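/- Let $m\ge 2$ be a fixed integer, let $1\le n=n_N\le N$ with $n/N\to0$ as $N\to\infty$, and write $k^{(m)}=\binom km$. For a random $m$-uniform hypergraph on $[N]$ with adjacency tensor $A$ (with $A_{i_1\ldots i_m}=0$ if two indices agree), let $\mathcal H_m(N,p)$ be the law under which all edges are present independently with probability $p$, and for $S\subset[N]$, $|S|=n$, let $\mathcal H_m(N,q;S,p_1)$ be the law under which edges are independent, present with probability $p_1$ if contained in $S$ and with probability $q$ otherwise. For $0<p_0<p_1<1$ put $$p_0'=\frac{N^{(m)}p_0-n^{(m)}p_1}{N^{(m)}-n^{(m)}}.$$ The parameters $(p_0,p_1)$ are unknown: let $\Theta_N$ be a set of pairs $(p_0,p_1)$ with $0<p_0<p_1<1$ and $p_0'>0$. Under $H_0$, $A\sim\mathcal H_m(N,p_0)$, and under $H_1$, $A\sim\mathcal H_m(N,p_0';S,p_1)$ for some $|S|=n$. A sequence of tests $T=T_N(A)\in\{0,1\}$, not depending on $(p_0,p_1)$ or $S$, is asymptotically powerful if $$\sup_{(p_0,p_1)\in\Theta_N}\mathbb P_{\mathcal H_m(N,p_0)}(T=1)+\sup_{(p_0,p_1)\in\Theta_N}\max_{|S|=n}\mathbb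 P_{\mathcal H_m(N,p_0';S,p_1)}(T=0)\to0 .$$ All conditions on $p_0,p_0',p_1$ below are meant for all large $N$ and uniformly over $(p_0,p_1)\in\Theta_N$. Suppose that $$\frac{\log N}{n^{m-1}}=o(1),\qquad \log\Bigl(1\vee\frac1{n^{m-1}p_0'}\Bigr)=o\Bigl(\log\frac Nn\Bigr).$$ Let $H_p(q)=q\log\frac qp+(1-q)\log\frac{1-q}{1-p}$ and $$\hat p_0=\frac{\sum_{i_1<\cdots<i_m}A_{i_1\ldots i_m}}{N^{(m)}},\qquad W_n=\max_{|S|=n}\ \sum_{\substack{i_1<\cdots<i_m\\ i_1,\ldots,i_m\in S}}A_{i_1\ldots i_m},\qquad W_{i_1*}=\sum_{i_2,\ldots,i_m\text{ pairwise distinct}}A_{i_1i_2\ldots i_m},$$ $$V_1=((m-1)!)^2(N-1)^{(m-1)}\frac{N^{(m)}}{N^{(m)}-1}\hat p_0(1-\hat p_0),\qquad V_2=\frac1{N-m!}\sum_{i=1}^N\bigl[W_{i*}-(m-1)!(N-1)^{(m-1)}\hat p_0\bigr]^2,$$ $$\mathcal T_1=\frac{V_2-V_1}{N^{(2m-3)/2}\,\hat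 p_0},\qquad \mathcal T_2=\frac{\sum_{i_1,\ldots,i_{m+1}\text{ pairwise distinct}}(A_{i_1\ldots i_m}-\hat p_0)(A_{i_2\ldots i_{m+1}}-\hat p_0)}{\sqrt{(m+1)!\,N^{(m+1)}\hat p_0^2(1-\hat p_0)^2}} .$$ (I) If $p_0N^m>2n$ and $$\liminf_{N\to\infty}\frac{(n-1)(n-2)\cdots(n-m+1)\,H_{p_0'}(p_1)}{m!\,\log\frac Nn}>1,$$ then the scan test that rejects $H_0$ when $W_n\ge n^{(m)}\hat a$ is asymptotically powerful, where $\hat a\in[\hat p_0,1]$ is the solution of $H_{\hat p_0}(\hat a)=n(\log\frac Nn+2)/n^{(m)}$ (the test does not reject if there is no solution). (II) If $\liminf N^{m-1}p_0>1$, $n\ge c\sqrt N$ for some constant $c>0$ and all large $N$, and $$\frac{p_1-p_0'}{\sqrt{p_0'}}\Bigl(\frac{n^2}N\Bigr)^{\frac{m+1}4}\to\infty,$$ then the loose 2-path test is asymptotically powerful: there are critical values $\tau_N$ such that the test rejecting when $\mathcal T_1>\tau_N$ is asymptotically powerful. (III) If $n=o(\sqrt N)$ and $\frac{p_1-p_0'}{\sqrt{p_0'}}\bigl(\frac{n^2}N\bigr)^{\frac{m+1}4}\to\infty$,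 then the tight 2-path test is asymptotically powerful: there are critical values $\tau_N$ such that the test rejecting when $\mathcal T_2>\tau_N$ is asymptotically powerful. -/

import Mathlib

open Filter Topology Asymptotics MeasureTheory
open scoped ENNReal Nat

noncomputable section

/-- The possible edges of an `m`-uniform hypergraph on `N` vertices: the `m`-element subsets of
the vertex set. -/
abbrev HEdge (m N : ℕ) : Type := {e : Finset (Fin N) // e.card = m}

/-- An `m`-uniform hypergraph on `N` vertices, as the indicator function of its edge set. -/
abbrev HGraph (m N : ℕ) : Type := HEdge m N → Bool

/-- The law of a random hypergraph with independent edges, `e` being present with probability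
`q e` (for `0 ≤ q e ≤ 1`). -/
def indepEdgeLaw {m N : ℕ} (q : HEdge m N → ℝ) : Measure (HGraph m N) :=
  Measure.pi fun e =>
    ProbabilityTheory.bernoulliMeasure true false (Set.projIcc (0 : ℝ) 1 zero_le_one (q e))

/-- The Erdős–Rényi law `H_m(N, p₀)`. -/
def nullLaw (m N : ℕ) (p₀ : ℝ) : Measure (HGraph m N) :=
  indepEdgeLaw fun _ => p₀

/-- The law `H_m(N, q; n, p₁)` with planted vertex set `S`: edges inside `S` have probability
`p₁`, all other edges have probability `q`. -/
def plantedLaw (m N : ℕ) (S : Finset (Fin N)) (q p₁ : ℝ) : Measure (HGraph m N) :=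
  indepEdgeLaw fun e => if e.1 ⊆ S then p₁ else q

/-- The worst-case risk of the test with rejection region `R`, for the composite null
`p₀ ∈ C₀` and the composite alternative `(q, p₁) ∈ C₁`, `|S| = n`. -/
def risk {m N : ℕ} (n : ℕ) (C₀ : Set ℝ) (C₁ : Set (ℝ × ℝ)) (R : Set (HGraph m N)) : ℝ≥0∞ :=
  (⨆ p₀ ∈ C₀, nullLaw m N p₀ R) +
    ⨆ q ∈ C₁, ⨆ S : Finset (Fin N), ⨆ _ : S.card = n, plantedLaw m N S q.1 q.2 Rᶜ

/-- The background probability `p₀'` for which `H_m(N, p₀'; n, p₁)` has the same expected number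
of edges as `H_m(N, p₀)`. -/
def matchedProb (m N n : ℕ) (p₀ p₁ : ℝ) : ℝ :=
  ((N.choose m : ℝ) * p₀ - (n.choose m : ℝ) * p₁) / ((N.choose m : ℝ) - (n.choose m : ℝ))

/-- A sequence of tests (rejection regions) is asymptotically powerful over the parameter sets
`Θ N ∋ (p₀, p₁)`: its worst-case risk tends to zero, where the null is `H_m(N, p₀)` and the
alternative is `H_m(N, p₀'; n, p₁)`, with `(p₀, p₁)` ranging over `Θ N`. -/
def AsympPowerful (m : ℕ) (n : ℕ → ℕ) (Θ : ℕ → Set (ℝ × ℝ))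
    (R : (N : ℕ) → Set (HGraph m N)) : Prop :=
  Tendsto
    (fun N => risk (n N) (Prod.fst '' Θ N)
      ((fun p : ℝ × ℝ => (matchedProb m N (n N) p.1 p.2, p.2)) '' Θ N) (R N))
    atTop (𝓝 0)

/-- `H_p(q)`, the Kullback–Leibler divergence between Bernoulli laws. -/
def bernKL (p q : ℝ) : ℝ :=
  q * Real.log (q / p) + (1 - q) * Real.log ((1 - q) / (1 - p))

/-- The adjacency tensor: `A.entry {i₁, …, i_m}` is `A_{i₁…i_m}`. It vanishes on sets that do not
have exactly `m` elements, that is, when two of the indices agree. -/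
def HGraph.entry {m N : ℕ} (A : HGraph m N) (e : Finset (Fin N)) : ℝ :=
  if h : e.card = m then (if A ⟨e, h⟩ = true then 1 else 0) else 0

/-- The edge density `p̂₀`. -/
def phat {m N : ℕ} (A : HGraph m N) : ℝ :=
  (∑ e ∈ Finset.univ.powersetCard m, A.entry e) / (N.choose m : ℝ)

/-- `W_S`, the number of edges inside `S`. -/
def edgesIn {m N : ℕ} (A : HGraph m N) (S : Finset (Fin N)) : ℕ :=
  (Finset.univ.filter fun e : HEdge m N => e.1 ⊆ S ∧ A e = true).card

/-- The scan statistic `W_n`: the largest number of edges inside a set of `n` vertices. -/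
def scanStat {m N : ℕ} (n : ℕ) (A : HGraph m N) : ℕ :=
  (Finset.univ.powersetCard n).sup (edgesIn A)

/-- The scan test with `p̂₀` plugged in. It rejects when
`W_n ≥ n^{(m)} a`, where `a = H_{p̂₀}⁻¹(n (log (N/n) + 2) / n^{(m)})` and `H_p⁻¹` is the inverse of
`H_p` on `[p, 1]`; it does not reject when this inverse does not exist. -/
def scanTest (m N n : ℕ) : Set (HGraph m N) :=
  {A | ∃ a ∈ Set.Icc (phat A) 1,
    bernKL (phat A) a =
      (n : ℝ) * (Real.log ((N : ℝ) / (n : ℝ)) + 2) / (n.choose m : ℝ) ∧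
    (n.choose m : ℝ) * a ≤ (scanStat n A : ℝ)}

/-- `W_{v*}`, the sum of `A_{v i₂ … i_m}` over pairwise distinct `i₂, …, i_m`. -/
def rowSum {m N : ℕ} (A : HGraph m N) (v : Fin N) : ℝ :=
  ∑ i : Fin (m - 1) ↪ Fin N, A.entry (insert v (Finset.univ.map i))

/-- `V₁`, the estimate of the null expectation of `V₂`. -/
def looseV₁ {m N : ℕ} (A : HGraph m N) : ℝ :=
  ((m - 1)! : ℝ) ^ 2 * ((N - 1).choose (m - 1) : ℝ) *
    ((N.choose m : ℝ) / ((N.choose m : ℝ) - 1)) * phat A * (1 - phat A)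

/-- `V₂`, the empirical variance of the `W_{v*}`. -/
def looseV₂ {m N : ℕ} (A : HGraph m N) : ℝ :=
  1 / ((N : ℝ) - (m ! : ℝ)) *
    ∑ v : Fin N, (rowSum A v - ((m - 1)! : ℝ) * ((N - 1).choose (m - 1) : ℝ) * phat A) ^ 2

/-- The loose 2-path statistic `T₁`. -/
def looseStat {m N : ℕ} (A : HGraph m N) : ℝ :=
  (looseV₂ A - looseV₁ A) / ((N : ℝ) ^ ((2 * (m : ℝ) - 3) / 2) * phat A)

/-- The tight 2-path statistic `T₂`; the sum runs over pairwise distinct `i₁, …, i_{m+1}`. -/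
def tightStat {m N : ℕ} (A : HGraph m N) : ℝ :=
  (∑ i : Fin (m + 1) ↪ Fin N,
      (A.entry (Finset.univ.image fun k : Fin m => i k.castSucc) - phat A) *
      (A.entry (Finset.univ.image fun k : Fin m => i k.succ) - phat A)) /
    Real.sqrt (((m + 1)! : ℝ) * (N.choose (m + 1) : ℝ) * phat A ^ 2 * (1 - phat A) ^ 2)

/-- The signal condition
`(p₁ - p₀') / √p₀' · (n² / N)^{(m+1)/4} → ∞`, uniformly over `(p₀, p₁) ∈ Θ N`. -/
def SignalDiverges (m : ℕ) (n : ℕ → ℕ) (Θ : ℕ → Set (ℝ × ℝ)) : Prop :=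
  ∀ K : ℝ, ∀ᶠ N in atTop, ∀ p ∈ Θ N,
    K ≤ (p.2 - matchedProb m N (n N) p.1 p.2) / Real.sqrt (matchedProb m N (n N) p.1 p.2) *
      ((n N : ℝ) ^ 2 / (N : ℝ)) ^ (((m : ℝ) + 1) / 4)

end

/-!
The three tests are handled by explicit non-asymptotic bounds for both error probabilities, which
are then shown to be small uniformly in the parameters. Throughout, `p₀ = p + r (q - p)`, where
`p = p₀'`, `q = p₁` and `r = binom(n, m) / binom(N, m)`, so that the expected edge density is the same
under both laws. The rate condition, used with exponent one, gives `p ≥ n / (N n^{m-1})`; hence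
`binom(N, m) p` is at least of order `N`, and `log(1/p) ≤ m log N`.

**The 2-path tests.** Up to normalization and lower-order terms, both statistics are quadratic
forms `∑_{e ≠ f} binom(|e ∩ f|, k) (A_e - p̂₀) (A_f - p̂₀)`, with `k = 1` for loose and `k = m - 1`
for tight paths: `binom(|e ∩ f|, k)` counts the `k`-sets common to `e` and `f`, so that the form is
the sum of squared `k`-degrees without its diagonal (`sum_sq_superset`, `pathForm`). For `m = 2` the
two forms coincide. The weights have constant row sums; therefore replacing `p̂₀` by `p₀` costs only
a multiple of `(p̂₀ - p₀)²` (`pathForm_eq`). Distinct edges being independent, the second moment of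
a centred form reduces to its matching pairs (`integral_offDiagForm_sq`). A planted set shifts the
mean by the order of `(q - p)² binom(n, k) binom(n - k, m - k)²` (`le_offDiagForm_signal`), and
Chebyshev's inequality shows that this dominates the fluctuations under both laws
(`nullLaw_pathForm_le`, `plantedLaw_pathForm_le`, `pathForm_separates`). As the signal-to-noise
ratio tends to infinity, the risk at a fixed critical value becomes small; critical values `τ_N`
that nearly minimize the risk then give a powerful sequence (`exists_asympPowerful_threshold`).

**The scan test.** Under the null law, changing `p̂₀` to `p₀` lowers the divergence at the critical
value from `n (log(N/n) + 2) / binom(n, m)` by at most `n / (2 binom(n, m))`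
(`critical_value_bounds`), and the Chernoff bound with a union bound over at most `(e N / n)^n` sets
leaves `exp(-n/2)` (`nullLaw_scanTest_le`). Under the planted law, let `x` be the frequency of edges
inside the planted set. The log-likelihood ratio `bernLLR p q x` is linear in `x` with mean
`bernKL p q`, and Chebyshev's inequality puts it above `(1 - η) bernKL p q`; it remains to compare
with the divergence of `x` from `p̂₀`. If `r (q - p)` is small against `p (1 - p)`, the base point
can be changed at the cost of `η bernKL p q`; otherwise `p̂₀` is of order at most `r (q - p)`, and
the divergence is at least of the order of `(q - p) log(N / n)`, more than is needed
(`le_bernKL_planted`, `plantedLaw_scanTest_compl_le`). The test rejects once the divergence of `x`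
from `p̂₀` reaches its critical level, by the intermediate value theorem.
-/

/-! ### Moments under laws with independent edges -/

/-- The indicator of the edge `e`, as a real number. -/
def HGraph.val {m N : ℕ} (A : HGraph m N) (e : HEdge m N) : ℝ := if A e = true then 1 else 0

section Moments

variable {m N : ℕ}

instance isProbabilityMeasure_indepEdgeLaw (q : HEdge m N → ℝ) :
    IsProbabilityMeasure (indepEdgeLaw q) := by
  unfold indepEdgeLaw; infer_instance

lemma integrable_hgraph (μ : Measure (HGraph m N)) [IsFiniteMeasure μ] (f : HGraph m N → ℝ) :
    Integrable f μ := Integrable.of_finite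

lemma integral_bernoulli {p : ℝ} (hp : p ∈ Set.Icc (0 : ℝ) 1) (g : Bool → ℝ) :
    ∫ b, g b ∂(ProbabilityTheory.bernoulliMeasure true false
      (Set.projIcc (0 : ℝ) 1 zero_le_one p)) = p * g true + (1 - p) * g false := by
  rw [Set.projIcc_of_mem zero_le_one hp, ProbabilityTheory.bernoulliMeasure_def,
    integral_add_measure (Integrable.of_finite) (Integrable.of_finite),
    integral_smul_nnreal_measure, integral_smul_nnreal_measure, integral_dirac, integral_dirac]
  simp [NNReal.smul_def]

lemma integral_prod_indepEdgeLaw {q : HEdge m N → ℝ} (hq : ∀ e, q e ∈ Set.Icc (0 : ℝ) 1)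
    (g : HEdge m N → Bool → ℝ) :
    ∫ A, ∏ e, g e (A e) ∂indepEdgeLaw q = ∏ e, (q e * g e true + (1 - q e) * g e false) := by
  unfold indepEdgeLaw
  rw [integral_fintype_prod_eq_prod (f := g)]
  exact Finset.prod_congr rfl fun e _ => integral_bernoulli (hq e) (g e)

/-- The `c`-th central moment of the Bernoulli law with parameter `p`. -/
def bernMoment (p : ℝ) (c : ℕ) : ℝ := p * (1 - p) ^ c + (1 - p) * (0 - p) ^ c

lemma bernMoment_zero (p : ℝ) : bernMoment p 0 = 1 := by simp [bernMoment]

lemma bernMoment_one (p : ℝ) : bernMoment p 1 = 0 := by simp [bernMoment]; ring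

lemma bernMoment_two (p : ℝ) : bernMoment p 2 = p * (1 - p) := by simp [bernMoment]; ring

lemma integral_prod_pow_centered {q : HEdge m N → ℝ} (hq : ∀ e, q e ∈ Set.Icc (0 : ℝ) 1)
    (c : HEdge m N → ℕ) :
    ∫ A, ∏ e, (A.val e - q e) ^ c e ∂indepEdgeLaw q = ∏ e, bernMoment (q e) (c e) := by
  have := integral_prod_indepEdgeLaw hq
    (fun e b => ((if b = true then (1 : ℝ) else 0) - q e) ^ c e)
  simpa [HGraph.val, bernMoment] using this

lemma integral_centered_mul {q : HEdge m N → ℝ} (hq : ∀ e, q e ∈ Set.Icc (0 : ℝ) 1)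
    (a b : HEdge m N) :
    ∫ A, (A.val a - q a) * (A.val b - q b) ∂indepEdgeLaw q =
      if a = b then q a * (1 - q a) else 0 := by
  have h := integral_prod_pow_centered hq
    (fun e => (if e = a then 1 else 0) + (if e = b then 1 else 0))
  simp only [pow_add, pow_ite, pow_one, pow_zero, Finset.prod_mul_distrib, Finset.prod_ite_eq',
    Finset.mem_univ, if_true] at h
  rw [h]
  split_ifs with hab
  · subst hab
    rw [Finset.prod_eq_single a (fun e _ he => by simp [he, bernMoment_zero]) (by simp)]
    simp [bernMoment_two]
  · refine Finset.prod_eq_zero (Finset.mem_univ a) ?_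
    simp [hab, bernMoment_one]

lemma integral_centered_mul_four {q : HEdge m N → ℝ} (hq : ∀ e, q e ∈ Set.Icc (0 : ℝ) 1)
    {a b c d : HEdge m N} (hab : a ≠ b) (hcd : c ≠ d) :
    ∫ A, (A.val a - q a) * (A.val b - q b) * ((A.val c - q c) * (A.val d - q d))
        ∂indepEdgeLaw q =
      (if a = c ∧ b = d then q a * (1 - q a) * (q b * (1 - q b)) else 0) +
      (if a = d ∧ b = c then q a * (1 - q a) * (q b * (1 - q b)) else 0) := by
  have h := integral_prod_pow_centered hq
    (fun e => ((if e = a then 1 else 0) + (if e = b then 1 else 0)) +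
      ((if e = c then 1 else 0) + (if e = d then 1 else 0)))
  simp only [pow_add, pow_ite, pow_one, pow_zero, Finset.prod_mul_distrib, Finset.prod_ite_eq',
    Finset.mem_univ, if_true] at h
  rw [h]
  have two : ∀ x y : HEdge m N, x ≠ y →
      (∏ e, bernMoment (q e) (((if e = x then 1 else 0) + (if e = y then 1 else 0)) +
        ((if e = x then 1 else 0) + (if e = y then 1 else 0)))) =
      q x * (1 - q x) * (q y * (1 - q y)) := by
    intro x y hxy
    rw [Finset.prod_eq_mul x y hxy (fun e _ he => by simp [he.1, he.2, bernMoment_zero])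
      (by simp) (by simp)]
    simp [hxy, hxy.symm, bernMoment_two]
  by_cases h1 : a = c ∧ b = d
  · obtain ⟨rfl, rfl⟩ := h1
    rw [two a b hab]
    simp [hab]
  by_cases h2 : a = d ∧ b = c
  · obtain ⟨rfl, rfl⟩ := h2
    rw [if_neg h1, if_pos ⟨rfl, rfl⟩, zero_add, ← two a b hab]
    refine Finset.prod_congr rfl fun e _ => ?_
    congr 1
    ring
  · rw [if_neg h1, if_neg h2, add_zero]
    -- one of the four indices occurs exactly once, and its factor is a first central moment
    by_cases hac : a = c
    · have hbd : b ≠ d := fun h => h1 ⟨hac, h⟩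
      have hbc : b ≠ c := fun h => hab (hac.trans h.symm)
      refine Finset.prod_eq_zero (Finset.mem_univ b) ?_
      simp [hab.symm, hbd, hbc, bernMoment_one]
    · by_cases had : a = d
      · have hbc : b ≠ c := fun h => h2 ⟨had, h⟩
        have hbd : b ≠ d := fun h => hab (had.trans h.symm)
        refine Finset.prod_eq_zero (Finset.mem_univ b) ?_
        simp [hab.symm, hbd, hbc, bernMoment_one]
      · refine Finset.prod_eq_zero (Finset.mem_univ a) ?_
        simp [hab, hac, had, bernMoment_one]

/-- Variance of a linear form in independent edge indicators. -/
lemma integral_linear_sq {q : HEdge m N → ℝ} (hq : ∀ e, q e ∈ Set.Icc (0 : ℝ) 1)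
    (c : HEdge m N → ℝ) :
    ∫ A, (∑ e, c e * (A.val e - q e)) ^ 2 ∂indepEdgeLaw q =
      ∑ e, c e ^ 2 * (q e * (1 - q e)) := by
  have h : ∀ A : HGraph m N, (∑ e, c e * (A.val e - q e)) ^ 2 =
      ∑ e, ∑ f, c e * c f * ((A.val e - q e) * (A.val f - q f)) := by
    intro A
    rw [sq, Finset.sum_mul_sum]
    exact Finset.sum_congr rfl fun e _ => Finset.sum_congr rfl fun f _ => by ring
  simp_rw [h]
  rw [integral_finsetSum _ fun e _ => integrable_hgraph _ _]
  refine Finset.sum_congr rfl fun e _ => ?_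
  rw [integral_finsetSum _ fun e _ => integrable_hgraph _ _]
  simp_rw [integral_const_mul, integral_centered_mul hq]
  simp
  exact Or.inl (by ring)

/-- The off-diagonal quadratic form with coefficients `w`. -/
def offDiagForm (w : HEdge m N → HEdge m N → ℝ) (y : HEdge m N → ℝ) : ℝ :=
  ∑ P ∈ (Finset.univ : Finset (HEdge m N)).offDiag, w P.1 P.2 * (y P.1 * y P.2)

/-- Second moment of a centred off-diagonal quadratic form in independent edge indicators: only
the products with matching pairs of edges contribute. -/
lemma integral_offDiagForm_sq {q : HEdge m N → ℝ} (hq : ∀ e, q e ∈ Set.Icc (0 : ℝ) 1)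
    {w : HEdge m N → HEdge m N → ℝ} (hw : ∀ e f, w e f = w f e) :
    ∫ A, offDiagForm w (fun e => A.val e - q e) ^ 2 ∂indepEdgeLaw q =
      2 * ∑ P ∈ (Finset.univ : Finset (HEdge m N)).offDiag,
        w P.1 P.2 ^ 2 * (q P.1 * (1 - q P.1) * (q P.2 * (1 - q P.2))) := by
  have h : ∀ A : HGraph m N, offDiagForm w (fun e => A.val e - q e) ^ 2 =
      ∑ P ∈ (Finset.univ : Finset (HEdge m N)).offDiag,
        ∑ Q ∈ (Finset.univ : Finset (HEdge m N)).offDiag,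
        w P.1 P.2 * w Q.1 Q.2 * ((A.val P.1 - q P.1) * (A.val P.2 - q P.2) *
          ((A.val Q.1 - q Q.1) * (A.val Q.2 - q Q.2))) := by
    intro A
    rw [sq, offDiagForm, Finset.sum_mul_sum]
    exact Finset.sum_congr rfl fun e _ => Finset.sum_congr rfl fun f _ => by ring
  simp_rw [h]
  rw [integral_finsetSum _ fun e _ => integrable_hgraph _ _, Finset.mul_sum]
  refine Finset.sum_congr rfl fun P hP => ?_
  rw [integral_finsetSum _ fun e _ => integrable_hgraph _ _]
  simp only [Finset.mem_offDiag, Finset.mem_univ, true_and] at hP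
  have key : ∀ Q ∈ (Finset.univ : Finset (HEdge m N)).offDiag,
      ∫ A : HGraph m N, w P.1 P.2 * w Q.1 Q.2 * ((A.val P.1 - q P.1) * (A.val P.2 - q P.2) *
          ((A.val Q.1 - q Q.1) * (A.val Q.2 - q Q.2))) ∂indepEdgeLaw q =
      (if Q = P then w P.1 P.2 ^ 2 * (q P.1 * (1 - q P.1) * (q P.2 * (1 - q P.2))) else 0) +
      (if Q = P.swap then w P.1 P.2 ^ 2 * (q P.1 * (1 - q P.1) * (q P.2 * (1 - q P.2)))
        else 0) := by
    intro Q hQ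
    simp only [Finset.mem_offDiag, Finset.mem_univ, true_and] at hQ
    rw [integral_const_mul, integral_centered_mul_four hq hP hQ]
    obtain ⟨a, b⟩ := P
    obtain ⟨c, d⟩ := Q
    simp only [Prod.mk.injEq, Prod.swap_prod_mk, mul_add]
    congr 1
    · by_cases h1 : a = c ∧ b = d
      · obtain ⟨rfl, rfl⟩ := h1
        simp
        exact Or.inl (by ring)
      · rw [if_neg h1, if_neg (fun h => h1 ⟨h.1.symm, h.2.symm⟩), mul_zero]
    · by_cases h1 : a = d ∧ b = c
      · obtain ⟨rfl, rfl⟩ := h1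
        simp [hw b a]
        exact Or.inl (by ring)
      · rw [if_neg h1, if_neg (fun h => h1 ⟨h.2.symm, h.1.symm⟩), mul_zero]
  rw [Finset.sum_congr rfl key, Finset.sum_add_distrib, Finset.sum_ite_eq', Finset.sum_ite_eq',
    if_pos (by simpa using hP), if_pos (by simpa using hP.symm)]
  ring

/-- Markov's inequality. -/
lemma measureReal_le_integral_div (μ : Measure (HGraph m N)) [IsFiniteMeasure μ]
    {f : HGraph m N → ℝ} (hf : ∀ A, 0 ≤ f A) {t : ℝ} (ht : 0 < t) :
    μ.real {A | t ≤ f A} ≤ (∫ A, f A ∂μ) / t := by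
  rw [le_div_iff₀ ht, mul_comm]
  exact mul_meas_ge_le_integral_of_nonneg (Eventually.of_forall hf) (integrable_hgraph _ _) t

end Moments

/-! ### Counting edges through a vertex set -/

section Counting

variable {m N : ℕ}

/-- The indicator that the edge `e` lies inside `S`. -/
def insideInd (S : Finset (Fin N)) (e : HEdge m N) : ℝ := if e.1 ⊆ S then 1 else 0

lemma insideInd_nonneg (S : Finset (Fin N)) (e : HEdge m N) : 0 ≤ insideInd S e := by
  unfold insideInd; split_ifs <;> norm_num

lemma insideInd_le_one (S : Finset (Fin N)) (e : HEdge m N) : insideInd S e ≤ 1 := by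
  unfold insideInd; split_ifs <;> norm_num

lemma insideInd_sq (S : Finset (Fin N)) (e : HEdge m N) : insideInd S e ^ 2 = insideInd S e := by
  unfold insideInd; split_ifs <;> norm_num

lemma card_edges_between {g S : Finset (Fin N)} (hgm : g.card ≤ m) (hgS : g ⊆ S) :
    (Finset.univ.filter fun e : HEdge m N => g ⊆ e.1 ∧ e.1 ⊆ S).card =
      (S.card - g.card).choose (m - g.card) := by
  rw [← Finset.card_sdiff_of_subset hgS, ← Finset.card_powersetCard]
  refine Finset.card_bij (fun e _ => e.1 \ g) ?_ ?_ ?_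
  · intro e he
    simp only [Finset.mem_filter, Finset.mem_univ, true_and] at he
    rw [Finset.mem_powersetCard, Finset.card_sdiff_of_subset he.1, e.2]
    exact ⟨Finset.sdiff_subset_sdiff he.2 subset_rfl, rfl⟩
  · intro e he f hf h
    simp only [Finset.mem_filter, Finset.mem_univ, true_and] at he hf
    apply Subtype.ext
    rw [← Finset.sdiff_union_of_subset he.1, ← Finset.sdiff_union_of_subset hf.1, h]
  · intro t ht
    rw [Finset.mem_powersetCard] at ht
    have hd : Disjoint t g := Finset.disjoint_of_subset_left ht.1 Finset.sdiff_disjoint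
    refine ⟨⟨t ∪ g, ?_⟩, ?_, ?_⟩
    · rw [Finset.card_union_of_disjoint hd, ht.2]; omega
    · simp only [Finset.mem_filter, Finset.mem_univ, true_and]
      exact ⟨Finset.subset_union_right,
        Finset.union_subset (ht.1.trans Finset.sdiff_subset) hgS⟩
    · exact Finset.union_sdiff_cancel_right hd

lemma sum_insideInd_superset {k n : ℕ} {g S : Finset (Fin N)} (hg : g.card = k) (hkm : k ≤ m)
    (hS : S.card = n) :
    ∑ e : HEdge m N with g ⊆ e.1, insideInd S e =
      if g ⊆ S then ((n - k).choose (m - k) : ℝ) else 0 := by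
  split_ifs with h
  · rw [← hg, ← hS, ← card_edges_between (hg.trans_le hkm) h, ← Finset.filter_filter,
      Finset.card_filter]
    push_cast
    exact Finset.sum_congr rfl fun e _ => rfl
  · refine Finset.sum_eq_zero fun e he => ?_
    simp only [Finset.mem_filter, Finset.mem_univ, true_and] at he
    exact if_neg fun h' => h (he.trans h')

lemma card_superset {k : ℕ} {g : Finset (Fin N)} (hg : g.card = k) (hkm : k ≤ m) :
    ((Finset.univ.filter fun e : HEdge m N => g ⊆ e.1).card : ℝ) = (N - k).choose (m - k) := by
  have := sum_insideInd_superset (m := m) (S := Finset.univ) hg hkm rfl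
  simpa [insideInd] using this

lemma sum_insideInd {n : ℕ} {S : Finset (Fin N)} (hS : S.card = n) :
    ∑ e : HEdge m N, insideInd S e = n.choose m := by
  have := sum_insideInd_superset (m := m) (g := ∅) (k := 0) rfl (Nat.zero_le m) hS
  simpa using this

lemma card_hedge : (Fintype.card (HEdge m N) : ℝ) = N.choose m := by
  simp

/-- The weight `binom(|e ∩ f|, k)`, the number of `k`-sets of vertices common to `e` and `f`. -/
def meetWeight (k : ℕ) (e f : HEdge m N) : ℝ := ((e.1 ∩ f.1).card.choose k : ℝ)

lemma meetWeight_comm (k : ℕ) (e f : HEdge m N) : meetWeight k e f = meetWeight k f e := by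
  rw [meetWeight, meetWeight, Finset.inter_comm]

lemma meetWeight_self (k : ℕ) (e : HEdge m N) : meetWeight k e e = m.choose k := by
  rw [meetWeight, Finset.inter_self, e.2]

lemma meetWeight_nonneg (k : ℕ) (e f : HEdge m N) : 0 ≤ meetWeight k e f := Nat.cast_nonneg _

lemma meetWeight_le (k : ℕ) (e f : HEdge m N) : meetWeight k e f ≤ m.choose k := by
  unfold meetWeight
  exact_mod_cast Nat.choose_le_choose k
    ((Finset.card_le_card Finset.inter_subset_left).trans_eq e.2)

lemma sum_meetWeight_mul (k : ℕ) (e : HEdge m N) (z : HEdge m N → ℝ) :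
    ∑ f, meetWeight k e f * z f =
      ∑ g ∈ e.1.powersetCard k, ∑ f : HEdge m N with g ⊆ f.1, z f := by
  simp_rw [Finset.sum_filter]
  rw [Finset.sum_comm]
  refine Finset.sum_congr rfl fun f _ => ?_
  rw [← Finset.sum_filter, Finset.sum_const, nsmul_eq_mul, meetWeight, ← Finset.card_powersetCard]
  congr 3
  ext g
  simp only [Finset.mem_powersetCard, Finset.mem_filter, Finset.subset_inter_iff]
  tauto

lemma sum_powersetCard_swap (k : ℕ) (y : HEdge m N → ℝ) (Z : Finset (Fin N) → ℝ) :
    ∑ e, y e * ∑ g ∈ e.1.powersetCard k, Z g =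
      ∑ g ∈ Finset.univ.powersetCard k, Z g * ∑ e : HEdge m N with g ⊆ e.1, y e := by
  simp_rw [Finset.mul_sum, Finset.sum_filter]
  rw [Finset.sum_comm]
  refine Finset.sum_congr rfl fun e _ => ?_
  rw [← Finset.sum_filter]
  refine Finset.sum_congr ?_ fun g _ => mul_comm _ _
  ext g
  simp only [Finset.mem_powersetCard, Finset.mem_filter, Finset.subset_univ, true_and]
  tauto

/-- The sum of squares of the generalized degrees of `y` is the quadratic form with weights
`meetWeight k`. -/
lemma sum_sq_superset (k : ℕ) (y : HEdge m N → ℝ) :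
    ∑ g ∈ Finset.univ.powersetCard k, (∑ e : HEdge m N with g ⊆ e.1, y e) ^ 2 =
      ∑ e, ∑ f, meetWeight k e f * (y e * y f) := by
  have : ∀ e, ∑ f, meetWeight k e f * (y e * y f) =
      y e * ∑ g ∈ e.1.powersetCard k, ∑ f : HEdge m N with g ⊆ f.1, y f := by
    intro e
    rw [← sum_meetWeight_mul, Finset.mul_sum]
    exact Finset.sum_congr rfl fun f _ => by ring
  simp_rw [this, sum_powersetCard_swap, sq]

lemma sum_offDiag_univ {ι : Type*} [Fintype ι] [DecidableEq ι] (F : ι → ι → ℝ) :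
    ∑ P ∈ (Finset.univ : Finset ι).offDiag, F P.1 P.2 = ∑ e, ∑ f, F e f - ∑ e, F e e := by
  rw [eq_sub_iff_add_eq, ← Finset.sum_diag (f := fun P : ι × ι => F P.1 P.2), add_comm,
    ← Finset.sum_union (Finset.disjoint_diag_offDiag _), Finset.diag_union_offDiag,
    Finset.sum_product]

lemma offDiagForm_meetWeight (k : ℕ) (y : HEdge m N → ℝ) :
    offDiagForm (meetWeight k) y =
      ∑ g ∈ Finset.univ.powersetCard k, (∑ e : HEdge m N with g ⊆ e.1, y e) ^ 2 -
        m.choose k * ∑ e, y e ^ 2 := by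
  rw [offDiagForm, sum_offDiag_univ (fun e f => meetWeight k e f * (y e * y f)), sum_sq_superset,
    Finset.mul_sum]
  simp_rw [meetWeight_self, sq]

/-- The coefficient of `x e` in the polarization of an off-diagonal form at `y`. -/
def offDiagRow (w : HEdge m N → HEdge m N → ℝ) (y : HEdge m N → ℝ) (e : HEdge m N) : ℝ :=
  ∑ f, w e f * y f - w e e * y e

lemma offDiagForm_add {w : HEdge m N → HEdge m N → ℝ} (hw : ∀ e f, w e f = w f e)
    (x y : HEdge m N → ℝ) :
    offDiagForm w (fun e => x e + y e) =
      offDiagForm w x + 2 * ∑ e, offDiagRow w y e * x e + offDiagForm w y := by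
  unfold offDiagForm offDiagRow
  rw [sum_offDiag_univ (fun e f => w e f * ((x e + y e) * (x f + y f))),
    sum_offDiag_univ (fun e f => w e f * (x e * x f)),
    sum_offDiag_univ (fun e f => w e f * (y e * y f))]
  have h1 : ∑ e, ∑ f, w e f * ((x e + y e) * (x f + y f)) =
      ∑ e, ∑ f, w e f * (x e * x f) + ∑ e, ∑ f, w e f * (x e * y f) +
        ∑ e, ∑ f, w e f * (y e * x f) + ∑ e, ∑ f, w e f * (y e * y f) := by
    simp_rw [← Finset.sum_add_distrib]
    exact Finset.sum_congr rfl fun e _ => Finset.sum_congr rfl fun f _ => by ring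
  have h2 : ∑ e, ∑ f, w e f * (y e * x f) = ∑ e, ∑ f, w e f * (x e * y f) := by
    rw [Finset.sum_comm]
    exact Finset.sum_congr rfl fun e _ => Finset.sum_congr rfl fun f _ => by rw [hw]; ring
  have h3 : ∑ e, w e e * ((x e + y e) * (x e + y e)) = ∑ e, w e e * (x e * x e) +
      2 * ∑ e, w e e * (x e * y e) + ∑ e, w e e * (y e * y e) := by
    simp_rw [Finset.mul_sum, ← Finset.sum_add_distrib]
    exact Finset.sum_congr rfl fun e _ => by ring
  have h4 : ∑ e, (∑ f, w e f * y f - w e e * y e) * x e =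
      ∑ e, ∑ f, w e f * (x e * y f) - ∑ e, w e e * (x e * y e) := by
    simp_rw [← Finset.sum_sub_distrib, sub_mul, Finset.sum_mul]
    exact Finset.sum_congr rfl fun e _ => by
      congr 1
      · exact Finset.sum_congr rfl fun f _ => by ring
      · ring
  rw [h1, h2, h3, h4]
  ring

lemma abs_offDiagRow_le {w : HEdge m N → HEdge m N → ℝ} (hw : ∀ e f, 0 ≤ w e f)
    (y : HEdge m N → ℝ) (e : HEdge m N) :
    |offDiagRow w y e| ≤ ∑ f, w e f * |y f| := by
  have h : offDiagRow w y e = ∑ f ∈ Finset.univ.erase e, w e f * y f := by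
    rw [offDiagRow, ← Finset.add_sum_erase _ _ (Finset.mem_univ e)]; ring
  rw [h]
  refine (Finset.abs_sum_le_sum_abs _ _).trans ?_
  calc ∑ f ∈ Finset.univ.erase e, |w e f * y f|
      = ∑ f ∈ Finset.univ.erase e, w e f * |y f| :=
        Finset.sum_congr rfl fun f _ => by rw [abs_mul, abs_of_nonneg (hw e f)]
    _ ≤ _ := Finset.sum_le_sum_of_subset_of_nonneg (Finset.erase_subset _ _)
        fun f _ _ => mul_nonneg (hw e f) (abs_nonneg _)

lemma sum_meetWeight {k : ℕ} (hkm : k ≤ m) (e : HEdge m N) :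
    ∑ f, meetWeight k e f = m.choose k * (N - k).choose (m - k) := by
  have h := sum_meetWeight_mul k e (fun _ => 1)
  simp only [mul_one] at h
  rw [h, Finset.sum_congr rfl (fun g hg => by
    rw [Finset.sum_const, nsmul_one, card_superset (Finset.mem_powersetCard.1 hg).2 hkm])]
  rw [Finset.sum_const, Finset.card_powersetCard, e.2, nsmul_eq_mul]

/-! ### The edge density and the quadratic forms -/

lemma HGraph.entry_coe (A : HGraph m N) (e : HEdge m N) : A.entry e.1 = A.val e := by
  unfold HGraph.entry HGraph.val
  rw [dif_pos e.2]

lemma HGraph.val_sq (A : HGraph m N) (e : HEdge m N) : A.val e ^ 2 = A.val e := by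
  unfold HGraph.val; split_ifs <;> norm_num

lemma HGraph.val_nonneg (A : HGraph m N) (e : HEdge m N) : 0 ≤ A.val e := by
  unfold HGraph.val; split_ifs <;> norm_num

lemma HGraph.val_le_one (A : HGraph m N) (e : HEdge m N) : A.val e ≤ 1 := by
  unfold HGraph.val; split_ifs <;> norm_num

lemma phat_eq (A : HGraph m N) : phat A = (∑ e, A.val e) / N.choose m := by
  unfold phat
  congr 1
  rw [Finset.sum_subtype (Finset.univ.powersetCard m) (p := fun e : Finset (Fin N) => e.card = m)
    (by simp [Finset.mem_powersetCard]) (fun e => A.entry e)]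
  exact Finset.sum_congr rfl fun e _ => A.entry_coe e

lemma sum_val (hmN : m ≤ N) (A : HGraph m N) : ∑ e, A.val e = N.choose m * phat A := by
  have : (N.choose m : ℝ) ≠ 0 := by exact_mod_cast (Nat.choose_pos hmN).ne'
  rw [phat_eq]; field_simp

lemma phat_nonneg (A : HGraph m N) : 0 ≤ phat A := by
  rw [phat_eq]
  exact div_nonneg (Finset.sum_nonneg fun e _ => A.val_nonneg e) (Nat.cast_nonneg _)

lemma phat_le_one (A : HGraph m N) : phat A ≤ 1 := by
  rw [phat_eq]
  refine div_le_one_of_le₀ ?_ (Nat.cast_nonneg _)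
  calc ∑ e, A.val e ≤ ∑ _e : HEdge m N, (1 : ℝ) := Finset.sum_le_sum fun e _ => A.val_le_one e
    _ = N.choose m := by rw [← card_hedge]; simp

lemma sum_val_sub_phat_sq (hmN : m ≤ N) (A : HGraph m N) :
    ∑ e, (A.val e - phat A) ^ 2 = N.choose m * phat A * (1 - phat A) := by
  simp_rw [sub_sq, HGraph.val_sq]
  rw [Finset.sum_add_distrib, Finset.sum_sub_distrib, ← Finset.sum_mul, ← Finset.mul_sum,
    sum_val hmN]
  simp only [Finset.sum_const, Finset.card_univ, nsmul_eq_mul, card_hedge]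
  ring

/-- The quadratic form centred at the estimated density. -/
noncomputable def pathForm (k : ℕ) (A : HGraph m N) : ℝ :=
  offDiagForm (meetWeight k) fun e => A.val e - phat A

/-- Replacing the estimated density by a fixed `p₀` costs a multiple of the squared estimation
error, because the weights have constant row sums. -/
lemma pathForm_eq {k : ℕ} (hkm : k ≤ m) (hmN : m ≤ N) (A : HGraph m N) (p₀ : ℝ) :
    pathForm k A = offDiagForm (meetWeight k) (fun e => A.val e - p₀) -
      N.choose m * (m.choose k * ((N - k).choose (m - k) - 1)) * (phat A - p₀) ^ 2 := by
  have h := offDiagForm_add (meetWeight_comm (m := m) (N := N) k) (fun e => A.val e - p₀)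
    (fun _ => p₀ - phat A)
  have hrow : ∀ e : HEdge m N, offDiagRow (meetWeight k) (fun _ => p₀ - phat A) e =
      m.choose k * ((N - k).choose (m - k) - 1) * (p₀ - phat A) := by
    intro e
    rw [offDiagRow, ← Finset.sum_mul, sum_meetWeight hkm, meetWeight_self]; ring
  have hconst : offDiagForm (meetWeight (m := m) (N := N) k) (fun _ => p₀ - phat A) =
      N.choose m * (m.choose k * ((N - k).choose (m - k) - 1)) * (p₀ - phat A) ^ 2 := by
    rw [offDiagForm, sum_offDiag_univ (fun e f => meetWeight k e f *
      ((p₀ - phat A) * (p₀ - phat A)))]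
    simp_rw [← Finset.sum_mul, sum_meetWeight hkm, meetWeight_self]
    simp only [Finset.sum_const, Finset.card_univ, nsmul_eq_mul, card_hedge]
    ring
  have hs : ∑ e, (A.val e - p₀) = N.choose m * (phat A - p₀) := by
    rw [Finset.sum_sub_distrib, sum_val hmN]
    simp only [Finset.sum_const, Finset.card_univ, nsmul_eq_mul, card_hedge]
    ring
  simp_rw [hrow, hconst, ← Finset.mul_sum, hs] at h
  rw [pathForm]
  simp only [sub_add_sub_cancel] at h
  rw [h]; ring

lemma pathForm_eq_zero {k : ℕ} (hmN : m ≤ N) {A : HGraph m N}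
    (h : phat A * (1 - phat A) = 0) : pathForm k A = 0 := by
  have h2 := sum_val_sub_phat_sq hmN A
  rw [mul_assoc, h, mul_zero, Finset.sum_eq_zero_iff_of_nonneg fun e _ => sq_nonneg _] at h2
  rw [pathForm, offDiagForm]
  refine Finset.sum_eq_zero fun P _ => ?_
  rw [pow_eq_zero_iff two_ne_zero |>.1 (h2 P.1 (Finset.mem_univ _))]
  ring

end Counting

/-! ### Mean and variance of the quadratic forms under a planted set -/

section PlantedMoments

variable {m N : ℕ}

/-- The edge probabilities of the planted law: `p + D` inside `S` and `p` elsewhere. -/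
def plantedProb (S : Finset (Fin N)) (p D : ℝ) (e : HEdge m N) : ℝ := p + D * insideInd S e

lemma plantedLaw_eq (S : Finset (Fin N)) (p q : ℝ) :
    plantedLaw m N S p q = indepEdgeLaw (plantedProb S p (q - p)) := by
  unfold plantedLaw plantedProb insideInd
  congr 1
  funext e
  split_ifs <;> ring

lemma nullLaw_eq (p : ℝ) : nullLaw m N p = indepEdgeLaw (plantedProb ∅ p 0) := by
  unfold nullLaw plantedProb
  simp

lemma plantedProb_mem (S : Finset (Fin N)) {p D : ℝ} (hp : 0 ≤ p) (hD : 0 ≤ D) (hpD : p + D ≤ 1)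
    (e : HEdge m N) : plantedProb S p D e ∈ Set.Icc (0 : ℝ) 1 := by
  have h0 := insideInd_nonneg S e
  have h1 := insideInd_le_one S e
  unfold plantedProb
  exact ⟨by positivity, by nlinarith⟩

lemma choose_mul_choose_cast {N m k : ℕ} (hkm : k ≤ m) :
    (N.choose m : ℝ) * m.choose k = N.choose k * (N - k).choose (m - k) := by
  exact_mod_cast Nat.choose_mul hkm

lemma sum_superset_planted {k n : ℕ} (hkm : k ≤ m) {S : Finset (Fin N)} (hS : S.card = n)
    (p D : ℝ) {g : Finset (Fin N)} (hg : g.card = k) :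
    ∑ e : HEdge m N with g ⊆ e.1, plantedProb S p D e =
      p * (N - k).choose (m - k) + D * if g ⊆ S then ((n - k).choose (m - k) : ℝ) else 0 := by
  unfold plantedProb
  rw [Finset.sum_add_distrib, ← Finset.mul_sum, sum_insideInd_superset hg hkm hS,
    Finset.sum_const, nsmul_eq_mul, card_superset hg hkm]
  ring

lemma sum_powersetCard_ite {k n : ℕ} {S : Finset (Fin N)} (hS : S.card = n) (x : ℝ) :
    ∑ g ∈ (Finset.univ : Finset (Fin N)).powersetCard k, (if g ⊆ S then x else 0) =
      n.choose k * x := by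
  rw [← Finset.sum_filter, Finset.sum_const, nsmul_eq_mul, ← hS, ← Finset.card_powersetCard]
  congr 3
  ext g
  simp only [Finset.mem_powersetCard, Finset.mem_filter, Finset.subset_univ, true_and]
  tauto

lemma sum_powersetCard_const (k : ℕ) (x : ℝ) :
    ∑ _g ∈ (Finset.univ : Finset (Fin N)).powersetCard k, x = N.choose k * x := by
  rw [Finset.sum_const, nsmul_eq_mul, Finset.card_powersetCard, Finset.card_fin]

/-- The planted set contributes order `D² binom(n,k) binom(n-k,m-k)²` to the mean of the quadratic
form, even after centring at the matched edge density. -/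
lemma le_offDiagForm_signal {k n : ℕ} (hkm : k ≤ m) (hmN : m ≤ N)
    {S : Finset (Fin N)} (hS : S.card = n) (D : ℝ)
    (ha : 8 ≤ ((n - k).choose (m - k) : ℝ)) (hal : 2 * (n.choose k : ℝ) ≤ N.choose k) :
    D ^ 2 * n.choose k * (n - k).choose (m - k) ^ 2 / 8 ≤
      offDiagForm (meetWeight (m := m) (N := N) k)
        (fun e => D * (insideInd S e - n.choose m / N.choose m)) := by
  have hM : (0 : ℝ) < N.choose m := by exact_mod_cast Nat.choose_pos hmN
  have hbe : (0 : ℝ) < N.choose k := by exact_mod_cast Nat.choose_pos (hkm.trans hmN)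
  have e1 := choose_mul_choose_cast (N := N) hkm
  have e2 := choose_mul_choose_cast (N := n) hkm
  have hnN : n ≤ N := by rw [← hS]; simpa using Finset.card_le_univ S
  have hGM : (n.choose m : ℝ) / N.choose m ≤ 1 := by
    rw [div_le_one hM]; exact_mod_cast Nat.choose_le_choose m hnN
  have hG : (0 : ℝ) ≤ n.choose m := Nat.cast_nonneg _
  have hMr : (N.choose m : ℝ) * (n.choose m / N.choose m) = n.choose m := by field_simp
  set r : ℝ := n.choose m / N.choose m with hr
  have hr0 : 0 ≤ r := by positivity
  set a : ℝ := ((n - k).choose (m - k) : ℝ)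
  set b : ℝ := ((N - k).choose (m - k) : ℝ)
  have hal0 : (0 : ℝ) ≤ n.choose k := Nat.cast_nonneg _
  have hrb : 2 * (r * b) ≤ a := by
    have h1 : r * b * N.choose k = n.choose k * a := by
      rw [← e2, ← hMr]; linear_combination (-r) * e1
    nlinarith
  rw [offDiagForm_meetWeight]
  have h1 : ∀ g ∈ (Finset.univ : Finset (Fin N)).powersetCard k,
      (if g ⊆ S then D ^ 2 * (a / 2) ^ 2 else 0) ≤
      (∑ e : HEdge m N with g ⊆ e.1, D * (insideInd S e - r)) ^ 2 := by
    intro g hg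
    have hgk := (Finset.mem_powersetCard.1 hg).2
    split_ifs with h
    · rw [← Finset.mul_sum, Finset.sum_sub_distrib, sum_insideInd_superset hgk hkm hS, if_pos h,
        Finset.sum_const, nsmul_eq_mul, card_superset hgk hkm, mul_pow]
      refine mul_le_mul_of_nonneg_left ?_ (sq_nonneg _)
      refine pow_le_pow_left₀ (by linarith) ?_ 2
      change a / 2 ≤ a - b * r
      linarith
    · positivity
  have h2 := Finset.sum_le_sum h1
  rw [sum_powersetCard_ite hS] at h2
  have h3 : ∑ e : HEdge m N, (D * (insideInd S e - r)) ^ 2 ≤ D ^ 2 * n.choose m := by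
    simp_rw [mul_pow, sub_sq, insideInd_sq]
    rw [← Finset.mul_sum, Finset.sum_add_distrib, Finset.sum_sub_distrib, ← Finset.sum_mul,
      ← Finset.mul_sum, sum_insideInd hS]
    simp only [Finset.sum_const, Finset.card_univ, nsmul_eq_mul, card_hedge]
    refine mul_le_mul_of_nonneg_left ?_ (sq_nonneg _)
    nlinarith
  have hc : (0 : ℝ) ≤ m.choose k := Nat.cast_nonneg _
  have h4 : (m.choose k : ℝ) * ∑ e : HEdge m N, (D * (insideInd S e - r)) ^ 2 ≤
      D ^ 2 * (n.choose k * a) := by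
    calc _ ≤ (m.choose k : ℝ) * (D ^ 2 * n.choose m) := mul_le_mul_of_nonneg_left h3 hc
      _ = _ := by rw [← e2]; ring
  have h5 : 0 ≤ D ^ 2 * n.choose k * (a * (a - 8)) := by
    have : 0 ≤ a - 8 := by linarith
    positivity
  nlinarith

lemma plantedProb_var_le (S : Finset (Fin N)) {p D : ℝ} (hp : 0 ≤ p) (hD : 0 ≤ D)
    (hpD : p + D ≤ 1) (e : HEdge m N) :
    0 ≤ plantedProb S p D e * (1 - plantedProb S p D e) ∧
    plantedProb S p D e * (1 - plantedProb S p D e) ≤ plantedProb S p D e := by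
  obtain ⟨h0, h1⟩ := plantedProb_mem S hp hD hpD e
  exact ⟨mul_nonneg h0 (by linarith), by nlinarith⟩

lemma sum_offDiag_var_le {k n : ℕ} (hkm : k ≤ m) {S : Finset (Fin N)}
    (hS : S.card = n) {p D : ℝ} (hp : 0 ≤ p) (hD : 0 ≤ D) (hpD : p + D ≤ 1) :
    ∑ P ∈ (Finset.univ : Finset (HEdge m N)).offDiag, meetWeight k P.1 P.2 ^ 2 *
      (plantedProb S p D P.1 * (1 - plantedProb S p D P.1) *
        (plantedProb S p D P.2 * (1 - plantedProb S p D P.2))) ≤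
    2 * m.choose k * (p ^ 2 * N.choose k * (N - k).choose (m - k) ^ 2 +
      D ^ 2 * n.choose k * (n - k).choose (m - k) ^ 2) := by
  have hv := fun e => plantedProb_var_le (m := m) S hp hD hpD e
  have hq := fun e => (plantedProb_mem (m := m) S hp hD hpD e).1
  have hc : (0 : ℝ) ≤ m.choose k := Nat.cast_nonneg _
  calc _ ≤ ∑ P ∈ (Finset.univ : Finset (HEdge m N)).offDiag, m.choose k *
        (meetWeight k P.1 P.2 * (plantedProb S p D P.1 * plantedProb S p D P.2)) := by
        refine Finset.sum_le_sum fun P _ => ?_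
        rw [sq, mul_assoc]
        refine mul_le_mul (meetWeight_le k _ _) ?_ (mul_nonneg (meetWeight_nonneg _ _ _)
          (mul_nonneg (hv _).1 (hv _).1)) hc
        exact mul_le_mul_of_nonneg_left
          (mul_le_mul (hv _).2 (hv _).2 (hv _).1 (hq _)) (meetWeight_nonneg _ _ _)
    _ ≤ m.choose k * ∑ e : HEdge m N, ∑ f, meetWeight k e f *
          (plantedProb S p D e * plantedProb S p D f) := by
        rw [← Finset.mul_sum]
        refine mul_le_mul_of_nonneg_left ?_ hc
        rw [sum_offDiag_univ fun e f => meetWeight k e f *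
          (plantedProb (m := m) S p D e * plantedProb S p D f)]
        have : 0 ≤ ∑ e : HEdge m N, meetWeight k e e *
            (plantedProb S p D e * plantedProb S p D e) :=
          Finset.sum_nonneg fun e _ => mul_nonneg (meetWeight_nonneg _ _ _)
            (mul_nonneg (hq _) (hq _))
        linarith
    _ ≤ _ := by
        rw [← sum_sq_superset, mul_comm (2 : ℝ), mul_assoc]
        refine mul_le_mul_of_nonneg_left ?_ hc
        have : ∀ g ∈ (Finset.univ : Finset (Fin N)).powersetCard k,
            (∑ e : HEdge m N with g ⊆ e.1, plantedProb S p D e) ^ 2 ≤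
            2 * (p ^ 2 * (N - k).choose (m - k) ^ 2 +
              if g ⊆ S then D ^ 2 * ((n - k).choose (m - k) : ℝ) ^ 2 else 0) := by
          intro g hg
          rw [sum_superset_planted hkm hS p D (Finset.mem_powersetCard.1 hg).2]
          refine add_sq_le.trans (le_of_eq ?_)
          split_ifs <;> ring
        refine (Finset.sum_le_sum this).trans (le_of_eq ?_)
        rw [← Finset.mul_sum, Finset.sum_add_distrib, sum_powersetCard_const,
          sum_powersetCard_ite hS]
        ring

lemma offDiagRow_sq_le {k n : ℕ} (hkm : k ≤ m) {S : Finset (Fin N)}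
    (hS : S.card = n) {D r : ℝ} (hD : 0 ≤ D) (hr : 0 ≤ r) (e : HEdge m N) :
    offDiagRow (meetWeight k) (fun f => D * (insideInd S f - r)) e ^ 2 ≤
      2 * D ^ 2 * m.choose k * ∑ g ∈ e.1.powersetCard k,
        ((if g ⊆ S then ((n - k).choose (m - k) : ℝ) ^ 2 else 0) +
          r ^ 2 * (N - k).choose (m - k) ^ 2) := by
  set a : ℝ := ((n - k).choose (m - k) : ℝ)
  set b : ℝ := ((N - k).choose (m - k) : ℝ)
  have h1 : |offDiagRow (meetWeight k) (fun f => D * (insideInd S f - r)) e| ≤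
      ∑ g ∈ e.1.powersetCard k, D * ((if g ⊆ S then a else 0) + r * b) := by
    refine (abs_offDiagRow_le (meetWeight_nonneg k) _ e).trans ?_
    rw [sum_meetWeight_mul]
    refine Finset.sum_le_sum fun g hg => ?_
    have hgk := (Finset.mem_powersetCard.1 hg).2
    calc ∑ f : HEdge m N with g ⊆ f.1, |D * (insideInd S f - r)|
        ≤ ∑ f : HEdge m N with g ⊆ f.1, D * (insideInd S f + r) := by
          refine Finset.sum_le_sum fun f _ => ?_
          rw [abs_mul, abs_of_nonneg hD]
          refine mul_le_mul_of_nonneg_left ?_ hD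
          have := insideInd_nonneg S f
          rw [abs_le]; constructor <;> linarith
      _ = _ := by
          rw [← Finset.mul_sum, Finset.sum_add_distrib, sum_insideInd_superset hgk hkm hS,
            Finset.sum_const, nsmul_eq_mul, card_superset hgk hkm]
          ring
  rw [← sq_abs]
  calc _ ≤ (∑ g ∈ e.1.powersetCard k, D * ((if g ⊆ S then a else 0) + r * b)) ^ 2 :=
        pow_le_pow_left₀ (abs_nonneg _) h1 2
    _ ≤ (e.1.powersetCard k).card * ∑ g ∈ e.1.powersetCard k,
          (D * ((if g ⊆ S then a else 0) + r * b)) ^ 2 := sq_sum_le_card_mul_sum_sq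
    _ ≤ (e.1.powersetCard k).card * ∑ g ∈ e.1.powersetCard k,
          2 * D ^ 2 * ((if g ⊆ S then a ^ 2 else 0) + r ^ 2 * b ^ 2) := by
        refine mul_le_mul_of_nonneg_left (Finset.sum_le_sum fun g _ => ?_) (Nat.cast_nonneg _)
        rw [mul_pow]
        have : ((if g ⊆ S then a else 0) + r * b) ^ 2 ≤
            2 * ((if g ⊆ S then a ^ 2 else 0) + r ^ 2 * b ^ 2) := by
          refine add_sq_le.trans (le_of_eq ?_)
          split_ifs <;> ring
        nlinarith [sq_nonneg D]
    _ = _ := by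
        rw [Finset.card_powersetCard, e.2, ← Finset.mul_sum]
        ring

lemma sum_offDiagRow_sq_le {k n : ℕ} (hkm : k ≤ m) (hmN : m ≤ N)
    {S : Finset (Fin N)} (hS : S.card = n) {p D : ℝ} (hp : 0 ≤ p) (hD : 0 ≤ D)
    (hpD : p + D ≤ 1) :
    ∑ e : HEdge m N, offDiagRow (meetWeight k)
        (fun f => D * (insideInd S f - n.choose m / N.choose m)) e ^ 2 *
        (plantedProb S p D e * (1 - plantedProb S p D e)) ≤
      4 * m.choose k * (D ^ 2 * n.choose k * (n - k).choose (m - k) ^ 2) *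
        (p * (N - k).choose (m - k) + D * (n - k).choose (m - k)) := by
  have hv := fun e => plantedProb_var_le (m := m) S hp hD hpD e
  have hM : (0 : ℝ) < N.choose m := by exact_mod_cast Nat.choose_pos hmN
  have hbe : (0 : ℝ) < N.choose k := by exact_mod_cast Nat.choose_pos (hkm.trans hmN)
  have e1 := choose_mul_choose_cast (N := N) hkm
  have e2 := choose_mul_choose_cast (N := n) hkm
  have hnN : n ≤ N := by rw [← hS]; simpa using Finset.card_le_univ S
  have hMr : (N.choose m : ℝ) * (n.choose m / N.choose m) = n.choose m := by field_simp
  set r : ℝ := n.choose m / N.choose m with hr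
  have hr0 : 0 ≤ r := by positivity
  have halbe : (n.choose k : ℝ) ≤ N.choose k := by exact_mod_cast Nat.choose_le_choose k hnN
  set a : ℝ := ((n - k).choose (m - k) : ℝ) with ha
  set b : ℝ := ((N - k).choose (m - k) : ℝ) with hb
  have ha0 : 0 ≤ a := Nat.cast_nonneg _
  have hb0 : 0 ≤ b := Nat.cast_nonneg _
  set al : ℝ := (n.choose k : ℝ)
  set be : ℝ := (N.choose k : ℝ)
  have hal0 : (0 : ℝ) ≤ al := Nat.cast_nonneg _
  have hc : (0 : ℝ) ≤ m.choose k := Nat.cast_nonneg _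
  have hrb : r * b * be = al * a := by
    rw [← e2, ← hMr]; linear_combination (-r) * e1
  have hrba : r * b ≤ a := by
    have : r * b * be ≤ a * be := by rw [hrb]; nlinarith
    exact le_of_mul_le_mul_right this hbe
  calc _ ≤ ∑ e : HEdge m N, plantedProb S p D e * (2 * D ^ 2 * m.choose k *
        ∑ g ∈ e.1.powersetCard k, ((if g ⊆ S then a ^ 2 else 0) + r ^ 2 * b ^ 2)) := by
        refine Finset.sum_le_sum fun e _ => ?_
        exact (mul_le_mul (offDiagRow_sq_le hkm hS hD hr0 e) (hv e).2 (hv e).1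
          ((sq_nonneg _).trans (offDiagRow_sq_le hkm hS hD hr0 e))).trans_eq (mul_comm _ _)
    _ = 2 * D ^ 2 * m.choose k * ∑ e : HEdge m N, plantedProb S p D e *
        ∑ g ∈ e.1.powersetCard k, ((if g ⊆ S then a ^ 2 else 0) + r ^ 2 * b ^ 2) := by
        rw [Finset.mul_sum]
        exact Finset.sum_congr rfl fun e _ => by ring
    _ = 2 * D ^ 2 * m.choose k * ∑ g ∈ (Finset.univ : Finset (Fin N)).powersetCard k,
        ((r ^ 2 * b ^ 2 * (p * b)) +
          if g ⊆ S then a ^ 2 * (p * b + D * a) + r ^ 2 * b ^ 2 * (D * a) else 0) := by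
        rw [sum_powersetCard_swap]
        congr 1
        refine Finset.sum_congr rfl fun g hg => ?_
        rw [sum_superset_planted hkm hS p D (Finset.mem_powersetCard.1 hg).2]
        split_ifs <;> ring
    _ = 2 * D ^ 2 * m.choose k * ((r * b) * (r * b * be) * (p * b) +
          al * (a ^ 2 * (p * b + D * a) + (r * b) ^ 2 * (D * a))) := by
        rw [Finset.sum_add_distrib, sum_powersetCard_const, sum_powersetCard_ite hS]
        ring
    _ ≤ 2 * D ^ 2 * m.choose k * (a * (al * a) * (p * b) +
          al * (a ^ 2 * (p * b + D * a) + a ^ 2 * (D * a))) := by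
        have hrb0 : 0 ≤ r * b := by positivity
        rw [hrb]
        gcongr
    _ = _ := by ring

/-- Variance bound for the quadratic form centred at the matched density. -/
lemma integral_offDiagForm_sub_sq_le {k n : ℕ} (hkm : k ≤ m) (hmN : m ≤ N)
    {S : Finset (Fin N)} (hS : S.card = n) {p D : ℝ} (hp : 0 ≤ p) (hD : 0 ≤ D)
    (hpD : p + D ≤ 1) :
    ∫ A, (offDiagForm (meetWeight k)
          (fun e => A.val e - (p + n.choose m / N.choose m * D)) -
        offDiagForm (meetWeight (m := m) k)
          (fun e => D * (insideInd S e - n.choose m / N.choose m))) ^ 2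
        ∂indepEdgeLaw (plantedProb (m := m) S p D) ≤
      8 * m.choose k * (p ^ 2 * N.choose k * (N - k).choose (m - k) ^ 2 +
        D ^ 2 * n.choose k * (n - k).choose (m - k) ^ 2) +
      32 * m.choose k * (D ^ 2 * n.choose k * (n - k).choose (m - k) ^ 2) *
        (p * (N - k).choose (m - k) + D * (n - k).choose (m - k)) := by
  have hq := plantedProb_mem (m := m) S hp hD hpD
  set r : ℝ := n.choose m / N.choose m with hr
  have hexp : ∀ A : HGraph m N, (offDiagForm (meetWeight k) (fun e => A.val e - (p + r * D)) -
      offDiagForm (meetWeight (m := m) k) (fun e => D * (insideInd S e - r))) ^ 2 ≤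
      2 * offDiagForm (meetWeight k) (fun e => A.val e - plantedProb S p D e) ^ 2 +
      8 * (∑ e, offDiagRow (meetWeight k) (fun f => D * (insideInd S f - r)) e *
        (A.val e - plantedProb S p D e)) ^ 2 := by
    intro A
    have h := offDiagForm_add (meetWeight_comm (m := m) (N := N) k)
      (fun e => A.val e - plantedProb S p D e) (fun e => D * (insideInd S e - r))
    have h2 : (fun e => A.val e - plantedProb S p D e + D * (insideInd S e - r)) =
        fun e => A.val e - (p + r * D) := by
      funext e; unfold plantedProb; ring
    rw [h2] at h
    rw [h, add_sub_cancel_right]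
    refine add_sq_le.trans (le_of_eq ?_)
    ring
  refine (integral_mono (integrable_hgraph _ _) (integrable_hgraph _ _) hexp).trans ?_
  rw [integral_add (integrable_hgraph _ _) (integrable_hgraph _ _), integral_const_mul,
    integral_const_mul, integral_offDiagForm_sq hq (meetWeight_comm k), integral_linear_sq hq]
  have h1 := sum_offDiag_var_le (m := m) hkm hS hp hD hpD
  have h2 := sum_offDiagRow_sq_le (m := m) hkm hmN hS hp hD hpD
  rw [← hr] at h2
  linarith

/-- Second moment of the error of the estimated density. -/
lemma integral_phat_sub_sq_le (hmN : m ≤ N) {q : HEdge m N → ℝ}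
    (hq : ∀ e, q e ∈ Set.Icc (0 : ℝ) 1) {p₀ : ℝ} (hsum : ∑ e, q e = N.choose m * p₀) :
    ∫ A, (phat A - p₀) ^ 2 ∂indepEdgeLaw q ≤ p₀ * (1 - p₀) / N.choose m := by
  have hM : (0 : ℝ) < N.choose m := by exact_mod_cast Nat.choose_pos hmN
  have h1 : ∀ A : HGraph m N, (phat A - p₀) ^ 2 =
      (∑ e, (1 / (N.choose m : ℝ)) * (A.val e - q e)) ^ 2 := by
    intro A
    rw [← Finset.mul_sum, Finset.sum_sub_distrib, hsum, sum_val hmN]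
    congr 1
    field_simp
  simp_rw [h1]
  rw [integral_linear_sq hq, ← Finset.mul_sum]
  have h2 : (∑ e, q e) ^ 2 ≤ N.choose m * ∑ e, q e ^ 2 := by
    rw [← card_hedge]; exact sq_sum_le_card_mul_sum_sq
  have h3 : ∑ e, q e * (1 - q e) = N.choose m * p₀ - ∑ e, q e ^ 2 := by
    rw [← hsum, ← Finset.sum_sub_distrib]
    exact Finset.sum_congr rfl fun e _ => by ring
  rw [hsum] at h2
  have h4 : (N.choose m : ℝ) * p₀ ^ 2 ≤ ∑ e, q e ^ 2 := by
    refine le_of_mul_le_mul_left ?_ hM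
    linarith
  rw [h3, one_div, inv_pow, inv_mul_eq_div, div_le_div_iff₀ (by positivity) hM]
  nlinarith [mul_le_mul_of_nonneg_right h4 hM.le]

lemma sum_plantedProb {n : ℕ} (hmN : m ≤ N) {S : Finset (Fin N)} (hS : S.card = n) (p D : ℝ) :
    ∑ e : HEdge m N, plantedProb S p D e =
      N.choose m * (p + n.choose m / N.choose m * D) := by
  have hM : (0 : ℝ) < N.choose m := by exact_mod_cast Nat.choose_pos hmN
  unfold plantedProb
  rw [Finset.sum_add_distrib, ← Finset.mul_sum, sum_insideInd hS]
  simp only [Finset.sum_const, Finset.card_univ, nsmul_eq_mul, card_hedge]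
  field_simp

end PlantedMoments

/-! ### Error probabilities of the quadratic tests -/

section QuadraticTest

variable {m N : ℕ}

lemma measureReal_phat_sub_sq_ge (hmN : m ≤ N) {q : HEdge m N → ℝ}
    (hq : ∀ e, q e ∈ Set.Icc (0 : ℝ) 1) {p₀ : ℝ} (hsum : ∑ e, q e = N.choose m * p₀)
    {t : ℝ} (ht : 0 < t) :
    (indepEdgeLaw q).real {A | t ≤ (phat A - p₀) ^ 2} ≤ p₀ * (1 - p₀) / (N.choose m * t) := by
  refine (measureReal_le_integral_div _ (fun A => sq_nonneg _) ht).trans ?_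
  rw [← div_div]
  exact div_le_div_of_nonneg_right (integral_phat_sub_sq_le hmN hq hsum) ht.le

/-- Under the null law the quadratic form is of the order of its standard deviation. -/
lemma nullLaw_pathForm_le {k : ℕ} (hkm : k < m) (hmN : m ≤ N) {p₀ τ : ℝ} (hp₀ : 0 < p₀)
    (hp₁ : p₀ ≤ 1) (hτ : 0 < τ) :
    (nullLaw m N p₀).real
      {A | τ * ((N - k).choose (m - k) * Real.sqrt (N.choose k) * phat A) < pathForm k A} ≤
      4 / (N.choose m * p₀) + 16 * m.choose k / τ ^ 2 := by
  have hM : (0 : ℝ) < N.choose m := by exact_mod_cast Nat.choose_pos hmN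
  have hbe : (0 : ℝ) < N.choose k := by exact_mod_cast Nat.choose_pos (hkm.le.trans hmN)
  have hb : (1 : ℝ) ≤ (N - k).choose (m - k) := by
    exact_mod_cast Nat.choose_pos (Nat.sub_le_sub_right hmN k)
  have hq := plantedProb_mem (m := m) (∅ : Finset (Fin N)) hp₀.le le_rfl (by simpa using hp₁)
  have hsum := sum_plantedProb (m := m) hmN (S := (∅ : Finset (Fin N))) rfl p₀ 0
  have hvar := sum_offDiag_var_le (m := m) hkm.le (S := (∅ : Finset (Fin N))) rfl hp₀.le le_rfl
    (by simpa using hp₁)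
  have hX := integral_offDiagForm_sq hq (meetWeight_comm k)
  rw [nullLaw_eq]
  set b : ℝ := ((N - k).choose (m - k) : ℝ)
  set be : ℝ := (N.choose k : ℝ)
  set s := Real.sqrt be with hs
  have hs2 : s ^ 2 = be := Real.sq_sqrt hbe.le
  have hspos : 0 < s := Real.sqrt_pos.2 hbe
  simp only [mul_zero, add_zero] at hsum
  have hpq : (fun e : HEdge m N => plantedProb (∅ : Finset (Fin N)) p₀ 0 e) = fun _ => p₀ := by
    funext e; simp [plantedProb]
  have hset : {A : HGraph m N | τ * (b * s * phat A) < pathForm k A} ⊆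
      {A | (p₀ / 2) ^ 2 ≤ (phat A - p₀) ^ 2} ∪
      {A | (τ / 2 * (b * s * p₀)) ^ 2 ≤
        offDiagForm (meetWeight k)
          (fun e => A.val e - plantedProb (∅ : Finset (Fin N)) p₀ 0 e) ^ 2} := by
    intro A hA
    by_contra hcon
    simp only [Set.mem_union, Set.mem_ofPred_eq, not_or, not_le] at hcon hA
    obtain ⟨h1, h2⟩ := hcon
    have h3 : p₀ / 2 < phat A := by
      have := abs_lt_of_sq_lt_sq h1 (by positivity)
      rw [abs_lt] at this; linarith [this.1]
    have h4 := abs_lt_of_sq_lt_sq h2 (by positivity)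
    rw [abs_lt] at h4
    have h5 := pathForm_eq hkm.le hmN A p₀
    have h6 : 0 ≤ (N.choose m : ℝ) * (m.choose k * (b - 1)) * (phat A - p₀) ^ 2 := by
      have : 0 ≤ b - 1 := by linarith
      positivity
    have h7 : (fun e => A.val e - plantedProb (∅ : Finset (Fin N)) p₀ 0 e) =
        fun e => A.val e - p₀ := by funext e; simp [plantedProb]
    rw [h7] at h4
    have h8 : τ * (b * s * (p₀ / 2)) ≤ τ * (b * s * phat A) := by gcongr
    linarith [h4.2]
  refine (measureReal_mono hset).trans ((measureReal_union_le _ _).trans (add_le_add ?_ ?_))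
  · refine (measureReal_phat_sub_sq_ge hmN hq hsum (by positivity)).trans ?_
    rw [div_le_div_iff₀ (by positivity) (by positivity)]
    have : 0 ≤ (N.choose m : ℝ) * p₀ ^ 2 * p₀ := by positivity
    nlinarith
  · refine (measureReal_le_integral_div _ (fun A => sq_nonneg _) (by positivity)).trans ?_
    rw [hX, div_le_div_iff₀ (by positivity) (by positivity)]
    have h9 : τ ^ 2 * (b ^ 2 * s ^ 2 * p₀ ^ 2) * (4 * m.choose k) =
        16 * m.choose k * (τ / 2 * (b * s * p₀)) ^ 2 := by ring
    rw [← h9, hs2]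
    have h10 := mul_le_mul_of_nonneg_right hvar (sq_nonneg τ)
    nlinarith

/-- The relative variance bound for the quadratic form under the planted law, in terms of the
signal `P` and the signal-to-noise ratio `P / (p b √β)`. -/
lemma planted_variance_ratio_le {p D a b al be P ε : ℝ} (hp : 0 < p)
    (hb : 0 < b) (hal : 1 ≤ al) (hbe : 1 ≤ be) (hP : P = D ^ 2 * al * a ^ 2)
    (hε : 0 < ε) (hε1 : ε ≤ 1) (hP1 : 1 ≤ ε ^ 2 * P)
    (hP2 : p * (b * Real.sqrt be) ≤ ε * P) :
    8 * (p ^ 2 * be * b ^ 2 + P) + 32 * P * (p * b + D * a) ≤ 80 * ε * P ^ 2 := by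
  have hP0 : 0 < P := by nlinarith [sq_nonneg ε]
  have hs1 : 1 ≤ Real.sqrt be := Real.one_le_sqrt.2 hbe
  have hs2 : Real.sqrt be ^ 2 = be := Real.sq_sqrt (by linarith)
  have h1 : p ^ 2 * be * b ^ 2 ≤ ε * P ^ 2 := by
    calc p ^ 2 * be * b ^ 2 = (p * (b * Real.sqrt be)) ^ 2 := by rw [mul_pow, mul_pow, hs2]; ring
      _ ≤ (ε * P) ^ 2 := pow_le_pow_left₀ (by positivity) hP2 2
      _ = ε * (ε * P ^ 2) := by ring
      _ ≤ 1 * (ε * P ^ 2) := by gcongr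
      _ = _ := one_mul _
  have h2 : P ≤ ε * P ^ 2 := by
    calc P = 1 * P := (one_mul _).symm
      _ ≤ ε ^ 2 * P * P := by gcongr
      _ = ε * (ε * P ^ 2) := by ring
      _ ≤ 1 * (ε * P ^ 2) := by gcongr
      _ = _ := one_mul _
  have h3 : p * b ≤ ε * P := by
    refine le_trans ?_ hP2
    have : p * b * 1 ≤ p * b * Real.sqrt be := by gcongr
    linarith
  have h4 : D * a ≤ ε * P := by
    refine le_of_sq_le_sq ?_ (by positivity)
    calc (D * a) ^ 2 = D ^ 2 * 1 * a ^ 2 := by ring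
      _ ≤ D ^ 2 * al * a ^ 2 := by gcongr
      _ = 1 * P := by rw [hP, one_mul]
      _ ≤ ε ^ 2 * P * P := by gcongr
      _ = _ := by ring
  nlinarith [mul_le_mul_of_nonneg_left (add_le_add h3 h4) hP0.le]

set_option maxHeartbeats 1000000 in
/-- Under the planted law the quadratic form exceeds every fixed multiple of its null standard
deviation, once the signal is strong enough. -/
lemma plantedLaw_pathForm_le {k n : ℕ} (hkm : k < m) (hmN : m ≤ N)
    {S : Finset (Fin N)} (hS : S.card = n) {p q τ ε : ℝ} (hp : 0 < p) (hpq : p < q) (hq1 : q ≤ 1)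
    (ha : 8 ≤ ((n - k).choose (m - k) : ℝ)) (hal1 : 1 ≤ (n.choose k : ℝ))
    (hal : 2 * (n.choose k : ℝ) ≤ N.choose k) (hτ : 0 ≤ τ) (hε : 0 < ε) (hε1 : ε ≤ 1)
    (hετ : 16 * (2 * τ + 1) * (2 * ε) ≤ 1)
    (hP1 : 1 ≤ ε ^ 2 * ((q - p) ^ 2 * n.choose k * (n - k).choose (m - k) ^ 2))
    (hP2 : p * ((N - k).choose (m - k) * Real.sqrt (N.choose k)) ≤
      ε * ((q - p) ^ 2 * n.choose k * (n - k).choose (m - k) ^ 2)) :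
    (plantedLaw m N S p q).real
      {A | pathForm k A ≤ τ * ((N - k).choose (m - k) * Real.sqrt (N.choose k) * phat A)} ≤
      1 / (N.choose m * p) + (m.choose k + 1) / Real.sqrt (N.choose k) +
        20480 * m.choose k * ε := by
  have hM : (0 : ℝ) < N.choose m := by exact_mod_cast Nat.choose_pos hmN
  have hbe : (1 : ℝ) ≤ N.choose k := by exact_mod_cast Nat.choose_pos (hkm.le.trans hmN)
  have hb : (1 : ℝ) ≤ (N - k).choose (m - k) := by
    exact_mod_cast Nat.choose_pos (Nat.sub_le_sub_right hmN k)
  have hD : 0 < q - p := by linarith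
  have hqm := plantedProb_mem (m := m) S hp.le hD.le (by linarith)
  have hsum := sum_plantedProb (m := m) hmN hS p (q - p)
  have hvar := integral_offDiagForm_sub_sq_le (m := m) hkm.le hmN hS hp.le hD.le (by linarith)
  have hsig := le_offDiagForm_signal (m := m) hkm.le hmN hS (q - p) ha hal
  have hnN : n ≤ N := by rw [← hS]; simpa using Finset.card_le_univ S
  have e1 := choose_mul_choose_cast (N := N) hkm.le
  have e2 := choose_mul_choose_cast (N := n) hkm.le
  have hMr : (N.choose m : ℝ) * (n.choose m / N.choose m) = n.choose m := by field_simp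
  have hratio := planted_variance_ratio_le (P := (q - p) ^ 2 * n.choose k *
    (n - k).choose (m - k) ^ 2) hp (by linarith) hal1 hbe rfl
    hε hε1 hP1 hP2
  rw [plantedLaw_eq]
  set r : ℝ := n.choose m / N.choose m with hr
  set D := q - p with hDdef
  set a : ℝ := ((n - k).choose (m - k) : ℝ)
  set b : ℝ := ((N - k).choose (m - k) : ℝ)
  set al : ℝ := (n.choose k : ℝ)
  set be : ℝ := (N.choose k : ℝ)
  set c : ℝ := (m.choose k : ℝ)
  set s := Real.sqrt be with hs
  set P := D ^ 2 * al * a ^ 2 with hP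
  set μ := indepEdgeLaw (plantedProb (m := m) S p D)
  have hs2 : s ^ 2 = be := Real.sq_sqrt (by linarith)
  have hspos : 0 < s := Real.sqrt_pos.2 (by linarith)
  have hr0 : 0 ≤ r := by positivity
  have hc : 0 ≤ c := Nat.cast_nonneg _
  have hPpos : 0 < P := by
    by_contra h
    have := mul_nonpos_of_nonneg_of_nonpos (sq_nonneg ε) (not_lt.1 h)
    linarith
  set p₀ := p + r * D with hp₀
  have hpp₀ : p ≤ p₀ := le_add_of_nonneg_right (by positivity)
  have hp₀pos : 0 < p₀ := by linarith
  -- the part `r D` of the matched density is dominated by the signal as well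
  have hrD : b * s * (r * D) ≤ ε * P := by
    have h1 : r * b * s ^ 2 = al * a := by
      rw [hs2, ← e2, ← hMr]; linear_combination (-r) * e1
    have hals : al ≤ s ^ 2 := by rw [hs2]; linarith
    refine le_of_mul_le_mul_right (a := s) ?_ hspos
    have h2 : b * s * (r * D) * s = D * al * a := by linear_combination D * h1
    rw [h2]
    refine le_of_sq_le_sq ?_ (by positivity)
    calc (D * al * a) ^ 2 = al * P := by rw [hP]; ring
      _ ≤ s ^ 2 * P := by gcongr
      _ = s ^ 2 * (1 * P) := by ring
      _ ≤ s ^ 2 * (ε ^ 2 * P * P) := by gcongr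
      _ = _ := by ring
  have hthr : (2 * τ + 1) * (b * s * p₀) ≤ P / 16 := by
    have h1 : b * s * p₀ ≤ 2 * ε * P := by
      have : b * s * p₀ = p * (b * s) + b * s * (r * D) := by rw [hp₀]; ring
      linarith
    calc (2 * τ + 1) * (b * s * p₀) ≤ (2 * τ + 1) * (2 * ε * P) := by gcongr
      _ = (16 * (2 * τ + 1) * (2 * ε)) * (P / 16) := by ring
      _ ≤ 1 * (P / 16) := by gcongr
      _ = _ := one_mul _
  set EX := offDiagForm (meetWeight (m := m) (N := N) k) (fun e => D * (insideInd S e - r))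
  have hset : {A : HGraph m N | pathForm k A ≤ τ * (b * s * phat A)} ⊆
      {A | p₀ ^ 2 ≤ (phat A - p₀) ^ 2} ∪
      {A | s * p₀ / (N.choose m * (c + 1)) ≤ (phat A - p₀) ^ 2} ∪
      {A | (P / 16) ^ 2 ≤ (offDiagForm (meetWeight k) (fun e => A.val e - p₀) - EX) ^ 2} := by
    intro A hA
    by_contra hcon
    simp only [Set.mem_union, Set.mem_ofPred_eq, not_or, not_le] at hcon hA
    obtain ⟨⟨h1, h2⟩, h3⟩ := hcon
    have h4 : phat A < 2 * p₀ := by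
      have := abs_lt_of_sq_lt_sq h1 (by positivity)
      rw [abs_lt] at this; linarith [this.2]
    have h5 := abs_lt_of_sq_lt_sq h3 (by positivity)
    rw [abs_lt] at h5
    have h6 := pathForm_eq hkm.le hmN A p₀
    rw [lt_div_iff₀ (by positivity)] at h2
    have h7 : (N.choose m : ℝ) * (c * (b - 1)) * (phat A - p₀) ^ 2 ≤ b * (s * p₀) := by
      calc (N.choose m : ℝ) * (c * (b - 1)) * (phat A - p₀) ^ 2
          ≤ (N.choose m : ℝ) * ((c + 1) * b) * (phat A - p₀) ^ 2 := by gcongr <;> linarith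
        _ = b * ((phat A - p₀) ^ 2 * (N.choose m * (c + 1))) := by ring
        _ ≤ _ := by gcongr
    have h8 : τ * (b * s * phat A) ≤ τ * (b * s * (2 * p₀)) := by gcongr
    change pathForm k A = _ - (N.choose m : ℝ) * (c * (b - 1)) * (phat A - p₀) ^ 2 at h6
    have h9 : (2 * τ + 1) * (b * s * p₀) = τ * (b * s * (2 * p₀)) + b * (s * p₀) := by ring
    linarith [h5.1]
  have hsum' : ∑ e, plantedProb (m := m) S p D e = N.choose m * p₀ := hsum
  have hcond : p₀ * (1 - p₀) ≤ p₀ := by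
    have := mul_self_nonneg p₀
    linarith
  refine (measureReal_mono hset).trans ((measureReal_union_le _ _).trans (add_le_add
    ((measureReal_union_le _ _).trans (add_le_add ?_ ?_)) ?_))
  · refine (measureReal_phat_sub_sq_ge hmN hqm hsum' (by positivity)).trans ?_
    calc p₀ * (1 - p₀) / (N.choose m * p₀ ^ 2) ≤ p₀ / (N.choose m * p₀ ^ 2) := by gcongr
      _ = 1 / (N.choose m * p₀) := by field_simp
      _ ≤ _ := by gcongr
  · refine (measureReal_phat_sub_sq_ge hmN hqm hsum' (by positivity)).trans ?_
    calc p₀ * (1 - p₀) / (N.choose m * (s * p₀ / (N.choose m * (c + 1))))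
        ≤ p₀ / (N.choose m * (s * p₀ / (N.choose m * (c + 1)))) := by gcongr
      _ = _ := by field_simp
  · refine (measureReal_le_integral_div _ (fun A => sq_nonneg _) (by positivity)).trans ?_
    rw [div_le_iff₀ (by positivity)]
    refine hvar.trans ?_
    calc 8 * c * (p ^ 2 * be * b ^ 2 + P) + 32 * c * P * (p * b + D * a)
        = c * (8 * (p ^ 2 * be * b ^ 2 + P) + 32 * P * (p * b + D * a)) := by ring
      _ ≤ c * (80 * ε * P ^ 2) := by gcongr
      _ = _ := by ring

end QuadraticTest

/-! ### The path statistics as quadratic forms -/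

section Embeddings

variable {α : Type*} [Fintype α] [DecidableEq α]

/-- Every `j`-set is the range of exactly `j!` embeddings of `Fin j`. -/
lemma sum_embedding_map (j : ℕ) (F : Finset α → ℝ) :
    ∑ i : Fin j ↪ α, F (Finset.univ.map i) =
      (j ! : ℝ) * ∑ g ∈ Finset.univ.powersetCard j, F g := by
  have hmaps : ∀ i ∈ (Finset.univ : Finset (Fin j ↪ α)),
      Finset.univ.map i ∈ (Finset.univ : Finset α).powersetCard j := by
    intro i _
    simp [Finset.mem_powersetCard]
  rw [← Finset.sum_fiberwise_of_maps_to hmaps, Finset.mul_sum]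
  refine Finset.sum_congr rfl fun g hg => ?_
  have hgj := (Finset.mem_powersetCard.1 hg).2
  rw [Finset.sum_congr rfl (g := fun _ => F g) fun i hi => by rw [(Finset.mem_filter.1 hi).2],
    Finset.sum_const, nsmul_eq_mul]
  congr 2
  have hcard : Fintype.card (Fin j ↪ g) = j ! := by
    rw [Fintype.card_embedding_eq, Fintype.card_coe, hgj, Fintype.card_fin, Nat.descFactorial_self]
  rw [← hcard, ← Finset.card_univ]
  symm
  refine Finset.card_bij (fun f _ => f.trans (Function.Embedding.subtype _)) ?_ ?_ ?_
  · intro f _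
    rw [Finset.mem_filter]
    refine ⟨Finset.mem_univ _, Finset.eq_of_subset_of_card_le ?_ (by simp [hgj])⟩
    intro x hx
    obtain ⟨y, _, rfl⟩ := Finset.mem_map.1 hx
    exact (f y).2
  · intro f _ f' _ h
    ext x
    exact DFunLike.congr_fun h x
  · intro i hi
    have hi := (Finset.mem_filter.1 hi).2
    refine ⟨i.codRestrict g fun x => ?_, Finset.mem_univ _, ?_⟩
    · rw [← hi]; simp
    · ext x; rfl

lemma sum_embedding_cons (j : ℕ) (H : (Fin (j + 1) → α) → ℝ) :
    ∑ i : Fin (j + 1) ↪ α, H i =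
      ∑ e : Fin j ↪ α, ∑ u ∈ (Finset.univ.map e)ᶜ, H (Fin.cons u e) := by
  rw [← (Equiv.embeddingFinSucc j α).symm.sum_comp, Fintype.sum_sigma]
  refine Finset.sum_congr rfl fun e _ => ?_
  simp_rw [Equiv.coe_embeddingFinSucc_symm]
  rw [Finset.sum_subtype (p := fun u => u ∉ Set.range e) _ (by simp)
    (fun u => H (Fin.cons u e))]

lemma sum_embedding_snoc (j : ℕ) (H : (Fin (j + 1) → α) → ℝ) :
    ∑ i : Fin (j + 1) ↪ α, H i =
      ∑ e : Fin j ↪ α, ∑ u ∈ (Finset.univ.map e)ᶜ, H (Fin.snoc e u) := by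
  rw [← ((finRotate (j + 1)).symm.embeddingCongr (Equiv.refl α)).sum_comp]
  have := sum_embedding_cons j (fun v : Fin (j + 1) → α => H (fun i => v (finRotate _ i)))
  simp_rw [Fin.snoc_eq_cons_rotate, ← this]
  rfl

end Embeddings

section Statistics

variable {m N : ℕ}

lemma sum_insert_eq (hm : 1 ≤ m) {g : Finset (Fin N)} (hg : g.card = m - 1)
    (F : Finset (Fin N) → ℝ) :
    ∑ u ∈ gᶜ, F (insert u g) = ∑ e : HEdge m N with g ⊆ e.1, F e.1 := by
  refine Finset.sum_bij (fun u hu => ⟨insert u g, ?_⟩) ?_ ?_ ?_ ?_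
  · rw [Finset.card_insert_of_notMem (Finset.mem_compl.1 hu), hg]; omega
  · intro u hu
    simp
  · intro u hu v hv h
    have h : insert u g = insert v g := congrArg Subtype.val h
    have : u ∈ insert v g := h ▸ Finset.mem_insert_self u g
    exact (Finset.mem_insert.1 this).resolve_right (Finset.mem_compl.1 hu)
  · intro e he
    have hge : g ⊆ e.1 := (Finset.mem_filter.1 he).2
    have h1 : (e.1 \ g).card = 1 := by
      rw [Finset.card_sdiff_of_subset hge, e.2, hg]; omega
    obtain ⟨u, hu⟩ := Finset.card_eq_one.1 h1
    have hu' : u ∈ e.1 \ g := hu ▸ Finset.mem_singleton_self u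
    refine ⟨u, Finset.mem_compl.2 (Finset.mem_sdiff.1 hu').2, Subtype.ext ?_⟩
    change insert u g = e.1
    rw [Finset.insert_eq, ← hu, Finset.sdiff_union_of_subset hge]
  · intro u hu
    rfl

/-- Each edge through `v` is counted `(m-1)!` times in the row sum. -/
lemma rowSum_eq (hm : 1 ≤ m) (A : HGraph m N) (v : Fin N) :
    rowSum A v = ((m - 1)! : ℝ) * ∑ e : HEdge m N with {v} ⊆ e.1, A.val e := by
  unfold rowSum
  rw [sum_embedding_map (m - 1) (fun g => A.entry (insert v g))]
  congr 1
  symm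
  refine Finset.sum_bij_ne_zero (fun e _ _ => e.1.erase v) ?_ ?_ ?_ ?_
  · intro e he _
    simp only [Finset.mem_filter, Finset.mem_univ, true_and, Finset.singleton_subset_iff] at he
    rw [Finset.mem_powersetCard, Finset.card_erase_of_mem he, e.2]
    exact ⟨Finset.subset_univ _, rfl⟩
  · intro e he _ f hf _ h
    simp only [Finset.mem_filter, Finset.mem_univ, true_and, Finset.singleton_subset_iff] at he hf
    apply Subtype.ext
    rw [← Finset.insert_erase he, ← Finset.insert_erase hf, h]
  · intro g hg h0
    have hgk := (Finset.mem_powersetCard.1 hg).2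
    have hvg : v ∉ g := by
      intro hv
      apply h0
      unfold HGraph.entry
      rw [dif_neg]
      rw [Finset.insert_eq_of_mem hv, hgk]; omega
    have hc : (insert v g).card = m := by
      rw [Finset.card_insert_of_notMem hvg, hgk]; omega
    refine ⟨⟨insert v g, hc⟩, by simp, ?_, Finset.erase_insert hvg⟩
    rw [← HGraph.entry_coe]; exact h0
  · intro e he _
    simp only [Finset.mem_filter, Finset.mem_univ, true_and, Finset.singleton_subset_iff] at he
    rw [Finset.insert_erase he, HGraph.entry_coe]

/-- The empirical variance `V₂` in terms of the quadratic form with weights `|e ∩ f|`. -/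
lemma looseV₂_eq (hm : 1 ≤ m) (hmN : m ≤ N) (A : HGraph m N) :
    looseV₂ A = 1 / ((N : ℝ) - (m ! : ℝ)) * (((m - 1)! : ℝ) ^ 2 *
      (pathForm 1 A + m * (N.choose m * phat A * (1 - phat A)))) := by
  have h1 : ∀ v : Fin N,
      (rowSum A v - ((m - 1)! : ℝ) * ((N - 1).choose (m - 1) : ℝ) * phat A) ^ 2 =
      ((m - 1)! : ℝ) ^ 2 * (∑ e : HEdge m N with {v} ⊆ e.1, (A.val e - phat A)) ^ 2 := by
    intro v
    rw [rowSum_eq hm, Finset.sum_sub_distrib, Finset.sum_const, nsmul_eq_mul,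
      card_superset (Finset.card_singleton v) hm]
    ring
  unfold looseV₂
  simp_rw [h1]
  rw [← Finset.mul_sum, pathForm, offDiagForm_meetWeight, sum_val_sub_phat_sq hmN,
    Finset.powersetCard_one, Finset.sum_map, Nat.choose_one_right]
  simp only [Function.Embedding.coeFn_mk]
  ring

/-- The numerator of the tight statistic: the `m - 1` middle vertices of a tight 2-path can be
ordered in `(m-1)!` ways. -/
lemma tight_numerator_eq (hm : 1 ≤ m) (A : HGraph m N) :
    ∑ i : Fin (m + 1) ↪ Fin N,
      (A.entry (Finset.univ.image fun k : Fin m => i k.castSucc) - phat A) *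
      (A.entry (Finset.univ.image fun k : Fin m => i k.succ) - phat A) =
      ((m - 1)! : ℝ) * pathForm (m - 1) A := by
  obtain ⟨j, rfl⟩ : ∃ j, m = j + 1 := ⟨m - 1, by omega⟩
  rw [Nat.add_sub_cancel]
  set y : Finset (Fin N) → ℝ := fun e => A.entry e - phat A with hy
  have h1 := sum_embedding_cons (j + 1) (fun i : Fin (j + 2) → Fin N =>
    y (Finset.univ.image fun k : Fin (j + 1) => i k.castSucc) *
      y (Finset.univ.image fun k : Fin (j + 1) => i k.succ))
  rw [h1]
  have h2 : ∀ e : Fin (j + 1) ↪ Fin N, ∀ u : Fin N,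
      (Finset.univ.image fun k : Fin (j + 1) => (Fin.cons u e : Fin (j + 2) → Fin N) k.castSucc) =
      insert u (Finset.univ.image fun k : Fin j => e k.castSucc) := by
    intro e u
    rw [Fin.univ_succ, Finset.cons_eq_insert, Finset.image_insert, Finset.map_eq_image,
      Finset.image_image]
    rfl
  have h3 := sum_embedding_snoc j (fun e : Fin (j + 1) → Fin N =>
    ∑ u ∈ (Finset.univ.image e)ᶜ, y (insert u (Finset.univ.image fun k : Fin j => e k.castSucc)) *
      y (Finset.univ.image e))
  have h4 : ∀ e : Fin j ↪ Fin N, ∀ v : Fin N,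
      (Finset.univ.image (Fin.snoc e v : Fin (j + 1) → Fin N)) =
        insert v (Finset.univ.map e) := by
    intro e v
    rw [Fin.univ_castSuccEmb, Finset.cons_eq_insert, Finset.image_insert, Fin.snoc_last,
      Finset.map_eq_image, Finset.image_image, Finset.map_eq_image]
    congr 2
    funext k
    simp
  calc _ = ∑ e : Fin (j + 1) ↪ Fin N, ∑ u ∈ (Finset.univ.image e)ᶜ,
        y (insert u (Finset.univ.image fun k : Fin j => e k.castSucc)) *
          y (Finset.univ.image e) := by
        refine Finset.sum_congr rfl fun e _ => ?_
        rw [Finset.map_eq_image]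
        refine Finset.sum_congr rfl fun u _ => ?_
        rw [h2]
        simp only [Fin.cons_succ]
    _ = ∑ e : Fin j ↪ Fin N, ∑ v ∈ (Finset.univ.map e)ᶜ,
        ∑ u ∈ (insert v (Finset.univ.map e))ᶜ,
          y (insert u (Finset.univ.map e)) * y (insert v (Finset.univ.map e)) := by
        rw [h3]
        refine Finset.sum_congr rfl fun e _ => Finset.sum_congr rfl fun v _ => ?_
        simp only [h4, Fin.snoc_castSucc]
        rw [Finset.map_eq_image]
    _ = (j ! : ℝ) * ∑ g ∈ (Finset.univ : Finset (Fin N)).powersetCard j, ∑ v ∈ gᶜ,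
        ∑ u ∈ (insert v g)ᶜ, y (insert u g) * y (insert v g) :=
        sum_embedding_map j fun g => ∑ v ∈ gᶜ, ∑ u ∈ (insert v g)ᶜ,
          y (insert u g) * y (insert v g)
    _ = (j ! : ℝ) * pathForm j A := by
        congr 1
        have hyc : ∀ e : HEdge (j + 1) N, y e.1 = A.val e - phat A := fun e => by
          rw [hy, ← HGraph.entry_coe]
        have h5 : ∀ g ∈ (Finset.univ : Finset (Fin N)).powersetCard j,
            ∑ v ∈ gᶜ, ∑ u ∈ (insert v g)ᶜ, y (insert u g) * y (insert v g) =
            (∑ e : HEdge (j + 1) N with g ⊆ e.1, (A.val e - phat A)) ^ 2 -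
              ∑ e : HEdge (j + 1) N with g ⊆ e.1, (A.val e - phat A) ^ 2 := by
          intro g hg
          have hgj := (Finset.mem_powersetCard.1 hg).2
          have h6 : ∀ v ∈ gᶜ, ∑ u ∈ (insert v g)ᶜ, y (insert u g) * y (insert v g) =
              (∑ u ∈ gᶜ, y (insert u g)) * y (insert v g) - y (insert v g) ^ 2 := by
            intro v hv
            rw [Finset.compl_insert, ← Finset.sum_mul, ← Finset.add_sum_erase _ _ hv]
            ring
          rw [Finset.sum_congr rfl h6, Finset.sum_sub_distrib, ← Finset.mul_sum, ← sq,
            sum_insert_eq (m := j + 1) (by omega) (by simpa using hgj) y,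
            sum_insert_eq (m := j + 1) (by omega) (by simpa using hgj) (fun e => y e ^ 2)]
          simp_rw [hyc]
        rw [Finset.sum_congr rfl h5, Finset.sum_sub_distrib, pathForm, offDiagForm_meetWeight]
        congr 1
        have h7 := sum_powersetCard_swap j (fun e : HEdge (j + 1) N => (A.val e - phat A) ^ 2)
          (fun _ => (1 : ℝ))
        simp only [one_mul] at h7
        rw [← h7, Finset.mul_sum]
        refine Finset.sum_congr rfl fun e _ => ?_
        rw [Finset.sum_const, Finset.card_powersetCard, e.2, nsmul_one, mul_comm]

end Statistics

/-! ### Worst-case risk -/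

section Risk

variable {m : ℕ} {n : ℕ → ℕ} {Θ : ℕ → Set (ℝ × ℝ)}

instance isProbabilityMeasure_nullLaw (m N : ℕ) (p : ℝ) :
    IsProbabilityMeasure (nullLaw m N p) := by unfold nullLaw; infer_instance

instance isProbabilityMeasure_plantedLaw (m N : ℕ) (S : Finset (Fin N)) (q p : ℝ) :
    IsProbabilityMeasure (plantedLaw m N S q p) := by unfold plantedLaw; infer_instance

/-- Both error probabilities of the test `R` at the parameter `p` are at most `ε`. -/
def ErrorsLE {N : ℕ} (n : ℕ) (p : ℝ × ℝ) (R : Set (HGraph m N)) (ε : ℝ) : Prop :=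
  (nullLaw m N p.1).real R ≤ ε ∧
    ∀ S : Finset (Fin N), S.card = n →
      (plantedLaw m N S (matchedProb m N n p.1 p.2) p.2).real Rᶜ ≤ ε

lemma risk_le_of_errorsLE {N n : ℕ} {Θ : Set (ℝ × ℝ)} {R : Set (HGraph m N)} {ε : ℝ}
    (hε : 0 ≤ ε) (h : ∀ p ∈ Θ, ErrorsLE n p R ε) :
    risk n (Prod.fst '' Θ) ((fun p : ℝ × ℝ => (matchedProb m N n p.1 p.2, p.2)) '' Θ) R ≤
      ENNReal.ofReal (2 * ε) := by
  have conv : ∀ (μ : Measure (HGraph m N)) [IsFiniteMeasure μ] (T : Set (HGraph m N)),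
      μ.real T ≤ ε → μ T ≤ ENNReal.ofReal ε := fun μ _ T hT => by
    rw [← ofReal_measureReal]; exact ENNReal.ofReal_le_ofReal hT
  rw [two_mul, ENNReal.ofReal_add hε hε]
  unfold risk
  refine add_le_add (iSup₂_le fun p₀ hp₀ => ?_) (iSup₂_le fun q hq => iSup₂_le fun S hS => ?_)
  · obtain ⟨p, hp, rfl⟩ := hp₀
    exact conv _ _ (h p hp).1
  · obtain ⟨p, hp, rfl⟩ := hq
    exact conv _ _ ((h p hp).2 S hS)

lemma asympPowerful_of_errorsLE {R : (N : ℕ) → Set (HGraph m N)}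
    (h : ∀ ε : ℝ, 0 < ε → ∀ᶠ N in atTop, ∀ p ∈ Θ N, ErrorsLE (n N) p (R N) ε) :
    AsympPowerful m n Θ R := by
  unfold AsympPowerful
  rw [ENNReal.tendsto_nhds_zero]
  intro δ hδ
  by_cases hδt : δ = ⊤
  · simp [hδt]
  have hpos : 0 < δ.toReal := ENNReal.toReal_pos hδ.ne' hδt
  filter_upwards [h (δ.toReal / 2) (by positivity)] with N hN
  refine (risk_le_of_errorsLE (by positivity) hN).trans ?_
  rw [mul_div_cancel₀ _ two_ne_zero, ENNReal.ofReal_toReal hδt]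

/-- A sequence of critical values exists as soon as every error level is eventually met by some
fixed critical value: take near-minimizers of the risk. -/
lemma exists_asympPowerful_threshold {T : (N : ℕ) → HGraph m N → ℝ}
    (h : ∀ ε : ℝ, 0 < ε → ∃ t : ℝ, ∀ᶠ N in atTop, ∀ p ∈ Θ N,
      ErrorsLE (n N) p {A | t < T N A} ε) :
    ∃ τ : ℕ → ℝ, AsympPowerful m n Θ fun N => {A | τ N < T N A} := by
  set f : ℕ → ℝ → ℝ≥0∞ := fun N t => risk (n N) (Prod.fst '' Θ N)
    ((fun p : ℝ × ℝ => (matchedProb m N (n N) p.1 p.2, p.2)) '' Θ N) {A | t < T N A} with hf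
  have hex : ∀ N, ∃ t, f N t ≤ (⨅ t, f N t) + ENNReal.ofReal (1 / ((N : ℝ) + 1)) := by
    intro N
    by_cases ht : (⨅ t, f N t) = ⊤
    · exact ⟨0, by simp [ht]⟩
    · obtain ⟨t, ht⟩ := iInf_lt_iff.1
        (ENNReal.lt_add_right ht (b := ENNReal.ofReal (1 / ((N : ℝ) + 1)))
          (ENNReal.ofReal_pos.2 (by positivity)).ne')
      exact ⟨t, ht.le⟩
  choose τ hτ using hex
  refine ⟨τ, ?_⟩
  have hlim : Tendsto (fun N => (⨅ t, f N t) + ENNReal.ofReal (1 / ((N : ℝ) + 1))) atTop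
      (𝓝 0) := by
    have h2 : Tendsto (fun N : ℕ => ENNReal.ofReal (1 / ((N : ℝ) + 1))) atTop (𝓝 0) := by
      have := ENNReal.tendsto_ofReal tendsto_one_div_add_atTop_nhds_zero_nat
      simpa using this
    have h1 : Tendsto (fun N => ⨅ t, f N t) atTop (𝓝 0) := by
      rw [ENNReal.tendsto_nhds_zero]
      intro δ hδ
      by_cases hδt : δ = ⊤
      · simp [hδt]
      have hpos : 0 < δ.toReal := ENNReal.toReal_pos hδ.ne' hδt
      obtain ⟨t, ht⟩ := h (δ.toReal / 2) (by positivity)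
      filter_upwards [ht] with N hN
      refine (iInf_le _ t).trans ((risk_le_of_errorsLE (by positivity) hN).trans ?_)
      rw [mul_div_cancel₀ _ two_ne_zero, ENNReal.ofReal_toReal hδt]
    simpa using h1.add h2
  exact tendsto_of_tendsto_of_tendsto_of_le_of_le tendsto_const_nhds hlim
    (fun _ => zero_le) hτ

end Risk

/-! ### Consequences of the rate conditions -/

section Rates

lemma choose_lt_choose_of_lt {m n N : ℕ} (hm : 1 ≤ m) (hmN : m ≤ N) (hnN : n < N) :
    n.choose m < N.choose m := by
  obtain ⟨N', rfl⟩ : ∃ N', N = N' + 1 := ⟨N - 1, by omega⟩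
  obtain ⟨j, rfl⟩ : ∃ j, m = j + 1 := ⟨m - 1, by omega⟩
  have h1 : n.choose (j + 1) ≤ N'.choose (j + 1) := Nat.choose_le_choose _ (by omega)
  have h2 : 0 < N'.choose j := Nat.choose_pos (by omega)
  rw [Nat.choose_succ_succ']
  omega

/-- The null edge probability is the average of the planted edge probabilities. -/
lemma eq_matchedProb_add {m N n : ℕ} (hm : 1 ≤ m) (hmN : m ≤ N) (hnN : n < N) (p₀ p₁ : ℝ) :
    p₀ = matchedProb m N n p₀ p₁ +
      n.choose m / N.choose m * (p₁ - matchedProb m N n p₀ p₁) := by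
  have h1 : (n.choose m : ℝ) < N.choose m := by exact_mod_cast choose_lt_choose_of_lt hm hmN hnN
  have h2 : (N.choose m : ℝ) - n.choose m ≠ 0 := by linarith
  have h3 : (N.choose m : ℝ) ≠ 0 := by
    have : (0 : ℝ) ≤ n.choose m := Nat.cast_nonneg _
    linarith
  unfold matchedProb
  field_simp
  ring

lemma matchedProb_lt {m N n : ℕ} (hm : 1 ≤ m) (hmN : m ≤ N) (hnN : n < N) {p₀ p₁ : ℝ}
    (h : p₀ < p₁) : matchedProb m N n p₀ p₁ < p₁ := by
  have h1 : (n.choose m : ℝ) < N.choose m := by exact_mod_cast choose_lt_choose_of_lt hm hmN hnN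
  have h3 : (0 : ℝ) < N.choose m := by exact_mod_cast Nat.choose_pos hmN
  unfold matchedProb
  rw [div_lt_iff₀ (by linarith)]
  nlinarith

lemma mul_choose_le {n N k : ℕ} (hk : 1 ≤ k) (hnN : n ≤ N) :
    (N : ℝ) * n.choose k ≤ n * N.choose k := by
  obtain ⟨j, rfl⟩ : ∃ j, k = j + 1 := ⟨k - 1, by omega⟩
  rcases Nat.eq_zero_or_pos n with rfl | hn
  · simp
  obtain ⟨n', rfl⟩ : ∃ n', n = n' + 1 := ⟨n - 1, by omega⟩
  obtain ⟨N', rfl⟩ : ∃ N', N = N' + 1 := ⟨N - 1, by omega⟩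
  have e1 := Nat.add_one_mul_choose_eq n' j
  have e2 := Nat.add_one_mul_choose_eq N' j
  have h1 : n'.choose j ≤ N'.choose j := Nat.choose_le_choose _ (by omega)
  have h2 : (N' + 1) * (n' + 1).choose (j + 1) * (j + 1) ≤
      (n' + 1) * (N' + 1).choose (j + 1) * (j + 1) := by
    calc (N' + 1) * (n' + 1).choose (j + 1) * (j + 1)
        = (N' + 1) * ((n' + 1).choose (j + 1) * (j + 1)) := by ring
      _ = (N' + 1) * ((n' + 1) * n'.choose j) := by rw [← e1]
      _ ≤ (N' + 1) * ((n' + 1) * N'.choose j) := by gcongr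
      _ = (n' + 1) * ((N' + 1) * N'.choose j) := by ring
      _ = (n' + 1) * (N' + 1).choose (j + 1) * (j + 1) := by rw [e2]; ring
  exact_mod_cast Nat.le_of_mul_le_mul_right h2 (by omega)

/-- The constant in the lower bounds `binom(x - i, j) ≥ chooseConst m * x ^ j`. -/
noncomputable def chooseConst (m : ℕ) : ℝ := 1 / (4 ^ m * m !)

lemma chooseConst_pos (m : ℕ) : 0 < chooseConst m := by unfold chooseConst; positivity

lemma le_choose {m i j x : ℕ} (hi : i ≤ m) (hj : j ≤ m) (hx : 4 * m ≤ x) :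
    chooseConst m * (x : ℝ) ^ j ≤ (x - i).choose j := by
  refine le_trans ?_ (Nat.pow_le_choose j (x - i))
  have h1 : (x : ℝ) / 4 ≤ ((x - i + 1 - j : ℕ) : ℝ) := by
    rw [div_le_iff₀ (by norm_num)]
    have : x ≤ (x - i + 1 - j) * 4 := by omega
    exact_mod_cast this
  have h2 : ((j ! : ℕ) : ℝ) ≤ m ! := by exact_mod_cast Nat.factorial_le hj
  calc chooseConst m * (x : ℝ) ^ j = (x : ℝ) ^ j / (4 ^ m * m !) := by
        unfold chooseConst; ring
    _ ≤ (x : ℝ) ^ j / (4 ^ j * j !) := by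
        gcongr
        norm_num
    _ = ((x : ℝ) / 4) ^ j / j ! := by rw [div_pow, div_div]
    _ ≤ _ := by gcongr

variable {m : ℕ} {n : ℕ → ℕ} {Θ : ℕ → Set (ℝ × ℝ)}

lemma tendsto_planted_size
    (hlog : (fun N : ℕ => Real.log (N : ℝ)) =o[atTop] fun N : ℕ => (n N : ℝ) ^ (m - 1)) :
    Tendsto n atTop atTop := by
  rw [tendsto_atTop]
  intro B
  have h1 := hlog.bound (c := 1) one_pos
  have h2 : Tendsto (fun N : ℕ => Real.log (N : ℝ)) atTop atTop :=
    Real.tendsto_log_atTop.comp tendsto_natCast_atTop_atTop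
  filter_upwards [h1, h2.eventually_gt_atTop ((B : ℝ) ^ (m - 1))] with N hN hB
  rw [one_mul, Real.norm_eq_abs, Real.norm_of_nonneg (by positivity)] at hN
  have h3 : (B : ℝ) ^ (m - 1) < (n N : ℝ) ^ (m - 1) := hB.trans_le ((le_abs_self _).trans hN)
  have := lt_of_pow_lt_pow_left₀ _ (by positivity) h3
  exact_mod_cast this.le

lemma eventually_mul_planted_size_le
    (hnN : (fun N : ℕ => (n N : ℝ)) =o[atTop] fun N : ℕ => (N : ℝ)) (K : ℝ) :
    ∀ᶠ N : ℕ in atTop, K * (n N : ℝ) ≤ N := by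
  have hK : 0 < 1 / (|K| + 1) := by positivity
  filter_upwards [hnN.bound hK] with N hN
  rw [Real.norm_of_nonneg (by positivity), Real.norm_of_nonneg (by positivity),
    one_div, inv_mul_eq_div, le_div_iff₀ (by positivity)] at hN
  have : (0 : ℝ) ≤ n N := by positivity
  nlinarith [le_abs_self K]

lemma eventually_planted_size_lt (hn : Tendsto n atTop atTop)
    (hnN : (fun N : ℕ => (n N : ℝ)) =o[atTop] fun N : ℕ => (N : ℝ)) :
    ∀ᶠ N : ℕ in atTop, n N < N := by
  filter_upwards [eventually_mul_planted_size_le hnN 2, hn.eventually_ge_atTop 1] with N h1 h2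
  have : (1 : ℝ) ≤ n N := by exact_mod_cast h2
  have : (n N : ℝ) < N := by linarith
  exact_mod_cast this

/-- The rate condition with exponent one: `p₀' ≥ n / (N n^{m-1})`. -/
lemma eventually_le_matchedProb (hn : Tendsto n atTop atTop)
    (hΘ : ∀ᶠ N in atTop, ∀ p ∈ Θ N,
      0 < p.1 ∧ p.1 < p.2 ∧ p.2 < 1 ∧ 0 < matchedProb m N (n N) p.1 p.2)
    (hrate : ∀ ε : ℝ, 0 < ε → ∀ᶠ N in atTop, ∀ p ∈ Θ N,
      Real.log (max 1 (1 / ((n N : ℝ) ^ (m - 1) * matchedProb m N (n N) p.1 p.2))) ≤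
        ε * Real.log ((N : ℝ) / (n N : ℝ))) :
    ∀ᶠ N : ℕ in atTop, ∀ p ∈ Θ N,
      (n N : ℝ) ≤ N * ((n N : ℝ) ^ (m - 1) * matchedProb m N (n N) p.1 p.2) := by
  filter_upwards [hΘ, hrate 1 one_pos, hn.eventually_ge_atTop 1, eventually_ge_atTop 1]
    with N h1 h2 h3 h4 p hp
  have hn0 : (0 : ℝ) < n N := by exact_mod_cast h3
  have hN0 : (0 : ℝ) < N := by exact_mod_cast h4
  have hp0 := (h1 p hp).2.2.2
  have h5 := h2 p hp
  rw [one_mul] at h5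
  have h6 := (Real.log_le_log_iff (by positivity) (by positivity)).1 h5
  have h7 := (le_max_right _ _).trans h6
  rw [div_le_div_iff₀ (by positivity) hn0] at h7
  linarith

lemma le_choose_mul_matchedProb {N n : ℕ} {p : ℝ} (hm : 2 ≤ m) (hn : 1 ≤ n) (hnN : n ≤ N)
    (hN : 4 * m ≤ N) (h : (n : ℝ) ≤ N * ((n : ℝ) ^ (m - 1) * p)) :
    chooseConst m * N ≤ N.choose m * p := by
  have hn0 : (0 : ℝ) < n := by exact_mod_cast hn
  have hN0 : (0 : ℝ) < N := by exact_mod_cast (by omega : 0 < N)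
  have hp : 0 < p := by
    by_contra hp
    have : (N : ℝ) * ((n : ℝ) ^ (m - 1) * p) ≤ 0 :=
      mul_nonpos_of_nonneg_of_nonpos hN0.le
        (mul_nonpos_of_nonneg_of_nonpos (by positivity) (not_lt.1 hp))
    linarith
  obtain ⟨j, rfl⟩ : ∃ j, m = j + 2 := ⟨m - 2, by omega⟩
  have h1 := le_choose (m := j + 2) (i := 0) (j := j + 2) (by omega) le_rfl hN
  have hc := chooseConst_pos (j + 2)
  have h2 : (1 : ℝ) ≤ N * ((n : ℝ) ^ j * p) := by
    have : (n : ℝ) * 1 ≤ n * (N * ((n : ℝ) ^ j * p)) := by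
      rw [mul_one]; refine h.trans (le_of_eq ?_)
      rw [show j + 2 - 1 = j + 1 by omega]; ring
    exact le_of_mul_le_mul_left this hn0
  have h3 : (n : ℝ) ^ j ≤ (N : ℝ) ^ j := by gcongr
  calc chooseConst (j + 2) * N = chooseConst (j + 2) * N * 1 := by ring
    _ ≤ chooseConst (j + 2) * N * (N * ((n : ℝ) ^ j * p)) := by gcongr
    _ ≤ chooseConst (j + 2) * N * (N * ((N : ℝ) ^ j * p)) := by gcongr
    _ = (chooseConst (j + 2) * (N : ℝ) ^ (j + 2)) * p := by ring
    _ ≤ _ := by gcongr; simpa using h1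

end Rates

/-! ### Power of the quadratic tests -/

section QuadraticPower

variable {m : ℕ} {n : ℕ → ℕ} {Θ : ℕ → Set (ℝ × ℝ)}

/-- The order of the null standard deviation of `pathForm k`, apart from the factor `p₀`. -/
noncomputable def pathScale (m k N : ℕ) : ℝ :=
  (N - k).choose (m - k) * Real.sqrt (N.choose k)

/-- The order of the mean of `pathForm k` under the planted law. -/
noncomputable def pathSignal (m k n : ℕ) (D : ℝ) : ℝ :=
  D ^ 2 * n.choose k * (n - k).choose (m - k) ^ 2

lemma sqrt_choose_tendsto {k : ℕ} (hk : 1 ≤ k) :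
    Tendsto (fun N : ℕ => Real.sqrt (N.choose k : ℝ)) atTop atTop := by
  have h1 : Tendsto (fun N : ℕ => (N.choose k : ℝ)) atTop atTop := by
    refine tendsto_atTop_mono' atTop ?_
      (Tendsto.const_mul_atTop (chooseConst_pos k) tendsto_natCast_atTop_atTop)
    filter_upwards [eventually_ge_atTop (4 * k), eventually_ge_atTop 1] with N hN hN1
    refine le_trans ?_ (le_choose (m := k) (i := 0) (j := k) (by omega) le_rfl hN)
    have h1 : (1 : ℝ) ≤ N := by exact_mod_cast hN1
    exact mul_le_mul_of_nonneg_left (le_self_pow₀ h1 (by omega)) (chooseConst_pos k).le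
  exact Real.tendsto_sqrt_atTop.comp h1

/-- If the signal diverges, absolutely and relative to the null fluctuations, then `pathForm k`
separates the null from the planted laws at every high enough multiple of its null fluctuations. -/
lemma pathForm_separates {k : ℕ} (hk : 1 ≤ k) (hkm : k < m)
    (hn : Tendsto n atTop atTop)
    (hnN : (fun N : ℕ => (n N : ℝ)) =o[atTop] fun N : ℕ => (N : ℝ))
    (hΘ : ∀ᶠ N in atTop, ∀ p ∈ Θ N,
      0 < p.1 ∧ p.1 < p.2 ∧ p.2 < 1 ∧ 0 < matchedProb m N (n N) p.1 p.2)
    (hMp : ∀ᶠ N : ℕ in atTop, ∀ p ∈ Θ N,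
      chooseConst m * N ≤ N.choose m * matchedProb m N (n N) p.1 p.2)
    (hsig : ∀ K : ℝ, ∀ᶠ N in atTop, ∀ p ∈ Θ N,
      K * (matchedProb m N (n N) p.1 p.2 * pathScale m k N) ≤
        pathSignal m k (n N) (p.2 - matchedProb m N (n N) p.1 p.2))
    (hP : ∀ K : ℝ, ∀ᶠ N in atTop, ∀ p ∈ Θ N,
      K ≤ pathSignal m k (n N) (p.2 - matchedProb m N (n N) p.1 p.2))
    {ε : ℝ} (hε : 0 < ε) :
    ∃ τ₀ : ℝ, 0 < τ₀ ∧ ∀ τ, τ₀ ≤ τ → ∀ᶠ N in atTop, ∀ p ∈ Θ N,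
      (nullLaw m N p.1).real {A | τ * (pathScale m k N * phat A) < pathForm k A} ≤ ε ∧
      ∀ S : Finset (Fin N), S.card = n N →
        (plantedLaw m N S (matchedProb m N (n N) p.1 p.2) p.2).real
          {A | pathForm k A ≤ τ * (pathScale m k N * phat A)} ≤ ε := by
  set c : ℝ := (m.choose k : ℝ) with hc
  have hc0 : 0 ≤ c := Nat.cast_nonneg _
  refine ⟨32 * c / ε + 1, by positivity, fun τ hτ => ?_⟩
  have hτ1 : 1 ≤ τ := le_trans (by simp; positivity) hτ
  have hτ0 : 0 < τ := by linarith
  have hτc : 16 * c / τ ^ 2 ≤ ε / 2 := by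
    rw [div_le_iff₀ (by positivity)]
    have h1 : 32 * c ≤ ε * τ := by
      have : 32 * c / ε ≤ τ := by linarith
      rw [div_le_iff₀ hε] at this
      linarith
    have h2 : ε * τ * 1 ≤ ε * τ * τ := by gcongr
    nlinarith
  -- the slack in the signal that makes all error terms small
  set η : ℝ := min (min 1 (1 / (32 * (2 * τ + 1)))) (ε / (3 * 20480 * (c + 1))) with hη
  have hη0 : 0 < η := by positivity
  have hη1 : η ≤ 1 := (min_le_left _ _).trans (min_le_left _ _)
  have hη2 : 16 * (2 * τ + 1) * (2 * η) ≤ 1 := by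
    have h : η ≤ 1 / (32 * (2 * τ + 1)) := (min_le_left _ _).trans (min_le_right _ _)
    rw [le_div_iff₀ (by positivity)] at h
    linarith
  have hη3 : 20480 * c * η ≤ ε / 3 := by
    have h : η ≤ ε / (3 * 20480 * (c + 1)) := min_le_right _ _
    rw [le_div_iff₀ (by positivity)] at h
    nlinarith
  have hm1 : 1 ≤ m := by omega
  filter_upwards [hΘ, hMp, hsig (1 / η), hP (1 / η ^ 2), eventually_ge_atTop (4 * m),
    hn.eventually_ge_atTop (4 * m), hn.eventually_ge_atTop (⌈8 / chooseConst m⌉₊),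
    eventually_mul_planted_size_le hnN 2, eventually_planted_size_lt hn hnN,
    (sqrt_choose_tendsto hk).eventually_ge_atTop (3 * (c + 1) / ε),
    tendsto_natCast_atTop_atTop.eventually_ge_atTop (8 / (ε * chooseConst m))]
    with N hΘN hMpN hsigN hPN hN hnm hn8 h2nN hlt hsq hNε p hp
  obtain ⟨hp0, hp01, hp1, hpm⟩ := hΘN p hp
  have hmN : m ≤ N := by omega
  have hpq := matchedProb_lt hm1 hmN hlt hp01
  have hmix := eq_matchedProb_add hm1 hmN hlt p.1 p.2
  have hMp := hMpN p hp
  have hsig := hsigN p hp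
  have hP := hPN p hp
  set q := matchedProb m N (n N) p.1 p.2 with hqdef
  have hqp0 : q ≤ p.1 := by
    rw [hmix]
    exact le_add_of_nonneg_right (mul_nonneg (by positivity) (by linarith))
  have hM : (0 : ℝ) < N.choose m := by exact_mod_cast Nat.choose_pos hmN
  have hMpos : 0 < (N.choose m : ℝ) * q := by positivity
  have hMq : 8 / ε ≤ (N.choose m : ℝ) * q := by
    refine le_trans ?_ hMp
    have hcc := chooseConst_pos m
    rw [div_le_iff₀ (by positivity)] at hNε
    rw [div_le_iff₀ hε]
    linarith
  refine ⟨?_, fun S hS => ?_⟩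
  · have h := nullLaw_pathForm_le (m := m) hkm hmN hp0 (by linarith) hτ0
    refine le_trans h ?_
    have h1 : 4 / (N.choose m * p.1) ≤ ε / 2 := by
      have : 8 / ε ≤ (N.choose m : ℝ) * p.1 := hMq.trans (by gcongr)
      rw [div_le_iff₀ (by positivity)]
      rw [div_le_iff₀ hε] at this
      linarith
    linarith
  · have ha : 8 ≤ ((n N - k).choose (m - k) : ℝ) := by
      refine le_trans ?_ (le_choose (m := m) hkm.le (by omega) hnm)
      have h1 : (1 : ℝ) ≤ n N := by exact_mod_cast (by omega : 1 ≤ n N)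
      have h2 : 8 / chooseConst m ≤ n N := (Nat.le_ceil _).trans (by exact_mod_cast hn8)
      rw [div_le_iff₀ (chooseConst_pos m), mul_comm] at h2
      exact h2.trans (mul_le_mul_of_nonneg_left (le_self_pow₀ h1 (by omega))
        (chooseConst_pos m).le)
    have hal1 : 1 ≤ ((n N).choose k : ℝ) := by
      exact_mod_cast Nat.choose_pos (by omega)
    have hal : 2 * ((n N).choose k : ℝ) ≤ N.choose k := by
      have h1 := mul_choose_le (k := k) hk hlt.le
      have h2 : (0 : ℝ) < n N := by exact_mod_cast (by omega : 0 < n N)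
      refine le_of_mul_le_mul_left ?_ h2
      calc (n N : ℝ) * (2 * (n N).choose k) = 2 * n N * (n N).choose k := by ring
        _ ≤ N * (n N).choose k := by gcongr
        _ ≤ _ := h1
    have h := plantedLaw_pathForm_le (m := m) (τ := τ) (ε := η) hkm hmN hS hpm hpq hp1.le ha hal1
      hal hτ0.le hη0 hη1 hη2 (by
        rw [div_le_iff₀ (by positivity)] at hP
        rw [mul_comm]; exact hP) (by
        rw [one_div, inv_mul_le_iff₀ hη0] at hsig
        exact hsig)
    refine le_trans h ?_
    have h1 : 1 / (N.choose m * q) ≤ ε / 3 := by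
      rw [div_le_iff₀ hMpos]
      rw [div_le_iff₀ hε] at hMq
      linarith
    have h2 : (c + 1) / Real.sqrt (N.choose k) ≤ ε / 3 := by
      rw [div_le_iff₀ hε] at hsq
      have : 0 < Real.sqrt (N.choose k : ℝ) := by
        refine Real.sqrt_pos.2 ?_
        exact_mod_cast Nat.choose_pos (by omega)
      rw [div_le_iff₀ this]
      linarith
    linarith

/-- A statistic that is comparable to the normalized `pathForm k`, off a set of vanishing null
probability, has asymptotically powerful critical values. -/
lemma exists_threshold_of_comparison {k : ℕ} {T : (N : ℕ) → HGraph m N → ℝ}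
    {E : (N : ℕ) → Set (HGraph m N)}
    (hsep : ∀ ε : ℝ, 0 < ε → ∃ τ₀ : ℝ, 0 < τ₀ ∧ ∀ τ, τ₀ ≤ τ → ∀ᶠ N in atTop, ∀ p ∈ Θ N,
      (nullLaw m N p.1).real {A | τ * (pathScale m k N * phat A) < pathForm k A} ≤ ε ∧
      ∀ S : Finset (Fin N), S.card = n N →
        (plantedLaw m N S (matchedProb m N (n N) p.1 p.2) p.2).real
          {A | pathForm k A ≤ τ * (pathScale m k N * phat A)} ≤ ε)
    (hE : ∀ ε : ℝ, 0 < ε → ∀ᶠ N in atTop, ∀ p ∈ Θ N, (nullLaw m N p.1).real (E N) ≤ ε)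
    (hcmp : ∀ τ₀ : ℝ, 0 < τ₀ → ∃ t τ₁ : ℝ, τ₀ ≤ τ₁ ∧ ∀ᶠ N in atTop, ∀ A : HGraph m N,
      (A ∉ E N → t < T N A → τ₀ * (pathScale m k N * phat A) < pathForm k A) ∧
      (T N A ≤ t → pathForm k A ≤ τ₁ * (pathScale m k N * phat A))) :
    ∃ τ : ℕ → ℝ, AsympPowerful m n Θ fun N => {A | τ N < T N A} := by
  refine exists_asympPowerful_threshold fun ε hε => ?_
  obtain ⟨τ₀, hτ₀, h⟩ := hsep (ε / 2) (by positivity)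
  obtain ⟨t, τ₁, h01, hc⟩ := hcmp τ₀ hτ₀
  refine ⟨t, ?_⟩
  filter_upwards [h τ₀ le_rfl, h τ₁ h01, hE (ε / 2) (by positivity), hc] with N h0 h1 hE hc p hp
  refine ⟨?_, fun S hS => ?_⟩
  · have hsub : {A : HGraph m N | t < T N A} ⊆
        E N ∪ {A | τ₀ * (pathScale m k N * phat A) < pathForm k A} := by
      intro A hA
      by_cases hAE : A ∈ E N
      · exact Or.inl hAE
      · exact Or.inr ((hc A).1 hAE hA)
    refine (measureReal_mono hsub).trans ((measureReal_union_le _ _).trans ?_)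
    linarith [hE p hp, (h0 p hp).1]
  · have hsub : {A : HGraph m N | t < T N A}ᶜ ⊆
        {A | pathForm k A ≤ τ₁ * (pathScale m k N * phat A)} := by
      intro A hA
      exact (hc A).2 (not_lt.1 hA)
    refine (measureReal_mono hsub).trans ?_
    linarith [(h1 p hp).2 S hS]

/-- Square-root-free form of the signal condition. -/
lemma SignalDiverges.eventually_le (hS : SignalDiverges m n Θ)
    (hΘ : ∀ᶠ N in atTop, ∀ p ∈ Θ N,
      0 < p.1 ∧ p.1 < p.2 ∧ p.2 < 1 ∧ 0 < matchedProb m N (n N) p.1 p.2) {K : ℝ} (hK : 0 ≤ K) :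
    ∀ᶠ N : ℕ in atTop, ∀ p ∈ Θ N,
      K * (matchedProb m N (n N) p.1 p.2 ^ 2 * (N : ℝ) ^ (m + 1)) ≤
        (p.2 - matchedProb m N (n N) p.1 p.2) ^ 4 * (n N : ℝ) ^ (2 * m + 2) := by
  filter_upwards [hS (K + 1), hΘ, eventually_ge_atTop 1] with N h hΘN hN p hp
  have h := h p hp
  have hq := (hΘN p hp).2.2.2
  set q := matchedProb m N (n N) p.1 p.2
  have hN0 : (0 : ℝ) < N := by exact_mod_cast hN
  have h4 := pow_le_pow_left₀ (by positivity) h 4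
  have hx : (((n N : ℝ) ^ 2 / N) ^ (((m : ℝ) + 1) / 4)) ^ 4 = ((n N : ℝ) ^ 2 / N) ^ (m + 1) := by
    rw [← Real.rpow_mul_natCast (by positivity), ← Real.rpow_natCast _ (m + 1)]
    congr 1
    push_cast
    ring
  have hs : Real.sqrt q ^ 4 = q ^ 2 := by
    rw [show (4 : ℕ) = 2 * 2 by norm_num, pow_mul, Real.sq_sqrt hq.le]
  rw [mul_pow, hx, div_pow, hs, div_pow, div_mul_div_comm, le_div_iff₀ (by positivity)] at h4
  have h5 : K ≤ (K + 1) ^ 4 := by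
    have h6 : K + 1 ≤ (K + 1) ^ 4 := le_self_pow₀ (by linarith) (by norm_num)
    linarith
  calc K * (q ^ 2 * (N : ℝ) ^ (m + 1)) ≤ (K + 1) ^ 4 * (q ^ 2 * (N : ℝ) ^ (m + 1)) := by gcongr
    _ ≤ _ := h4
    _ = _ := by rw [← pow_mul]; congr 2

lemma pathSignal_nonneg (m k n : ℕ) (D : ℝ) : 0 ≤ pathSignal m k n D := by
  unfold pathSignal; positivity

lemma le_pathSignal_sq {k x : ℕ} (hkm : k ≤ m) (hx : 4 * m ≤ x) (D : ℝ) :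
    chooseConst m ^ 6 * (D ^ 4 * (x : ℝ) ^ (4 * m - 2 * k)) ≤ pathSignal m k x D ^ 2 := by
  have h1 := le_choose (m := m) (i := 0) (j := k) (by omega) hkm hx
  have h2 := le_choose (m := m) (i := k) (j := m - k) hkm (by omega) hx
  rw [Nat.sub_zero] at h1
  have hc := chooseConst_pos m
  have h3 : D ^ 2 * (chooseConst m * (x : ℝ) ^ k) * (chooseConst m * (x : ℝ) ^ (m - k)) ^ 2 ≤
      pathSignal m k x D := by
    unfold pathSignal; gcongr
  refine le_trans (le_of_eq ?_) (pow_le_pow_left₀ (by positivity) h3 2)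
  have : 4 * m - 2 * k = k * 2 + (m - k) * 2 * 2 := by omega
  rw [this, pow_add, pow_mul, pow_mul, pow_mul]
  ring

lemma pathScale_sq_le {k N : ℕ} (hkm : k ≤ m) :
    pathScale m k N ^ 2 ≤ (N : ℝ) ^ (2 * m - k) := by
  have h1 : ((N.choose k : ℕ) : ℝ) ≤ (N : ℝ) ^ k := by exact_mod_cast Nat.choose_le_pow N k
  have h2 : (((N - k).choose (m - k) : ℕ) : ℝ) ≤ (N : ℝ) ^ (m - k) := by
    exact_mod_cast (Nat.choose_le_pow (N - k) (m - k)).trans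
      (Nat.pow_le_pow_left (Nat.sub_le _ _) _)
  unfold pathScale
  rw [mul_pow, Real.sq_sqrt (Nat.cast_nonneg _)]
  calc _ ≤ ((N : ℝ) ^ (m - k)) ^ 2 * (N : ℝ) ^ k := by gcongr
    _ = _ := by
      rw [← pow_mul, ← pow_add]; congr 1; omega

/-- The relative signal of `pathForm k` diverges. -/
lemma eventually_pathScale_le {k : ℕ} (hkm : k < m) (hn : Tendsto n atTop atTop)
    (hs : ∀ K : ℝ, 0 ≤ K → ∀ᶠ N : ℕ in atTop, ∀ p ∈ Θ N,
      K * (matchedProb m N (n N) p.1 p.2 ^ 2 * (N : ℝ) ^ (2 * m - k)) ≤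
        (p.2 - matchedProb m N (n N) p.1 p.2) ^ 4 * (n N : ℝ) ^ (4 * m - 2 * k)) (K : ℝ) :
    ∀ᶠ N in atTop, ∀ p ∈ Θ N,
      K * (matchedProb m N (n N) p.1 p.2 * pathScale m k N) ≤
        pathSignal m k (n N) (p.2 - matchedProb m N (n N) p.1 p.2) := by
  have hc := chooseConst_pos m
  filter_upwards [hs (K ^ 2 / chooseConst m ^ 6) (by positivity),
    hn.eventually_ge_atTop (4 * m)] with N h hN p hp
  have h := h p hp
  set q := matchedProb m N (n N) p.1 p.2
  refine le_of_sq_le_sq ?_ (pathSignal_nonneg _ _ _ _)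
  refine le_trans ?_ (le_pathSignal_sq hkm.le hN _)
  rw [div_mul_eq_mul_div, div_le_iff₀ (by positivity)] at h
  calc (K * (q * pathScale m k N)) ^ 2 = K ^ 2 * (q ^ 2 * pathScale m k N ^ 2) := by ring
    _ ≤ K ^ 2 * (q ^ 2 * (N : ℝ) ^ (2 * m - k)) := by
      have := pathScale_sq_le (N := N) hkm.le
      gcongr
    _ ≤ _ := h
    _ = _ := by ring

/-- The absolute signal of `pathForm k` diverges: the rate condition bounds `p₀'` from below. -/
lemma eventually_le_pathSignal {k : ℕ} (hkm : k < m) (hn : Tendsto n atTop atTop)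
    (hr : ∀ᶠ N : ℕ in atTop, ∀ p ∈ Θ N,
      (n N : ℝ) ≤ N * ((n N : ℝ) ^ (m - 1) * matchedProb m N (n N) p.1 p.2))
    (hs : ∀ᶠ N : ℕ in atTop, ∀ p ∈ Θ N,
      1 * (matchedProb m N (n N) p.1 p.2 ^ 2 * (N : ℝ) ^ (m + 1)) ≤
        (p.2 - matchedProb m N (n N) p.1 p.2) ^ 4 * (n N : ℝ) ^ (2 * m + 2))
    (hk : ∀ᶠ N : ℕ in atTop, (n N : ℝ) ^ (2 * k) * N ≤ (n N : ℝ) ^ 2 * (N : ℝ) ^ (m - 1)) (K : ℝ) :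
    ∀ᶠ N in atTop, ∀ p ∈ Θ N,
      K ≤ pathSignal m k (n N) (p.2 - matchedProb m N (n N) p.1 p.2) := by
  have hc := chooseConst_pos m
  filter_upwards [hr, hs, hk, hn.eventually_ge_atTop (4 * m), eventually_ge_atTop 1,
    tendsto_natCast_atTop_atTop.eventually_ge_atTop (K ^ 2 / chooseConst m ^ 6)]
    with N hr hs hk hnm hN1 hNK p hp
  have hr := hr p hp
  have hs := hs p hp
  set q := matchedProb m N (n N) p.1 p.2
  set D := p.2 - q
  set x : ℝ := (n N : ℝ) with hx
  have hx0 : 0 < x := by rw [hx]; exact_mod_cast (by omega : 0 < n N)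
  have hN0 : (0 : ℝ) < N := by exact_mod_cast hN1
  refine le_of_sq_le_sq ?_ (pathSignal_nonneg _ _ _ _)
  refine le_trans ?_ (le_pathSignal_sq hkm.le hnm _)
  rw [div_le_iff₀ (by positivity)] at hNK
  refine hNK.trans ?_
  rw [mul_comm]
  refine mul_le_mul_of_nonneg_left ?_ (by positivity)
  have h1 : x ^ (2 * k) * N ≤ x ^ (2 * k) * (D ^ 4 * x ^ (4 * m - 2 * k)) := by
    calc x ^ (2 * k) * N ≤ x ^ 2 * (N : ℝ) ^ (m - 1) := hk
      _ ≤ (N * (x ^ (m - 1) * q)) ^ 2 * (N : ℝ) ^ (m - 1) := by gcongr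
      _ = x ^ (2 * (m - 1)) * (1 * (q ^ 2 * ((N : ℝ) ^ (2 + (m - 1))))) := by
        rw [pow_add, mul_comm 2 (m - 1), pow_mul]; ring
      _ = x ^ (2 * (m - 1)) * (1 * (q ^ 2 * ((N : ℝ) ^ (m + 1)))) := by
        rw [show 2 + (m - 1) = m + 1 by omega]
      _ ≤ x ^ (2 * (m - 1)) * (D ^ 4 * x ^ (2 * m + 2)) := by gcongr
      _ = D ^ 4 * x ^ (2 * (m - 1) + (2 * m + 2)) := by rw [pow_add]; ring
      _ = D ^ 4 * x ^ (2 * k + (4 * m - 2 * k)) := by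
        rw [show 2 * (m - 1) + (2 * m + 2) = 2 * k + (4 * m - 2 * k) by omega]
      _ = _ := by rw [pow_add]; ring
  exact le_of_mul_le_mul_left h1 (by positivity)

end QuadraticPower

/-! ### The loose and tight path tests -/

section PathTests

variable {m : ℕ} {n : ℕ → ℕ} {Θ : ℕ → Set (ℝ × ℝ)}

/-- `V₂ - V₁` is a multiple of the quadratic form up to a nonnegative remainder of lower order. -/
lemma looseV₂_sub_looseV₁ {N : ℕ} (hm : 2 ≤ m) (hN : m + m ! < N) (A : HGraph m N) :
    ∃ R : ℝ, 0 ≤ R ∧ R ≤ m ! * ((N - 1).choose (m - 1) : ℝ) * phat A ∧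
      looseV₂ A - looseV₁ A =
        ((m - 1)! : ℝ) ^ 2 / ((N : ℝ) - m !) * (pathForm 1 A + R) := by
  have hmN : m ≤ N := by omega
  have e1 := choose_mul_choose_cast (N := N) (m := m) (k := 1) (by omega)
  rw [Nat.choose_one_right, Nat.choose_one_right] at e1
  have hMN : (N : ℝ) ≤ N.choose m := by
    have hb : (m : ℝ) ≤ (N - 1).choose (m - 1) := by
      have h2 : m.choose (m - 1) ≤ (N - 1).choose (m - 1) :=
        Nat.choose_le_choose _ (by have := Nat.factorial_pos m; omega)
      have h3 : m.choose (m - 1) = m := by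
        rw [Nat.choose_symm_of_eq_add (show m = (m - 1) + 1 by omega), Nat.choose_one_right]
      rw [h3] at h2
      exact_mod_cast h2
    have hm0 : (0 : ℝ) < m := by exact_mod_cast (by omega : 0 < m)
    refine le_of_mul_le_mul_right ?_ hm0
    rw [e1]
    gcongr
  have hNr : (m ! : ℝ) < N := by exact_mod_cast (by omega : m ! < N)
  have hfact : (1 : ℝ) ≤ m ! := by exact_mod_cast Nat.factorial_pos m
  have hp0 := phat_nonneg A
  have hp1 := phat_le_one A
  set b : ℝ := ((N - 1).choose (m - 1) : ℝ) with hb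
  have hb0 : 0 ≤ b := Nat.cast_nonneg _
  set M : ℝ := (N.choose m : ℝ) with hM
  have hM1 : 0 < M - 1 := by linarith
  have hNm : 0 < (N : ℝ) - m ! := by linarith
  have hfrac0 : 0 ≤ ((N : ℝ) - m !) / (M - 1) := by positivity
  have hfrac1 : ((N : ℝ) - m !) / (M - 1) ≤ 1 := by
    rw [div_le_one hM1]; linarith
  refine ⟨b * (phat A * (1 - phat A)) * ((m ! : ℝ) - ((N : ℝ) - m !) / (M - 1)), ?_, ?_, ?_⟩
  · have : 0 ≤ 1 - phat A := by linarith
    have : 0 ≤ (m ! : ℝ) - ((N : ℝ) - m !) / (M - 1) := by linarith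
    positivity
  · calc b * (phat A * (1 - phat A)) * ((m ! : ℝ) - ((N : ℝ) - m !) / (M - 1))
        ≤ b * (phat A * 1) * ((m ! : ℝ) - 0) := by
          gcongr
          · linarith
          · linarith
      _ = _ := by ring
  · rw [looseV₂_eq (by omega) hmN]
    unfold looseV₁
    rw [← hb, ← hM]
    have h1 : (m : ℝ) * (M * phat A * (1 - phat A)) = N * b * (phat A * (1 - phat A)) := by
      rw [← e1]; ring
    rw [h1]
    field_simp
    ring

lemma looseStat_comparison (hm : 2 ≤ m) {τ₀ : ℝ} (hτ₀ : 0 < τ₀) :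
    ∃ t τ₁ : ℝ, τ₀ ≤ τ₁ ∧ ∀ᶠ N in atTop, ∀ A : HGraph m N,
      (A ∉ (∅ : Set (HGraph m N)) → t < looseStat A →
        τ₀ * (pathScale m 1 N * phat A) < pathForm 1 A) ∧
      (looseStat A ≤ t → pathForm 1 A ≤ τ₁ * (pathScale m 1 N * phat A)) := by
  have hc := chooseConst_pos m
  set f : ℝ := ((m - 1)! : ℝ) ^ 2 with hf
  have hf0 : 0 < f := by positivity
  refine ⟨2 * f * (τ₀ + m !), τ₀ + 2 * (τ₀ + m !) / chooseConst m,
    le_add_of_nonneg_right (by positivity), ?_⟩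
  filter_upwards [eventually_ge_atTop (4 * m + 2 * m !)] with N hN A
  have hfp := Nat.factorial_pos m
  obtain ⟨R, hR0, hR1, hR⟩ := looseV₂_sub_looseV₁ hm (by omega) A
  have hN1 : (1 : ℝ) ≤ N := by exact_mod_cast (by omega : 1 ≤ N)
  have hs1 : 1 ≤ Real.sqrt (N : ℝ) := Real.one_le_sqrt.2 hN1
  have hNm : (N : ℝ) / 2 ≤ N - m ! := by
    have : (2 * m ! : ℝ) ≤ N := by exact_mod_cast (by omega : 2 * m ! ≤ N)
    linarith
  have hNm' : (N : ℝ) - m ! ≤ N := by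
    have : (0 : ℝ) ≤ m ! := by positivity
    linarith
  have hpow : (N : ℝ) ^ ((2 * (m : ℝ) - 3) / 2) = (N : ℝ) ^ (m - 2) * Real.sqrt N := by
    rw [Real.sqrt_eq_rpow, ← Real.rpow_natCast, ← Real.rpow_add (by linarith)]
    congr 1
    rw [Nat.cast_sub hm]
    push_cast
    ring
  have hb1 : (((N - 1).choose (m - 1) : ℕ) : ℝ) ≤ (N : ℝ) ^ (m - 1) := by
    exact_mod_cast (Nat.choose_le_pow (N - 1) (m - 1)).trans
      (Nat.pow_le_pow_left (Nat.sub_le _ _) _)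
  have hb2 : chooseConst m * (N : ℝ) ^ (m - 1) ≤ ((N - 1).choose (m - 1) : ℝ) :=
    le_choose (by omega) (by omega) (by omega)
  have hscale : pathScale m 1 N = ((N - 1).choose (m - 1) : ℝ) * Real.sqrt N := by
    rw [pathScale, Nat.choose_one_right]
  have hp0 := phat_nonneg A
  have hNpow : (N : ℝ) ^ (m - 1) = N * (N : ℝ) ^ (m - 2) := by
    rw [← pow_succ']; congr 1; omega
  unfold looseStat
  rw [hR, hpow, hscale]
  set b : ℝ := ((N - 1).choose (m - 1) : ℝ) with hb
  have hb0 : 0 ≤ b := Nat.cast_nonneg _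
  set s := Real.sqrt (N : ℝ)
  set Nm : ℝ := (N : ℝ) - m ! with hNmdef
  have hNm0 : 0 < Nm := by linarith
  have hN0 : (0 : ℝ) < N := by linarith
  have hs0 : 0 < s := by linarith
  rcases hp0.eq_or_lt with h0 | hp
  · have hY : pathForm 1 A = 0 := pathForm_eq_zero (by omega) (by rw [← h0]; ring)
    rw [← h0, hY]
    simp only [mul_zero, div_zero, le_refl, implies_true, and_true]
    intro _ h
    exact absurd h (not_lt.2 (by positivity))
  · have hden : 0 < (N : ℝ) ^ (m - 2) * s * phat A := by positivity
    have hform : f / Nm * (pathForm 1 A + R) / ((N : ℝ) ^ (m - 2) * s * phat A) =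
        f * (pathForm 1 A + R) / (Nm * ((N : ℝ) ^ (m - 2) * s * phat A)) := by
      rw [div_mul_eq_mul_div, div_div]
    rw [hform]
    constructor
    · intro _ h
      rw [lt_div_iff₀ (by positivity)] at h
      have h1 : (2 * (τ₀ + m !)) * (Nm * ((N : ℝ) ^ (m - 2) * s * phat A)) < pathForm 1 A + R := by
        refine lt_of_mul_lt_mul_left ?_ hf0.le
        linarith
      have h2 : (τ₀ + m !) * (b * s * phat A) ≤
          (2 * (τ₀ + m !)) * (Nm * ((N : ℝ) ^ (m - 2) * s * phat A)) := by
        calc (τ₀ + m !) * (b * s * phat A) ≤ (τ₀ + m !) * ((N : ℝ) ^ (m - 1) * s * phat A) := by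
              gcongr
          _ = (2 * (τ₀ + m !)) * (N / 2 * ((N : ℝ) ^ (m - 2) * s * phat A)) := by
              rw [hNpow]; ring
          _ ≤ _ := by gcongr
      have h3 : m ! * b * phat A ≤ m ! * (b * s * phat A) := by
        have : m ! * (b * 1 * phat A) ≤ m ! * (b * s * phat A) := by gcongr
        linarith
      linarith
    · intro h
      rw [div_le_iff₀ (by positivity)] at h
      have h1 : pathForm 1 A + R ≤
          (2 * (τ₀ + m !)) * (Nm * ((N : ℝ) ^ (m - 2) * s * phat A)) := by
        refine le_of_mul_le_mul_left ?_ hf0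
        linarith
      have h2 : (2 * (τ₀ + m !)) * (Nm * ((N : ℝ) ^ (m - 2) * s * phat A)) ≤
          2 * (τ₀ + m !) / chooseConst m * (b * s * phat A) := by
        calc (2 * (τ₀ + m !)) * (Nm * ((N : ℝ) ^ (m - 2) * s * phat A))
            ≤ (2 * (τ₀ + m !)) * (N * ((N : ℝ) ^ (m - 2) * s * phat A)) := by gcongr
          _ = 2 * (τ₀ + m !) / chooseConst m *
              (chooseConst m * (N : ℝ) ^ (m - 1) * s * phat A) := by
              rw [hNpow]; field_simp
          _ ≤ _ := by gcongr
      have h3 : 0 ≤ τ₀ * (b * s * phat A) := by positivity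
      linarith

/-- The normalization of the tight statistic has the order of `pathScale m (m - 1) N`. -/
lemma tight_normalization_bounds {N : ℕ} (hm : 2 ≤ m) (hN : 4 * m ≤ N) :
    pathScale m (m - 1) N / 2 ≤ Real.sqrt (((m + 1)! : ℝ) * (N.choose (m + 1) : ℝ)) ∧
      Real.sqrt (((m + 1)! : ℝ) * (N.choose (m + 1) : ℝ)) ≤
        ((m - 1)! : ℝ) * pathScale m (m - 1) N := by
  obtain ⟨j, rfl⟩ : ∃ j, m = j + 1 := ⟨m - 1, by omega⟩
  rw [Nat.add_sub_cancel]
  have e1 : (((j + 1 + 1)! : ℕ) : ℝ) * (N.choose (j + 1 + 1) : ℝ) =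
      (j ! : ℝ) * N.choose j * (((N - j : ℕ) : ℝ) * ((N - j - 1 : ℕ) : ℝ)) := by
    have h : (j + 1 + 1)! * N.choose (j + 1 + 1) = (j ! * N.choose j) * ((N - j) * (N - j - 1)) := by
      rw [← Nat.descFactorial_eq_factorial_mul_choose, ← Nat.descFactorial_eq_factorial_mul_choose,
        Nat.descFactorial_succ, Nat.descFactorial_succ]
      rw [show N - (j + 1) = N - j - 1 by omega]
      ring
    exact_mod_cast h
  have e2 : pathScale (j + 1) j N = ((N - j : ℕ) : ℝ) * Real.sqrt (N.choose j) := by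
    rw [pathScale, show j + 1 - j = 1 by omega, Nat.choose_one_right]
  have h1 : ((N - j : ℕ) : ℝ) ≤ 4 * ((N - j - 1 : ℕ) : ℝ) := by
    exact_mod_cast (by omega : N - j ≤ 4 * (N - j - 1))
  have h2 : ((N - j - 1 : ℕ) : ℝ) ≤ ((N - j : ℕ) : ℝ) := by
    exact_mod_cast (by omega : N - j - 1 ≤ N - j)
  have hf : (1 : ℝ) ≤ j ! := by exact_mod_cast Nat.factorial_pos j
  rw [e1, e2]
  set x : ℝ := ((N - j : ℕ) : ℝ)
  set y : ℝ := ((N - j - 1 : ℕ) : ℝ)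
  have hx : 0 ≤ x := Nat.cast_nonneg _
  have hy : 0 ≤ y := Nat.cast_nonneg _
  set be : ℝ := (N.choose j : ℝ)
  have hbe : 0 ≤ be := Nat.cast_nonneg _
  have hs : Real.sqrt be ^ 2 = be := Real.sq_sqrt hbe
  constructor
  · refine Real.le_sqrt_of_sq_le ?_
    calc (x * Real.sqrt be / 2) ^ 2 = 1 * be * (x * (x / 4)) := by rw [div_pow, mul_pow, hs]; ring
      _ ≤ (j ! : ℝ) * be * (x * y) := by
        gcongr
        linarith
  · refine Real.sqrt_le_iff.2 ⟨by positivity, ?_⟩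
    calc (j ! : ℝ) * be * (x * y) ≤ (j ! : ℝ) * be * (x * x) := by gcongr
      _ = 1 * ((j ! : ℝ) * be * (x * x)) := by ring
      _ ≤ (j ! : ℝ) * ((j ! : ℝ) * be * (x * x)) := by gcongr
      _ = _ := by rw [mul_pow, mul_pow, hs]; ring

lemma tightStat_comparison (hm : 2 ≤ m) {τ₀ : ℝ} (hτ₀ : 0 < τ₀) :
    ∃ t τ₁ : ℝ, τ₀ ≤ τ₁ ∧ ∀ᶠ N in atTop, ∀ A : HGraph m N,
      (A ∉ {A : HGraph m N | 1 / 2 < phat A} → t < tightStat A →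
        τ₀ * (pathScale m (m - 1) N * phat A) < pathForm (m - 1) A) ∧
      (tightStat A ≤ t → pathForm (m - 1) A ≤ τ₁ * (pathScale m (m - 1) N * phat A)) := by
  have hf1 : (1 : ℝ) ≤ (m - 1)! := by exact_mod_cast Nat.factorial_pos _
  set f : ℝ := ((m - 1)! : ℝ) with hf
  have hf0 : 0 < f := by linarith
  refine ⟨4 * f * τ₀, 4 * f * τ₀, by nlinarith, ?_⟩
  filter_upwards [eventually_ge_atTop (4 * m)] with N hN A
  obtain ⟨hQ1, hQ2⟩ := tight_normalization_bounds hm hN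
  have hp0 := phat_nonneg A
  have hp1 : 0 ≤ 1 - phat A := by linarith [phat_le_one A]
  have hZ : 0 < pathScale m (m - 1) N := by
    unfold pathScale
    refine mul_pos ?_ (Real.sqrt_pos.2 ?_) <;>
      exact_mod_cast Nat.choose_pos (by omega)
  unfold tightStat
  rw [tight_numerator_eq (by omega)]
  have hsqrt : Real.sqrt (((m + 1)! : ℝ) * (N.choose (m + 1) : ℝ) * phat A ^ 2 *
      (1 - phat A) ^ 2) = Real.sqrt (((m + 1)! : ℝ) * (N.choose (m + 1) : ℝ)) *
      (phat A * (1 - phat A)) := by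
    rw [mul_assoc, ← mul_pow, Real.sqrt_mul (by positivity), Real.sqrt_sq (by positivity)]
  rw [hsqrt]
  set Q := Real.sqrt (((m + 1)! : ℝ) * (N.choose (m + 1) : ℝ))
  set Z := pathScale m (m - 1) N
  have hv : 0 ≤ phat A * (1 - phat A) := by positivity
  rcases hv.eq_or_lt with h0 | hv
  · rw [pathForm_eq_zero (by omega) h0.symm]
    simp only [mul_zero, zero_div]
    exact ⟨fun _ h => absurd h (not_lt.2 (by positivity)), fun _ => by positivity⟩
  · have hQ0 : 0 < Q := by linarith
    constructor
    · intro hA h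
      have hA : phat A ≤ 1 / 2 := not_lt.1 hA
      rw [lt_div_iff₀ (by positivity)] at h
      refine lt_of_mul_lt_mul_left (a := f) (lt_of_le_of_lt ?_ h) hf0.le
      calc f * (τ₀ * (Z * phat A)) = 4 * f * τ₀ * (Z / 2 * (phat A * (1 / 2))) := by ring
        _ ≤ _ := by
          gcongr
          linarith
    · intro h
      rw [div_le_iff₀ (by positivity)] at h
      refine le_of_mul_le_mul_left (h.trans ?_) hf0
      calc 4 * f * τ₀ * (Q * (phat A * (1 - phat A)))
          ≤ 4 * f * τ₀ * ((f * Z) * (phat A * 1)) := by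
            gcongr
            linarith
        _ = _ := by ring

/-- The loose path test is powerful for planted sets of order at least `√N`. -/
theorem looseStat_powerful (hm : 2 ≤ m) (hn : Tendsto n atTop atTop)
    (hnN : (fun N : ℕ => (n N : ℝ)) =o[atTop] fun N : ℕ => (N : ℝ))
    (hΘ : ∀ᶠ N in atTop, ∀ p ∈ Θ N,
      0 < p.1 ∧ p.1 < p.2 ∧ p.2 < 1 ∧ 0 < matchedProb m N (n N) p.1 p.2)
    (hr : ∀ᶠ N : ℕ in atTop, ∀ p ∈ Θ N,
      (n N : ℝ) ≤ N * ((n N : ℝ) ^ (m - 1) * matchedProb m N (n N) p.1 p.2))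
    (hMp : ∀ᶠ N : ℕ in atTop, ∀ p ∈ Θ N,
      chooseConst m * N ≤ N.choose m * matchedProb m N (n N) p.1 p.2)
    (hO : (fun N : ℕ => Real.sqrt (N : ℝ)) =O[atTop] fun N : ℕ => (n N : ℝ))
    (hS : SignalDiverges m n Θ) :
    ∃ τ : ℕ → ℝ, AsympPowerful m n Θ fun N => {A | τ N < looseStat A} := by
  refine exists_threshold_of_comparison (k := 1) (E := fun _ => ∅)
    (fun ε hε => pathForm_separates le_rfl (by omega) hn hnN hΘ hMp ?_ ?_ hε)
    (fun ε hε => Eventually.of_forall fun N p _ => by simpa using hε.le)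
    (fun τ₀ hτ₀ => looseStat_comparison hm hτ₀)
  · refine eventually_pathScale_le (by omega) hn fun K hK => ?_
    obtain ⟨C, hC, hO⟩ := hO.exists_pos
    filter_upwards [hS.eventually_le hΘ (K := K * (C ^ 2) ^ (m - 2)) (by positivity), hO.bound]
      with N h hN p hp
    have h := h p hp
    set q := matchedProb m N (n N) p.1 p.2
    rw [Real.norm_of_nonneg (by positivity), Real.norm_of_nonneg (by positivity)] at hN
    have hN2 : (N : ℝ) ≤ C ^ 2 * (n N : ℝ) ^ 2 := by
      have := pow_le_pow_left₀ (by positivity) hN 2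
      rwa [Real.sq_sqrt (Nat.cast_nonneg _), mul_pow] at this
    calc K * (q ^ 2 * (N : ℝ) ^ (2 * m - 1))
        = K * (q ^ 2 * (N : ℝ) ^ (m + 1)) * (N : ℝ) ^ (m - 2) := by
          rw [show 2 * m - 1 = (m + 1) + (m - 2) by omega, pow_add]; ring
      _ ≤ K * (q ^ 2 * (N : ℝ) ^ (m + 1)) * (C ^ 2 * (n N : ℝ) ^ 2) ^ (m - 2) := by gcongr
      _ = K * (C ^ 2) ^ (m - 2) * (q ^ 2 * (N : ℝ) ^ (m + 1)) * ((n N : ℝ) ^ 2) ^ (m - 2) := by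
          rw [mul_pow]; ring
      _ ≤ (p.2 - q) ^ 4 * (n N : ℝ) ^ (2 * m + 2) * ((n N : ℝ) ^ 2) ^ (m - 2) := by gcongr
      _ = _ := by
          rw [mul_assoc, ← pow_mul, ← pow_add]; congr 2; omega
  · refine eventually_le_pathSignal (by omega) hn hr (hS.eventually_le hΘ zero_le_one) ?_
    filter_upwards [eventually_ge_atTop 1] with N hN
    have hN : (1 : ℝ) ≤ N := by exact_mod_cast hN
    have := le_self_pow₀ hN (show m - 1 ≠ 0 by omega)
    rw [mul_one]
    gcongr

/-- The tight path test is powerful for planted sets of order below `√N`. -/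
theorem tightStat_powerful (hm : 2 ≤ m) (hn : Tendsto n atTop atTop)
    (hnN : (fun N : ℕ => (n N : ℝ)) =o[atTop] fun N : ℕ => (N : ℝ))
    (hΘ : ∀ᶠ N in atTop, ∀ p ∈ Θ N,
      0 < p.1 ∧ p.1 < p.2 ∧ p.2 < 1 ∧ 0 < matchedProb m N (n N) p.1 p.2)
    (hr : ∀ᶠ N : ℕ in atTop, ∀ p ∈ Θ N,
      (n N : ℝ) ≤ N * ((n N : ℝ) ^ (m - 1) * matchedProb m N (n N) p.1 p.2))
    (hMp : ∀ᶠ N : ℕ in atTop, ∀ p ∈ Θ N,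
      chooseConst m * N ≤ N.choose m * matchedProb m N (n N) p.1 p.2)
    (ho : (fun N : ℕ => (n N : ℝ)) =o[atTop] fun N : ℕ => Real.sqrt (N : ℝ))
    (hS : SignalDiverges m n Θ) :
    ∃ τ : ℕ → ℝ, AsympPowerful m n Θ fun N => {A | τ N < tightStat A} := by
  have hsq : ∀ᶠ N : ℕ in atTop, (n N : ℝ) ^ 2 ≤ N := by
    filter_upwards [ho.bound one_pos] with N hN
    rw [Real.norm_of_nonneg (by positivity), Real.norm_of_nonneg (by positivity), one_mul] at hN
    have := pow_le_pow_left₀ (by positivity) hN 2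
    rwa [Real.sq_sqrt (Nat.cast_nonneg _)] at this
  refine exists_threshold_of_comparison (k := m - 1) (E := fun N => {A | 1 / 2 < phat A})
    (fun ε hε => pathForm_separates (by omega) (by omega) hn hnN hΘ hMp ?_ ?_ hε) ?_
    (fun τ₀ hτ₀ => tightStat_comparison hm hτ₀)
  · refine eventually_pathScale_le (by omega) hn fun K hK => ?_
    have e1 : 2 * m - (m - 1) = m + 1 := by omega
    have e2 : 4 * m - 2 * (m - 1) = 2 * m + 2 := by omega
    rw [e1, e2]
    exact hS.eventually_le hΘ hK
  · refine eventually_le_pathSignal (by omega) hn hr (hS.eventually_le hΘ zero_le_one) ?_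
    filter_upwards [hsq] with N hN
    calc (n N : ℝ) ^ (2 * (m - 1)) * N = (n N : ℝ) ^ 2 * ((n N : ℝ) ^ 2) ^ (m - 2) * N := by
          rw [← pow_succ', ← pow_mul]; congr 2; omega
      _ ≤ (n N : ℝ) ^ 2 * (N : ℝ) ^ (m - 2) * N := by gcongr
      _ = _ := by rw [mul_assoc, ← pow_succ]; congr 2; omega
  · intro ε hε
    filter_upwards [hS.eventually_le hΘ (K := 64) (by norm_num), hΘ, hsq,
      eventually_mul_planted_size_le hnN 8, eventually_planted_size_lt hn hnN,
      eventually_ge_atTop (4 * m), eventually_ge_atTop 1,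
      tendsto_natCast_atTop_atTop.eventually_ge_atTop (16 / (ε * chooseConst m))]
      with N h hΘ hsq h8 hlt hN hN1 hNε p hp
    obtain ⟨hp0, hp01, hp1, hq⟩ := hΘ p hp
    have h := h p hp
    have hmN : m ≤ N := by omega
    have hpq := matchedProb_lt (by omega) hmN hlt hp01
    have hmix := eq_matchedProb_add (m := m) (by omega) hmN hlt p.1 p.2
    set q := matchedProb m N (n N) p.1 p.2
    have hN0 : (0 : ℝ) < N := by exact_mod_cast hN1
    have hM : (0 : ℝ) < N.choose m := by exact_mod_cast Nat.choose_pos hmN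
    -- the signal condition forces `p₀'`, hence `p₀`, to be small
    have hq8 : q ≤ 1 / 8 := by
      have h1 : 64 * q ^ 2 * (N : ℝ) ^ (m + 1) ≤ 1 * (N : ℝ) ^ (m + 1) := by
        calc 64 * q ^ 2 * (N : ℝ) ^ (m + 1) = 64 * (q ^ 2 * (N : ℝ) ^ (m + 1)) := by ring
          _ ≤ (p.2 - q) ^ 4 * (n N : ℝ) ^ (2 * m + 2) := h
          _ ≤ 1 * (n N : ℝ) ^ (2 * m + 2) := by
            gcongr
            exact pow_le_one₀ (by linarith) (by linarith)
          _ = 1 * ((n N : ℝ) ^ 2) ^ (m + 1) := by rw [← pow_mul]; congr 2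
          _ ≤ _ := by gcongr
      have h2 := le_of_mul_le_mul_right h1 (by positivity)
      nlinarith
    have hr8 : ((n N).choose m : ℝ) / N.choose m ≤ 1 / 8 := by
      rw [div_le_iff₀ hM]
      have h1 := mul_choose_le (k := m) (by omega) hlt.le
      refine le_of_mul_le_mul_left ?_ hN0
      have h2 : (8 * (n N : ℝ)) * N.choose m ≤ N * N.choose m := by gcongr
      linarith
    have hp4 : p.1 ≤ 1 / 4 := by
      rw [hmix]
      have : ((n N).choose m : ℝ) / N.choose m * (p.2 - q) ≤ 1 / 8 * 1 :=
        mul_le_mul hr8 (by linarith) (by linarith) (by norm_num)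
      linarith
    have hsum := sum_plantedProb (m := m) hmN (S := (∅ : Finset (Fin N))) rfl p.1 0
    simp only [mul_zero, add_zero] at hsum
    have hqm := plantedProb_mem (m := m) (∅ : Finset (Fin N)) hp0.le le_rfl
      (by linarith : p.1 + 0 ≤ 1)
    have hprob := measureReal_phat_sub_sq_ge hmN hqm hsum (t := 1 / 16) (by norm_num)
    rw [nullLaw_eq]
    refine (measureReal_mono (s₂ := {A | 1 / 16 ≤ (phat A - p.1) ^ 2}) ?_).trans
      (hprob.trans ?_)
    · intro A hA
      have hA : 1 / 2 < phat A := hA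
      change 1 / 16 ≤ (phat A - p.1) ^ 2
      nlinarith
    · have hcM : chooseConst m * N ≤ N.choose m := by
        refine le_trans ?_ (le_choose (m := m) (i := 0) (j := m) (by omega) le_rfl hN)
        have h1 : (1 : ℝ) ≤ N := by exact_mod_cast hN1
        exact mul_le_mul_of_nonneg_left (le_self_pow₀ h1 (by omega)) (chooseConst_pos m).le
      have hc := chooseConst_pos m
      rw [div_le_iff₀ (by positivity)] at hNε
      rw [div_le_iff₀ (by positivity)]
      have h3 : p.1 * (1 - p.1) ≤ 1 := by nlinarith
      have h4 : ε * (chooseConst m * N) ≤ ε * N.choose m := by gcongr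
      linarith

end PathTests

/-! ### The Bernoulli Kullback–Leibler divergence -/

section KL

/-- The log-likelihood ratio, per observation, of Bernoulli `q` against Bernoulli `p` at the
empirical frequency `x`. -/
noncomputable def bernLLR (p q x : ℝ) : ℝ :=
  x * Real.log (q / p) + (1 - x) * Real.log ((1 - q) / (1 - p))

lemma bernKL_eq_bernLLR (p q : ℝ) : bernKL p q = bernLLR p q q := rfl

lemma sub_le_mul_log_div {x p : ℝ} (hx : 0 ≤ x) (hp : 0 < p) : x - p ≤ x * Real.log (x / p) := by
  rcases hx.eq_or_lt with rfl | hx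
  · simp [hp.le]
  · have h := Real.one_sub_inv_le_log_of_pos (div_pos hx hp)
    have h2 := mul_le_mul_of_nonneg_left h hx.le
    rw [inv_div, mul_sub, mul_one, mul_div_cancel₀ _ hx.ne'] at h2
    exact h2

lemma bernKL_nonneg {p x : ℝ} (hp0 : 0 < p) (hp1 : p < 1) (hx0 : 0 ≤ x) (hx1 : x ≤ 1) :
    0 ≤ bernKL p x := by
  have h1 := sub_le_mul_log_div hx0 hp0
  have h2 := sub_le_mul_log_div (x := 1 - x) (p := 1 - p) (by linarith) (by linarith)
  unfold bernKL
  linarith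

lemma mul_log_div_split {x p q : ℝ} (hp : 0 < p) (hq : 0 < q) :
    x * Real.log (x / p) = x * Real.log (x / q) + x * Real.log (q / p) := by
  by_cases hx : x = 0
  · simp [hx]
  · rw [Real.log_div hx hp.ne', Real.log_div hx hq.ne', Real.log_div hq.ne' hp.ne']; ring

/-- Changing the reference law of the divergence. -/
lemma bernKL_eq_add {p q x : ℝ} (hp0 : 0 < p) (hp1 : p < 1) (hq0 : 0 < q) (hq1 : q < 1) :
    bernKL p x = bernKL q x + bernLLR p q x := by
  unfold bernKL bernLLR
  rw [mul_log_div_split (x := x) hp0 hq0,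
    mul_log_div_split (x := 1 - x) (p := 1 - p) (q := 1 - q) (by linarith) (by linarith)]
  ring

lemma bernLLR_le_bernKL {p q x : ℝ} (hp0 : 0 < p) (hp1 : p < 1) (hq0 : 0 < q) (hq1 : q < 1)
    (hx0 : 0 ≤ x) (hx1 : x ≤ 1) : bernLLR p q x ≤ bernKL p x := by
  rw [bernKL_eq_add hp0 hp1 hq0 hq1]
  linarith [bernKL_nonneg hq0 hq1 hx0 hx1]

lemma bernLLR_le {p q x : ℝ} (hp0 : 0 < p) (hp1 : p < 1) (hq0 : 0 < q) (hq1 : q < 1)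
    (hx0 : 0 ≤ x) (hx1 : x ≤ 1) : bernLLR p q x ≤ (q - p) * (x - p) / (p * (1 - p)) := by
  have hp1' : 0 < 1 - p := by linarith
  have hq1' : 0 < 1 - q := by linarith
  have h1 := mul_le_mul_of_nonneg_left (Real.log_le_sub_one_of_pos (div_pos hq0 hp0)) hx0
  have h2 := mul_le_mul_of_nonneg_left (Real.log_le_sub_one_of_pos (div_pos hq1' hp1'))
    (by linarith : 0 ≤ 1 - x)
  have h3 : x * (q / p - 1) + (1 - x) * ((1 - q) / (1 - p) - 1) =
      (q - p) * (x - p) / (p * (1 - p)) := by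
    field_simp
    ring
  unfold bernLLR
  linarith

lemma bernKL_le_sq {p q : ℝ} (hp0 : 0 < p) (hp1 : p < 1) (hq0 : 0 < q) (hq1 : q < 1) :
    bernKL p q ≤ (q - p) ^ 2 / (p * (1 - p)) := by
  rw [bernKL_eq_bernLLR, sq]
  exact bernLLR_le hp0 hp1 hq0 hq1 hq0.le hq1.le

/-- A Bernstein-type lower bound, from the variational formula for the divergence with a small
exponential tilt. -/
lemma le_bernKL_of_tilt {p x l : ℝ} (hp0 : 0 < p) (hp1 : p < 1) (hx0 : 0 ≤ x) (hx1 : x ≤ 1)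
    (hl0 : 0 ≤ l) (hl1 : l ≤ 1) : l * (x - p) - p * (1 - p) * l ^ 2 ≤ bernKL p x := by
  have hp1' : 0 < 1 - p := by linarith
  set Z := 1 - p + p * Real.exp l with hZ
  have hZ0 : 0 < Z := by positivity
  have hq0 : 0 < p * Real.exp l / Z := by positivity
  have hq1 : 1 - p * Real.exp l / Z = (1 - p) / Z := by
    rw [eq_div_iff hZ0.ne', sub_mul, div_mul_cancel₀ _ hZ0.ne', hZ]; ring
  have h := bernLLR_le_bernKL hp0 hp1 hq0 (by
    have : 0 < (1 - p) / Z := by positivity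
    linarith) hx0 hx1
  refine le_trans ?_ h
  have e1 : Real.log (p * Real.exp l / Z / p) = l - Real.log Z := by
    rw [show p * Real.exp l / Z / p = Real.exp l / Z by field_simp,
      Real.log_div (Real.exp_ne_zero _) hZ0.ne', Real.log_exp]
  have e2 : Real.log ((1 - p) / Z / (1 - p)) = - Real.log Z := by
    rw [show (1 - p) / Z / (1 - p) = Z⁻¹ by field_simp, Real.log_inv]
  unfold bernLLR
  rw [hq1, e1, e2]
  have hlog : Real.log Z ≤ p * l + p * (1 - p) * l ^ 2 := by
    have b1 := abs_le.1 (Real.abs_exp_sub_one_sub_id_le (x := -(p * l)) (by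
      rw [abs_neg, abs_of_nonneg (by positivity)]; nlinarith))
    have b2 := abs_le.1 (Real.abs_exp_sub_one_sub_id_le (x := (1 - p) * l) (by
      rw [abs_of_nonneg (by positivity)]; nlinarith))
    have hW : Z * Real.exp (-(p * l)) = (1 - p) * Real.exp (-(p * l)) +
        p * Real.exp ((1 - p) * l) := by
      have : Real.exp ((1 - p) * l) = Real.exp l * Real.exp (-(p * l)) := by
        rw [← Real.exp_add]; congr 1; ring
      rw [this, hZ]; ring
    have hW2 : Z * Real.exp (-(p * l)) ≤ 1 + p * (1 - p) * l ^ 2 := by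
      rw [hW]
      have c1 := mul_le_mul_of_nonneg_left b1.2 hp1'.le
      have c2 := mul_le_mul_of_nonneg_left b2.2 hp0.le
      nlinarith
    have h3 := Real.log_le_sub_one_of_pos (x := Z * Real.exp (-(p * l))) (by positivity)
    rw [Real.log_mul hZ0.ne' (Real.exp_ne_zero _), Real.log_exp] at h3
    linarith
  nlinarith

/-- The divergence is at least quadratic for small, and linear for large deviations. -/
lemma min_le_bernKL {p x : ℝ} (hp0 : 0 < p) (hp1 : p < 1) (hpx : p ≤ x) (hx1 : x ≤ 1) :
    (x - p ≤ 2 * (p * (1 - p)) → (x - p) ^ 2 ≤ 4 * (p * (1 - p)) * bernKL p x) ∧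
    (2 * (p * (1 - p)) ≤ x - p → x - p ≤ 2 * bernKL p x) := by
  have hv : 0 < p * (1 - p) := mul_pos hp0 (by linarith)
  constructor
  · intro h
    have h1 := le_bernKL_of_tilt (l := (x - p) / (2 * (p * (1 - p)))) hp0 hp1 (by linarith) hx1
      (div_nonneg (by linarith) (by linarith)) (by rw [div_le_one (by linarith)]; exact h)
    have h2 : (x - p) / (2 * (p * (1 - p))) * (x - p) -
        p * (1 - p) * ((x - p) / (2 * (p * (1 - p)))) ^ 2 =
        (x - p) ^ 2 / (4 * (p * (1 - p))) := by
      generalize p * (1 - p) = v at *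
      field_simp
      ring
    rw [h2, div_le_iff₀ (by linarith)] at h1
    linarith
  · intro h
    have h1 := le_bernKL_of_tilt (l := 1) hp0 hp1 (by linarith) hx1 zero_le_one le_rfl
    linarith

lemma bernLLR_mono {p q x y : ℝ} (hp0 : 0 < p) (hpq : p ≤ q) (hq1 : q < 1) (hxy : x ≤ y) :
    bernLLR p q x ≤ bernLLR p q y := by
  have h1 : 0 ≤ Real.log (q / p) := Real.log_nonneg (by rwa [le_div_iff₀ hp0, one_mul])
  have h2 : Real.log ((1 - q) / (1 - p)) ≤ 0 := by
    refine Real.log_nonpos (div_nonneg (by linarith) (by linarith)) ?_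
    rw [div_le_one (by linarith)]; linarith
  unfold bernLLR
  nlinarith

lemma bernKL_mono {p a b : ℝ} (hp0 : 0 < p) (hpa : p ≤ a) (hab : a ≤ b) (hb1 : b ≤ 1) :
    bernKL p a ≤ bernKL p b := by
  rcases hab.eq_or_lt with rfl | hab
  · exact le_rfl
  · have ha1 : a < 1 := by linarith
    rw [bernKL_eq_bernLLR]
    exact (bernLLR_mono hp0 hpa ha1 hab.le).trans
      (bernLLR_le_bernKL hp0 (by linarith) (by linarith) ha1 (by linarith) hb1)

lemma mul_log_sq_le_of_le_one {u : ℝ} (hu0 : 0 < u) (hu1 : u ≤ 1) :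
    u * Real.log u ^ 2 ≤ 2 * (u * Real.log u - u + 1) := by
  have ht : 0 ≤ -Real.log u := by linarith [Real.log_nonpos hu0.le hu1]
  have h := Real.quadratic_le_exp_of_nonneg ht
  rw [Real.exp_neg, Real.exp_log hu0] at h
  have h2 := mul_le_mul_of_nonneg_left h hu0.le
  rw [mul_inv_cancel₀ hu0.ne'] at h2
  nlinarith

lemma mul_log_sq_le_of_one_le {v : ℝ} (hv : 1 ≤ v) :
    v * Real.log v ^ 2 ≤ 4 * (1 + Real.log v) * (v * Real.log v - v + 1) := by
  have hv0 : 0 < v := by linarith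
  set t := Real.log v with ht
  have ht0 : 0 ≤ t := Real.log_nonneg hv
  have hvt : v⁻¹ = Real.exp (-t) := by rw [Real.exp_neg, ht, Real.exp_log hv0]
  have key : t ^ 2 ≤ 4 * (1 + t) * (t - 1 + v⁻¹) := by
    by_cases h2 : t ≤ 2
    · have h3 : (1 - t / 2) ^ 2 ≤ v⁻¹ := by
        rw [hvt, show -t = -(t / 2) + -(t / 2) by ring, Real.exp_add, ← sq]
        exact pow_le_pow_left₀ (by linarith) (by linarith [Real.add_one_le_exp (-(t / 2))]) 2
      have h4 : 4 * (1 + t) * (t - 1 + (1 - t / 2) ^ 2) ≤ 4 * (1 + t) * (t - 1 + v⁻¹) := by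
        gcongr
      nlinarith [pow_nonneg ht0 3]
    · have h3 : 0 < v⁻¹ := by positivity
      have h4 : 4 * (1 + t) * (t - 1 + 0) ≤ 4 * (1 + t) * (t - 1 + v⁻¹) := by gcongr
      nlinarith
  calc v * t ^ 2 ≤ v * (4 * (1 + t) * (t - 1 + v⁻¹)) := by gcongr
    _ = 4 * (1 + t) * (v * t - v + v * v⁻¹) := by ring
    _ = _ := by rw [mul_inv_cancel₀ hv0.ne']

/-- The variance of the log-likelihood ratio is bounded by its mean, up to a logarithm. -/
lemma bernLLR_variance_le {p q : ℝ} (hp0 : 0 < p) (hpq : p ≤ q) (hq1 : q < 1) :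
    (Real.log (q / p) - Real.log ((1 - q) / (1 - p))) ^ 2 * (q * (1 - q)) ≤
      4 * (1 + Real.log (1 / p)) * bernKL p q := by
  have hp1 : 0 < 1 - p := by linarith
  have hq1' : 0 < 1 - q := by linarith
  have hq0 : 0 < q := by linarith
  have hv : 1 ≤ q / p := by rwa [le_div_iff₀ hp0, one_mul]
  have hu0 : 0 < (1 - q) / (1 - p) := by positivity
  have hu1 : (1 - q) / (1 - p) ≤ 1 := by rw [div_le_one hp1]; linarith
  have h1 := mul_le_mul_of_nonneg_left (mul_log_sq_le_of_one_le hv) hp0.le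
  have h2 := mul_le_mul_of_nonneg_left (mul_log_sq_le_of_le_one hu0 hu1) hp1.le
  have hlogv : Real.log (q / p) ≤ Real.log (1 / p) :=
    Real.log_le_log (by positivity) (by gcongr)
  have hL : 0 ≤ Real.log (q / p) := Real.log_nonneg hv
  set A := Real.log (q / p)
  set B := Real.log ((1 - q) / (1 - p))
  set L := Real.log (1 / p)
  have e1 : p * (q / p) = q := by field_simp
  have e2 : (1 - p) * ((1 - q) / (1 - p)) = 1 - q := by field_simp
  have f1 : 0 ≤ q * A - q + p := by
    have := sub_le_mul_log_div hq0.le hp0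
    linarith
  have f2 : 0 ≤ (1 - q) * B - (1 - q) + (1 - p) := by
    have := sub_le_mul_log_div (x := 1 - q) hq1'.le hp1
    linarith
  have g1 : q * A ^ 2 ≤ 4 * (1 + L) * (q * A - q + p) := by
    calc q * A ^ 2 = p * (q / p * A ^ 2) := by rw [← mul_assoc, e1]
      _ ≤ p * (4 * (1 + A) * (q / p * A - q / p + 1)) := h1
      _ = 4 * (1 + A) * (p * (q / p) * A - p * (q / p) + p) := by ring
      _ = 4 * (1 + A) * (q * A - q + p) := by rw [e1]
      _ ≤ _ := by gcongr
  have g2 : (1 - q) * B ^ 2 ≤ 4 * (1 + L) * ((1 - q) * B - (1 - q) + (1 - p)) := by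
    calc (1 - q) * B ^ 2 = (1 - p) * ((1 - q) / (1 - p) * B ^ 2) := by rw [← mul_assoc, e2]
      _ ≤ (1 - p) * (2 * ((1 - q) / (1 - p) * B - (1 - q) / (1 - p) + 1)) := h2
      _ = 2 * ((1 - p) * ((1 - q) / (1 - p)) * B - (1 - p) * ((1 - q) / (1 - p)) + (1 - p)) := by
        ring
      _ = 2 * ((1 - q) * B - (1 - q) + (1 - p)) := by rw [e2]
      _ ≤ _ := by
        refine mul_le_mul_of_nonneg_right ?_ f2
        linarith
  have hsq := sq_nonneg (q * A + (1 - q) * B)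
  have hKL : bernKL p q = q * A + (1 - q) * B := rfl
  rw [hKL]
  nlinarith

lemma bernKL_le_mul_log {p q : ℝ} (hp0 : 0 < p) (hpq : p ≤ q) (hq1 : q < 1) :
    bernKL p q ≤ q * Real.log (1 / p) := by
  have hq0 : 0 < q := by linarith
  have h1 : Real.log (q / p) ≤ Real.log (1 / p) :=
    Real.log_le_log (by positivity) (by gcongr)
  have h2 : Real.log ((1 - q) / (1 - p)) ≤ 0 := by
    refine Real.log_nonpos (div_nonneg (by linarith) (by linarith)) ?_
    rw [div_le_one (by linarith)]; linarith
  unfold bernKL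
  nlinarith

lemma mul_bernKL_le_one_sub {p q : ℝ} (hp0 : 0 < p) (hpq : p ≤ q) (hq1 : q < 1) :
    p * bernKL p q ≤ 1 - p := by
  have h1 := bernKL_le_mul_log hp0 hpq hq1
  have h0 : 0 ≤ Real.log (1 / p) := Real.log_nonneg (by rw [le_div_iff₀ hp0]; linarith)
  have h2 : Real.log (1 / p) ≤ 1 / p - 1 := Real.log_le_sub_one_of_pos (by positivity)
  have h3 : bernKL p q ≤ 1 / p - 1 := by nlinarith
  have h4 := mul_le_mul_of_nonneg_left h3 hp0.le
  rwa [mul_sub, mul_one, mul_one_div, div_self hp0.ne'] at h4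

lemma mul_log_sub_le_bernKL {p x : ℝ} (hp0 : 0 < p) (hp1 : p < 1) (hx1 : x ≤ 1) :
    x * Real.log (x / p) - x ≤ bernKL p x := by
  have h2 := sub_le_mul_log_div (x := 1 - x) (p := 1 - p) (by linarith) (by linarith)
  unfold bernKL
  linarith

lemma continuous_bernKL {p : ℝ} (hp0 : 0 < p) (hp1 : p < 1) : Continuous (bernKL p) := by
  have h : ∀ r : ℝ, 0 < r → ∀ x : ℝ, x * Real.log (x / r) = x * Real.log x - x * Real.log r := by
    intro r hr x
    by_cases hx : x = 0
    · simp [hx]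
    · rw [Real.log_div hx hr.ne']; ring
  have hfun : bernKL p = fun x => (x * Real.log x - x * Real.log p) +
      ((1 - x) * Real.log (1 - x) - (1 - x) * Real.log (1 - p)) := by
    funext x
    unfold bernKL
    rw [h p hp0, h (1 - p) (by linarith)]
  rw [hfun]
  have h1 : Continuous fun x : ℝ => (1 - x) * Real.log (1 - x) :=
    Real.continuous_mul_log.comp (continuous_const.sub continuous_id)
  have h2 := Real.continuous_mul_log
  fun_prop

end KL

/-! ### Type I error of the scan test -/

section Scan

variable {m N : ℕ}

lemma edgesIn_eq (A : HGraph m N) (S : Finset (Fin N)) :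
    (edgesIn A S : ℝ) = ∑ e, insideInd S e * A.val e := by
  unfold edgesIn insideInd HGraph.val
  rw [Finset.card_filter]
  push_cast
  refine Finset.sum_congr rfl fun e _ => ?_
  by_cases h1 : e.1 ⊆ S <;> by_cases h2 : A e = true <;> simp [h1, h2]

lemma edgesIn_le {n : ℕ} (A : HGraph m N) {S : Finset (Fin N)} (hS : S.card = n) :
    (edgesIn A S : ℝ) ≤ n.choose m := by
  rw [edgesIn_eq, ← sum_insideInd hS]
  exact Finset.sum_le_sum fun e _ =>
    mul_le_of_le_one_right (insideInd_nonneg S e) (A.val_le_one e)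

lemma edgesIn_le_scanStat {n : ℕ} (A : HGraph m N) {S : Finset (Fin N)} (hS : S.card = n) :
    edgesIn A S ≤ scanStat n A :=
  Finset.le_sup (f := edgesIn A) (Finset.mem_powersetCard.2 ⟨Finset.subset_univ _, hS⟩)

lemma exists_edgesIn_eq_scanStat {n : ℕ} (hnN : n ≤ N) (A : HGraph m N) :
    ∃ S : Finset (Fin N), S.card = n ∧ edgesIn A S = scanStat n A := by
  have hne : ((Finset.univ : Finset (Fin N)).powersetCard n).Nonempty :=
    Finset.powersetCard_nonempty.2 (by simpa using hnN)
  obtain ⟨S, hS, h⟩ := Finset.exists_mem_eq_sup _ hne (edgesIn A)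
  exact ⟨S, (Finset.mem_powersetCard.1 hS).2, h.symm⟩

/-- The exponential moment of the number of edges inside a set. -/
lemma integral_exp_edgesIn {n : ℕ} {S : Finset (Fin N)} (hS : S.card = n) {p : ℝ} (hp0 : 0 ≤ p)
    (hp1 : p ≤ 1) (l : ℝ) :
    ∫ A, Real.exp (l * edgesIn A S) ∂nullLaw m N p =
      (1 - p + p * Real.exp l) ^ (n.choose m) := by
  have h := integral_prod_indepEdgeLaw (m := m) (N := N) (q := fun _ => p) (fun _ => ⟨hp0, hp1⟩)
    (fun e b => Real.exp (l * (insideInd S e * if b = true then 1 else 0)))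
  have h1 : ∀ A : HGraph m N, Real.exp (l * edgesIn A S) =
      ∏ e, Real.exp (l * (insideInd S e * if A e = true then 1 else 0)) := by
    intro A
    rw [← Real.exp_sum, ← Finset.mul_sum, edgesIn_eq]
    rfl
  unfold nullLaw
  simp_rw [h1]
  rw [h]
  have h2 : ∀ e : HEdge m N,
      p * Real.exp (l * (insideInd S e * if true = true then 1 else 0)) +
        (1 - p) * Real.exp (l * (insideInd S e * if false = true then 1 else 0)) =
      if ∅ ⊆ e.1 ∧ e.1 ⊆ S then 1 - p + p * Real.exp l else 1 := by
    intro e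
    unfold insideInd
    by_cases h : e.1 ⊆ S
    · simp [h]; ring
    · simp [h]
  rw [Finset.prod_congr rfl fun e _ => h2 e, ← Finset.prod_filter, Finset.prod_const,
    card_edges_between (Nat.zero_le m) (Finset.empty_subset S), hS]
  simp

lemma nullLaw_edgesIn_ge_le_pow {n : ℕ} {S : Finset (Fin N)} (hS : S.card = n) {p : ℝ}
    (hp0 : 0 ≤ p) (hp1 : p ≤ 1) (a : ℝ) {l : ℝ} (hl : 0 ≤ l) :
    (nullLaw m N p).real {A | n.choose m * a ≤ edgesIn A S} ≤
      ((1 - p + p * Real.exp l) * Real.exp (-(l * a))) ^ (n.choose m) := by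
  have hsub : {A : HGraph m N | n.choose m * a ≤ edgesIn A S} ⊆
      {A | Real.exp (l * (n.choose m * a)) ≤ Real.exp (l * edgesIn A S)} := by
    intro A hA
    exact Real.exp_le_exp.2 (mul_le_mul_of_nonneg_left hA hl)
  refine (measureReal_mono hsub).trans
    ((measureReal_le_integral_div _ (fun A => (Real.exp_pos _).le) (Real.exp_pos _)).trans ?_)
  rw [integral_exp_edgesIn hS hp0 hp1, mul_pow, div_eq_mul_inv, ← Real.exp_neg,
    ← Real.exp_nat_mul]
  refine le_of_eq ?_
  congr 2
  ring

/-- Chernoff's bound. At `a = 1` the optimal exponential tilt is only reached in the limit. -/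
lemma nullLaw_edgesIn_ge_le {n : ℕ} {S : Finset (Fin N)} (hS : S.card = n) {p a : ℝ} (hp0 : 0 < p)
    (hp1 : p < 1) (hpa : p ≤ a) (ha1 : a ≤ 1) :
    (nullLaw m N p).real {A | n.choose m * a ≤ edgesIn A S} ≤
      Real.exp (-(n.choose m * bernKL p a)) := by
  have hp1' : 0 < 1 - p := by linarith
  rcases ha1.eq_or_lt with rfl | ha1
  · have hKL : Real.exp (-(n.choose m * bernKL p 1)) = p ^ (n.choose m) := by
      have : bernKL p 1 = -Real.log p := by simp [bernKL]
      rw [this, mul_neg, neg_neg, Real.exp_nat_mul, Real.exp_log hp0]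
    rw [hKL]
    have hlim : Tendsto (fun l : ℝ => ((1 - p + p * Real.exp l) * Real.exp (-(l * 1))) ^
        (n.choose m)) atTop (𝓝 (((1 - p) * 0 + p) ^ (n.choose m))) := by
      have h1 : ∀ l : ℝ, (1 - p) * Real.exp (-l) + p =
          (1 - p + p * Real.exp l) * Real.exp (-(l * 1)) := by
        intro l
        have : Real.exp l * Real.exp (-l) = 1 := by rw [← Real.exp_add]; simp
        rw [mul_one, add_mul, mul_assoc, this, mul_one]
      simp_rw [← h1]
      exact ((Real.tendsto_exp_neg_atTop_nhds_zero.const_mul (1 - p)).add_const p).pow _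
    rw [mul_zero, zero_add] at hlim
    refine ge_of_tendsto hlim ?_
    filter_upwards [eventually_ge_atTop 0] with l hl
    exact nullLaw_edgesIn_ge_le_pow hS hp0.le hp1.le 1 hl
  · have ha0 : 0 < a := by linarith
    have ha1' : 0 < 1 - a := by linarith
    set u := Real.log (a / p) with hu
    set v := Real.log ((1 - a) / (1 - p)) with hv
    have hu0 : 0 ≤ u := Real.log_nonneg (by rwa [le_div_iff₀ hp0, one_mul])
    have hv0 : v ≤ 0 := by
      refine Real.log_nonpos (by positivity) ?_
      rw [div_le_one hp1']; linarith
    refine (nullLaw_edgesIn_ge_le_pow hS hp0.le hp1.le a (l := u - v) (by linarith)).trans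
      (le_of_eq ?_)
    have hZ : 1 - p + p * Real.exp (u - v) = Real.exp (-v) := by
      rw [Real.exp_sub, Real.exp_neg, hu, hv, Real.exp_log (by positivity),
        Real.exp_log (by positivity)]
      field_simp
      ring
    rw [hZ, ← Real.exp_add, ← Real.exp_nat_mul]
    congr 1
    have : bernKL p a = a * u + (1 - a) * v := rfl
    rw [this]
    ring

/-- The divergence of the edge frequency inside a fixed set is exponentially unlikely to be large:
by monotonicity the event is an upper tail event, to which Chernoff's bound applies. -/
lemma nullLaw_bernKL_edgesIn_le {n : ℕ} (hmn : m ≤ n) {S : Finset (Fin N)} (hS : S.card = n)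
    {p : ℝ} (hp0 : 0 < p) (hp1 : p < 1) (h₀ : ℝ) :
    (nullLaw m N p).real {A | p ≤ edgesIn A S / (n.choose m : ℝ) ∧
      h₀ ≤ bernKL p (edgesIn A S / (n.choose m : ℝ))} ≤ Real.exp (-(n.choose m * h₀)) := by
  have hG : (0 : ℝ) < n.choose m := by exact_mod_cast Nat.choose_pos hmn
  set E : Set (HGraph m N) := {A | p ≤ edgesIn A S / (n.choose m : ℝ) ∧
      h₀ ≤ bernKL p (edgesIn A S / (n.choose m : ℝ))} with hE
  rcases E.eq_empty_or_nonempty with h | h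
  · rw [h, measureReal_empty]; positivity
  obtain ⟨A₀, hA₀, hmin⟩ := Set.exists_min_image E (fun A => edgesIn A S) (Set.toFinite _) h
  set a : ℝ := edgesIn A₀ S / (n.choose m : ℝ) with ha
  have ha1 : a ≤ 1 := by rw [ha, div_le_one hG]; exact edgesIn_le A₀ hS
  have hsub : E ⊆ {A | n.choose m * a ≤ edgesIn A S} := by
    intro A hA
    change (n.choose m : ℝ) * a ≤ edgesIn A S
    rw [ha, mul_div_cancel₀ _ hG.ne']
    exact_mod_cast hmin A hA
  refine (measureReal_mono hsub).trans ((nullLaw_edgesIn_ge_le hS hp0 hp1 hA₀.1 ha1).trans ?_)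
  refine Real.exp_le_exp.2 (neg_le_neg ?_)
  exact mul_le_mul_of_nonneg_left hA₀.2 hG.le

lemma choose_le_exp {n : ℕ} (hn : 1 ≤ n) (hnN : n ≤ N) :
    (N.choose n : ℝ) ≤ Real.exp (n * (Real.log ((N : ℝ) / n) + 1)) := by
  have hn0 : (0 : ℝ) < n := by exact_mod_cast hn
  have hN0 : (0 : ℝ) < N := by exact_mod_cast (by omega : 0 < N)
  have h1 : (N.choose n : ℝ) ≤ (N : ℝ) ^ n / n ! := Nat.choose_le_pow_div n N
  have h2 : (n : ℝ) ^ n / n ! ≤ Real.exp n := Real.pow_div_factorial_le_exp n hn0.le n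
  calc (N.choose n : ℝ) ≤ (N : ℝ) ^ n / n ! := h1
    _ = ((N : ℝ) / n) ^ n * ((n : ℝ) ^ n / n !) := by
      rw [div_pow]; field_simp
    _ ≤ ((N : ℝ) / n) ^ n * Real.exp n := by gcongr
    _ = _ := by
      rw [mul_add, mul_one, Real.exp_add, Real.exp_nat_mul, Real.exp_log (by positivity)]

set_option maxHeartbeats 400000 in
/-- Replacing the estimated density by the true one changes the divergence at the critical value
by little. -/
lemma critical_value_bounds {p₀ ph a G M n L w : ℝ} (hp0 : 0 < p₀) (hp1 : p₀ < 1)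
    (hG : 0 < G) (hM : 0 < M) (hn : 0 < n) (hL : 0 ≤ L) (hw : 0 < w)
    (hph : (ph - p₀) ^ 2 ≤ w ^ 2 * (p₀ * (1 - p₀)) / M)
    (h1 : 256 * w ^ 2 * (L + 2) ^ 2 ≤ M * (p₀ * (1 - p₀)))
    (h2 : 64 * w ^ 2 * (L + 2) * G ≤ n * M)
    (hpa : ph ≤ a) (ha1 : a ≤ 1) (hKL : bernKL ph a = n * (L + 2) / G) :
    p₀ ≤ a ∧ n * (L + 3 / 2) / G ≤ bernKL p₀ a := by
  have hv0 : 0 < p₀ * (1 - p₀) := mul_pos hp0 (by linarith)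
  set v := p₀ * (1 - p₀) with hv
  set y := |ph - p₀| with hy
  have hy0 : 0 ≤ y := abs_nonneg _
  have hy2 : y ^ 2 * M ≤ w ^ 2 * v := by
    rw [hy, sq_abs]; rwa [le_div_iff₀ hM] at hph
  have hL2 : 2 ≤ L + 2 := by linarith
  have hyL : 16 * (y * (L + 2)) ≤ v := by
    refine le_of_sq_le_sq ?_ hv0.le
    refine le_of_mul_le_mul_right ?_ hM
    calc (16 * (y * (L + 2))) ^ 2 * M = 256 * (L + 2) ^ 2 * (y ^ 2 * M) := by ring
      _ ≤ 256 * (L + 2) ^ 2 * (w ^ 2 * v) := by gcongr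
      _ = (256 * w ^ 2 * (L + 2) ^ 2) * v := by ring
      _ ≤ (M * v) * v := by gcongr
      _ = _ := by ring
  have hyv : y ≤ v / 2 := by nlinarith
  have hyabs := abs_le.1 (le_refl y)
  have hvh : v / 2 ≤ ph * (1 - ph) := by
    have e : ph * (1 - ph) = v + (ph - p₀) * (1 - ph - p₀) := by rw [hv]; ring
    have h3 : |(ph - p₀) * (1 - ph - p₀)| ≤ y := by
      rw [abs_mul]
      refine mul_le_of_le_one_right hy0 ?_
      have hv1 : v ≤ p₀ := by rw [hv]; nlinarith
      have hv2 : v ≤ 1 - p₀ := by rw [hv]; nlinarith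
      rw [abs_le]; constructor <;> linarith [hyabs.1, hyabs.2]
    have := (abs_le.1 h3).1
    rw [e]; linarith
  have hph01 : 0 < ph ∧ ph < 1 := by
    have hv1 : v ≤ p₀ := by rw [hv]; nlinarith
    have hv2 : v ≤ 1 - p₀ := by rw [hv]; nlinarith
    constructor <;> linarith [hyabs.1, hyabs.2]
  obtain ⟨hph0, hph1⟩ := hph01
  have hKLlow : n * (L + 3 / 2) / G ≤ bernKL p₀ a := by
    set vh := ph * (1 - ph) with hvh_def
    have hvh0 : 0 < vh := by linarith
    have hchange := bernKL_eq_add (x := a) hph0 hph1 hp0 hp1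
    have hle := bernLLR_le (x := a) hph0 hph1 hp0 hp1 (by linarith) ha1
    -- the tilt balancing the two terms of the bound on `a - ph`
    set t := 1 + 4 * G * y / n with ht
    have ht1 : 1 ≤ t := by rw [ht]; exact le_add_of_nonneg_right (by positivity)
    have ht0 : 0 < t := by linarith
    have htilt := le_bernKL_of_tilt (l := 1 / t) hph0 hph1 (by linarith) ha1 (by positivity)
      (by rw [div_le_one ht0]; exact ht1)
    have hd : a - ph ≤ t * bernKL ph a + vh / t := by
      have h3 := mul_le_mul_of_nonneg_left htilt ht0.le
      have h4 : t * (1 / t * (a - ph) - ph * (1 - ph) * (1 / t) ^ 2) = (a - ph) - vh / t := by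
        rw [hvh_def]; field_simp
      rw [h4] at h3
      linarith
    have hnum : (p₀ - ph) * (a - ph) ≤ y * (t * bernKL ph a + vh / t) := by
      have h5 : p₀ - ph ≤ y := by linarith [hyabs.1]
      calc (p₀ - ph) * (a - ph) ≤ y * (a - ph) :=
            mul_le_mul_of_nonneg_right h5 (by linarith)
        _ ≤ _ := by gcongr
    have hfinal : y * (t * bernKL ph a + vh / t) / vh ≤ n / (2 * G) := by
      have h6 : y / t ≤ n / (4 * G) := by
        rw [div_le_div_iff₀ ht0 (by positivity), ht]
        have : n * (1 + 4 * G * y / n) = n + 4 * G * y := by field_simp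
        rw [this]; linarith
      have h7 : y * (t * bernKL ph a) / vh ≤ n / (4 * G) := by
        rw [div_le_iff₀ hvh0, hKL]
        have h8 : y * (t * (n * (L + 2) / G)) =
            (y * (L + 2)) * n / G + 4 * y ^ 2 * (L + 2) := by
          rw [ht]; field_simp
        have h9 : 64 * y ^ 2 * (L + 2) * G ≤ n * v := by
          refine le_of_mul_le_mul_right ?_ hM
          calc 64 * y ^ 2 * (L + 2) * G * M = 64 * (L + 2) * G * (y ^ 2 * M) := by ring
            _ ≤ 64 * (L + 2) * G * (w ^ 2 * v) := by gcongr
            _ = (64 * w ^ 2 * (L + 2) * G) * v := by ring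
            _ ≤ n * M * v := by gcongr
            _ = _ := by ring
        have h10 : 4 * y ^ 2 * (L + 2) ≤ n / (16 * G) * v := by
          rw [div_mul_eq_mul_div, le_div_iff₀ (by positivity)]
          linarith
        have h11 : y * (L + 2) * n / G ≤ n / (16 * G) * v := by
          rw [div_mul_eq_mul_div, div_le_div_iff₀ hG (by positivity)]
          have := mul_le_mul_of_nonneg_left hyL (by positivity : 0 ≤ n * G)
          linarith
        have h12 : n / (4 * G) * vh ≥ n / (4 * G) * (v / 2) := by gcongr
        have h13 : n / (4 * G) * (v / 2) = n / (16 * G) * v + n / (16 * G) * v := by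
          field_simp; ring
        rw [h8]; linarith
      have h14 : y * (t * bernKL ph a + vh / t) / vh =
          y * (t * bernKL ph a) / vh + y / t := by field_simp
      have h15 : n / (2 * G) = n / (4 * G) + n / (4 * G) := by field_simp; ring
      rw [h14, h15]; linarith
    have h16 : (p₀ - ph) * (a - ph) / vh ≤ n / (2 * G) :=
      le_trans (by gcongr) hfinal
    have h17 : n * (L + 3 / 2) / G = n * (L + 2) / G - n / (2 * G) := by field_simp; ring
    rw [h17, ← hKL, hchange]
    linarith
  refine ⟨?_, hKLlow⟩
  by_contra hlt
  push Not at hlt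
  have h3 := bernKL_le_sq hp0 hp1 (by linarith : 0 < a) (by linarith)
  have h4 : (a - p₀) ^ 2 ≤ y ^ 2 :=
    sq_le_sq' (by linarith [hyabs.1]) (by linarith)
  have h5 : (a - p₀) ^ 2 / v ≤ w ^ 2 / M := by
    rw [div_le_div_iff₀ hv0 hM]
    exact (mul_le_mul_of_nonneg_right h4 hM.le).trans hy2
  have h6 : w ^ 2 / M < n * (L + 3 / 2) / G := by
    rw [div_lt_div_iff₀ hM hG]
    have h7 : w ^ 2 * G * 1 ≤ w ^ 2 * G * (64 * (L + 2)) := by gcongr; linarith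
    have h8 : n * M * 1 < n * M * (L + 3 / 2) := by gcongr; linarith
    linarith
  linarith

/-- Type I error of the scan test. -/
lemma nullLaw_scanTest_le {n : ℕ} (hmN : m ≤ N) (hmn : m ≤ n) (hn : 1 ≤ n) (hnN : n ≤ N)
    {p₀ w : ℝ} (hp0 : 0 < p₀) (hp1 : p₀ < 1) (hw : 0 < w)
    (h1 : 256 * w ^ 2 * (Real.log ((N : ℝ) / n) + 2) ^ 2 ≤ N.choose m * (p₀ * (1 - p₀)))
    (h2 : 64 * w ^ 2 * (Real.log ((N : ℝ) / n) + 2) * n.choose m ≤ n * N.choose m) :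
    (nullLaw m N p₀).real (scanTest m N n) ≤ 1 / w ^ 2 + Real.exp (-((n : ℝ) / 2)) := by
  have hG : (0 : ℝ) < n.choose m := by exact_mod_cast Nat.choose_pos hmn
  have hM : (0 : ℝ) < N.choose m := by exact_mod_cast Nat.choose_pos hmN
  have hn0 : (0 : ℝ) < n := by exact_mod_cast hn
  have hL0 : 0 ≤ Real.log ((N : ℝ) / n) := by
    refine Real.log_nonneg ?_
    rw [le_div_iff₀ hn0, one_mul]; exact_mod_cast hnN
  have hexp := choose_le_exp hn hnN
  set L := Real.log ((N : ℝ) / n) with hL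
  set G : ℝ := (n.choose m : ℝ) with hGdef
  set M : ℝ := (N.choose m : ℝ)
  set v := p₀ * (1 - p₀) with hv
  have hv0 : 0 < v := mul_pos hp0 (by linarith)
  set E : Finset (Fin N) → Set (HGraph m N) := fun S => {A | p₀ ≤ edgesIn A S / G ∧
      n * (L + 3 / 2) / G ≤ bernKL p₀ (edgesIn A S / G)} with hE
  have hsub : scanTest m N n ⊆ {A | w ^ 2 * v / M ≤ (phat A - p₀) ^ 2} ∪
      ⋃ S ∈ (Finset.univ : Finset (Fin N)).powersetCard n, E S := by
    rintro A ⟨a, ⟨ha0, ha1⟩, hKL, hscan⟩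
    by_cases hcl : w ^ 2 * v / M ≤ (phat A - p₀) ^ 2
    · exact Or.inl hcl
    right
    obtain ⟨hpa, hlow⟩ := critical_value_bounds hp0 hp1 hG hM hn0 hL0 hw (not_le.1 hcl).le h1 h2
      ha0 ha1 hKL
    obtain ⟨S, hS, hSeq⟩ := exists_edgesIn_eq_scanStat hnN A
    rw [Set.mem_iUnion₂]
    refine ⟨S, Finset.mem_powersetCard.2 ⟨Finset.subset_univ _, hS⟩, ?_⟩
    have hx : a ≤ edgesIn A S / G := by
      rw [le_div_iff₀ hG, hSeq, mul_comm]; exact hscan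
    have hx1 : edgesIn A S / G ≤ 1 := by rw [div_le_one hG]; exact edgesIn_le A hS
    exact ⟨hpa.trans hx, hlow.trans (bernKL_mono hp0 hpa hx hx1)⟩
  refine (measureReal_mono hsub).trans ((measureReal_union_le _ _).trans (add_le_add ?_ ?_))
  · have hsum := sum_plantedProb (m := m) hmN (S := (∅ : Finset (Fin N))) rfl p₀ 0
    simp only [mul_zero, add_zero] at hsum
    rw [nullLaw_eq]
    refine (measureReal_phat_sub_sq_ge hmN (plantedProb_mem (m := m) (∅ : Finset (Fin N)) hp0.le
      le_rfl (by linarith)) hsum (by positivity)).trans (le_of_eq ?_)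
    rw [← hv]
    change v / (M * (w ^ 2 * v / M)) = _
    field_simp
  · refine (measureReal_biUnion_finset_le _ _).trans ?_
    calc ∑ S ∈ (Finset.univ : Finset (Fin N)).powersetCard n, (nullLaw m N p₀).real (E S)
        ≤ ∑ S ∈ (Finset.univ : Finset (Fin N)).powersetCard n,
            Real.exp (-(G * (n * (L + 3 / 2) / G))) :=
          Finset.sum_le_sum fun S hS => nullLaw_bernKL_edgesIn_le hmn
            (Finset.mem_powersetCard.1 hS).2 hp0 hp1 _
      _ = N.choose n * Real.exp (-(n * (L + 3 / 2))) := by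
          rw [Finset.sum_const, Finset.card_powersetCard, Finset.card_fin, nsmul_eq_mul,
            mul_div_cancel₀ _ hG.ne']
      _ ≤ Real.exp (n * (L + 1)) * Real.exp (-(n * (L + 3 / 2))) := by gcongr
      _ = _ := by rw [← Real.exp_add]; congr 1; ring

end Scan

/-! ### Type II error of the scan test -/

section ScanPlanted

variable {m N : ℕ}

lemma bernVar_mul_bernKL_le {p q : ℝ} (hp0 : 0 < p) (hpq : p < q) (hq1 : q < 1) :
    p * (1 - p) * bernKL p q ≤ (q - p) ^ 2 := by
  have hv : 0 < p * (1 - p) := mul_pos hp0 (by linarith)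
  have h := bernKL_le_sq hp0 (by linarith) (by linarith : 0 < q) hq1
  rw [le_div_iff₀ hv] at h
  linarith

/-- The relative variance of the edge frequency inside the planted set, in terms of the
divergence. -/
lemma planted_frequency_variance_le {p q : ℝ} (hp0 : 0 < p) (hpq : p < q) (hq1 : q < 1) :
    q * (1 - q) * bernKL p q ≤ 3 * (1 + Real.log (1 / p)) * (q - p) ^ 2 := by
  have hl : 0 ≤ Real.log (1 / p) := Real.log_nonneg (by rw [le_div_iff₀ hp0]; linarith)
  have hH := bernKL_nonneg hp0 (by linarith : p < 1) (by linarith : 0 ≤ q) hq1.le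
  have h1 := bernVar_mul_bernKL_le hp0 hpq hq1
  have h2 := bernKL_le_mul_log hp0 hpq.le hq1
  set H := bernKL p q
  set l := Real.log (1 / p)
  set D := q - p with hD
  have hD0 : 0 < D := by linarith
  have h3 : H ≤ 2 * (1 + l) * D := by
    rcases le_total p D with h | h
    · have : q * l ≤ 2 * D * l := by gcongr; linarith
      linarith
    · have h4 : D / 2 ≤ p * (1 - p) := by
        have h5 : D ≤ 1 - p := by linarith
        rcases le_total p (1 / 2) with h6 | h6 <;> nlinarith
      have h7 : D / 2 * H ≤ D ^ 2 := le_trans (by gcongr) h1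
      have h8 : H ≤ 2 * D := by
        refine le_of_mul_le_mul_left ?_ hD0
        linarith
      nlinarith
  have h9 : q * (1 - q) ≤ p * (1 - p) + D := by
    have : q = p + D := by linarith
    rw [this]; nlinarith
  calc q * (1 - q) * H ≤ (p * (1 - p) + D) * H := by gcongr
    _ = p * (1 - p) * H + D * H := by ring
    _ ≤ D ^ 2 + D * (2 * (1 + l) * D) := by gcongr
    _ ≤ _ := by nlinarith [mul_nonneg hl (sq_nonneg D)]

set_option maxHeartbeats 1000000 in
/-- On the typical event under the planted law, the frequency of edges inside the planted set
exceeds the critical value. Here `ph` is the estimated density, `x` the frequency of edges inside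
the planted set and `h` the critical level. If the planted edges raise the density by little
compared with `p (1 - p)`, the divergence from the estimated density is close to that from `p`;
otherwise it is at least of the order of `(q - p) log(N / n)`. -/
lemma le_bernKL_planted {p q p₀ ph x r M G n L w η h : ℝ} (hp0 : 0 < p) (hpq : p < q)
    (hq1 : q < 1) (hη0 : 0 < η) (hη1 : η < 1 / 2) (hr0 : 0 < r) (hr1 : r ≤ η / 100)
    (hp₀ : p₀ = p + r * (q - p)) (hM : 0 < M) (hG : 0 < G) (hrM : r * M = G)
    (hw : 0 < w) (hLr : r ≤ Real.exp (-L)) (hL : 2 * (Real.log (100 / η) + 1) ≤ L)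
    (hMH : 72 * w ^ 2 ≤ η ^ 2 * (M * bernKL p q)) (hMv : 72 * w ^ 2 ≤ η ^ 2 * (M * (p * (1 - p))))
    (hpM : 192 * n / η ≤ p * M) (hh : h ≤ (1 - 2 * η) * bernKL p q) (hh2 : G * h ≤ 2 * n * L)
    (hx1 : x ≤ 1) (hxl : (1 - η) * bernKL p q ≤ bernLLR p q x)
    (hxq : |x - q| ≤ (q - p) / 2) (hph : (ph - p₀) ^ 2 ≤ w ^ 2 * (p₀ * (1 - p₀)) / M) :
    0 < ph ∧ ph < 1 ∧ ph ≤ x ∧ h ≤ bernKL ph x := by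
  have hp1 : p < 1 := by linarith
  have hminK := min_le_bernKL hp0 hp1 hpq.le hq1.le
  have hvH := bernVar_mul_bernKL_le hp0 hpq hq1
  have hv0 : 0 < p * (1 - p) := mul_pos hp0 (by linarith)
  have hvp : p * (1 - p) ≤ p := by nlinarith
  have hv1p : p * (1 - p) ≤ 1 - p := by nlinarith
  have hHpos : 0 < bernKL p q := by
    by_contra hcon
    have : η ^ 2 * (M * bernKL p q) ≤ 0 := mul_nonpos_of_nonneg_of_nonpos (by positivity)
      (mul_nonpos_of_nonneg_of_nonpos hM.le (not_lt.1 hcon))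
    have : 0 < 72 * w ^ 2 := by positivity
    linarith
  set H := bernKL p q with hH
  set D := q - p with hD
  set v := p * (1 - p) with hv
  have hD0 : 0 < D := by linarith
  have hD1 : D ≤ 1 - p := by linarith
  set y := |ph - p₀| with hy
  have hy0 : 0 ≤ y := abs_nonneg _
  have hyabs := abs_le.1 (le_refl y)
  have hy2 : y ^ 2 * M ≤ w ^ 2 * (p₀ * (1 - p₀)) := by
    rw [hy, sq_abs]; rwa [le_div_iff₀ hM] at hph
  have hxabs := abs_le.1 hxq
  have hxlow : p + D / 2 ≤ x := by linarith [hxabs.1]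
  have hxhigh : x - p ≤ 3 / 2 * D := by linarith [hxabs.2]
  have hx0 : 0 ≤ x := by linarith
  have hrD : r * D ≤ D / 200 := by
    have : r * D ≤ 1 / 200 * D := by gcongr; linarith
    linarith
  have hp₀p : p ≤ p₀ := by rw [hp₀]; exact le_add_of_nonneg_right (by positivity)
  have hp₀1 : p₀ ≤ 1 := by rw [hp₀]; linarith
  by_cases hcase : 12 / η * (r * D) ≤ v
  · -- the planted edges hardly change the density
    have hrDv : r * D ≤ η / 12 * v := by
      rw [div_mul_eq_mul_div, div_le_iff₀ hη0] at hcase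
      linarith
    have hrDv' : r * D ≤ v := by
      have : η / 12 * v ≤ 1 * v := by gcongr; linarith
      linarith
    have hp₀v : p₀ * (1 - p₀) ≤ 2 * v := by
      have h1 : p₀ * (1 - p₀) = v + r * D - (2 * p * (r * D) + (r * D) ^ 2) := by
        rw [hp₀, hv]; ring
      have h2 : 0 ≤ 2 * p * (r * D) + (r * D) ^ 2 := by positivity
      linarith
    have hyM : y ^ 2 * M ≤ 2 * w ^ 2 * v := by
      refine hy2.trans ?_
      have := mul_le_mul_of_nonneg_left hp₀v (sq_nonneg w)
      linarith
    have hyv : 6 * y ≤ η * v := by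
      refine le_of_sq_le_sq ?_ (by positivity)
      refine le_of_mul_le_mul_right ?_ hM
      calc (6 * y) ^ 2 * M = 36 * (y ^ 2 * M) := by ring
        _ ≤ 36 * (2 * w ^ 2 * v) := by gcongr
        _ = (72 * w ^ 2) * v := by ring
        _ ≤ (η ^ 2 * (M * v)) * v := by gcongr
        _ = _ := by ring
    have hyD : 6 * y ≤ η * D := by
      refine le_of_sq_le_sq ?_ (by positivity)
      refine le_of_mul_le_mul_right ?_ (mul_pos hM hHpos)
      calc (6 * y) ^ 2 * (M * H) = 36 * H * (y ^ 2 * M) := by ring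
        _ ≤ 36 * H * (2 * w ^ 2 * v) := by gcongr
        _ = (72 * w ^ 2) * (v * H) := by ring
        _ ≤ (η ^ 2 * (M * H)) * D ^ 2 := by gcongr
        _ = _ := by ring
    have hyv' : y ≤ v / 12 := by
      have : η * v ≤ 1 / 2 * v := by gcongr
      linarith
    have hyD' : y ≤ D / 12 := by
      have : η * D ≤ 1 / 2 * D := by gcongr
      linarith
    have hph0 : 0 < ph := by linarith [hyabs.1]
    have hph1 : ph < 1 := by
      have : p₀ ≤ p + (1 - p) / 200 := by rw [hp₀]; linarith
      linarith [hyabs.2]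
    have hphx : ph ≤ x := by
      have : p₀ = p + r * D := hp₀
      linarith [hyabs.2]
    refine ⟨hph0, hph1, hphx, ?_⟩
    -- the change of the log-likelihood ratio is at most `η H`
    have hB := bernLLR_le hp0 hp1 hph0 hph1 hx0 hx1
    have hB2 : (ph - p) * (x - p) / v ≤ η * H := by
      rw [div_le_iff₀ hv0]
      have h1 : (ph - p) * (x - p) ≤ (r * D + y) * (3 / 2 * D) := by
        have h2 : ph - p ≤ r * D + y := by
          have : p₀ = p + r * D := hp₀
          linarith [hyabs.2]
        calc (ph - p) * (x - p) ≤ (r * D + y) * (x - p) :=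
              mul_le_mul_of_nonneg_right h2 (by linarith)
          _ ≤ _ := by gcongr
      refine h1.trans ?_
      have h3 : r * D * D ≤ η / 6 * (v * H) := by
        rcases le_total D (2 * v) with hc | hc
        · have := hminK.1 hc
          calc r * D * D = r * D ^ 2 := by ring
            _ ≤ r * (4 * v * H) := by gcongr
            _ = (4 * r) * (v * H) := by ring
            _ ≤ _ := by gcongr; linarith
        · have := hminK.2 hc
          calc r * D * D ≤ η / 12 * v * (2 * H) := by gcongr
            _ = _ := by ring
      have h4 : y * D ≤ η / 3 * (v * H) := by
        rcases le_total D (2 * v) with hc | hc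
        · have h5 := hminK.1 hc
          refine le_of_sq_le_sq ?_ (by positivity)
          refine le_of_mul_le_mul_right ?_ hM
          calc (y * D) ^ 2 * M = (y ^ 2 * M) * D ^ 2 := by ring
            _ ≤ (2 * w ^ 2 * v) * (4 * v * H) := by gcongr
            _ = 1 / 9 * (72 * w ^ 2) * (v ^ 2 * H) := by ring
            _ ≤ 1 / 9 * (η ^ 2 * (M * H)) * (v ^ 2 * H) := by gcongr
            _ = _ := by ring
        · have h5 := hminK.2 hc
          have h6 : y ≤ η / 6 * v := by linarith
          calc y * D ≤ η / 6 * v * (2 * H) := by gcongr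
            _ = _ := by ring
      have h7 : 0 ≤ η * (v * H) := by positivity
      linarith
    have hsplit : bernLLR ph q x = bernLLR p q x - bernLLR p ph x := by
      have e1 := bernKL_eq_add (x := x) hp0 hp1 (by linarith : 0 < q) hq1
      have e2 := bernKL_eq_add (x := x) hp0 hp1 hph0 hph1
      have e3 := bernKL_eq_add (x := x) hph0 hph1 (by linarith : 0 < q) hq1
      linarith
    have hfin := bernLLR_le_bernKL hph0 hph1 (by linarith : 0 < q) hq1 hx0 hx1
    rw [hsplit] at hfin
    change bernLLR p ph x ≤ (ph - p) * (x - p) / v at hB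
    linarith
  · -- the planted edges dominate the density
    push Not at hcase
    have hκr : 12 / η * r ≤ 3 / 25 := by
      rw [div_mul_eq_mul_div, div_le_iff₀ hη0]; linarith
    have hphalf : p ≤ 1 / 2 := by
      have h1 : v ≤ (3 / 25) * (1 - p) := by
        calc v ≤ 12 / η * (r * D) := hcase.le
          _ = 12 / η * r * D := by ring
          _ ≤ _ := by gcongr
      have h2 : p ≤ 3 / 25 := le_of_mul_le_mul_right (by rwa [hv] at h1) (by linarith : 0 < 1 - p)
      linarith
    have hpv : p ≤ 2 * v := by
      have : p * (1 / 2) ≤ p * (1 - p) := mul_le_mul_of_nonneg_left (by linarith) hp0.le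
      linarith
    have hpr : p ≤ 24 / η * (r * D) := by
      have : 24 / η * (r * D) = 2 * (12 / η * (r * D)) := by ring
      linarith
    have hη2 : 2 ≤ 1 / η := by rw [le_div_iff₀ hη0]; linarith
    have hp₀r : p₀ ≤ 25 / η * (r * D) := by
      have h1 : 25 / η * (r * D) = 24 / η * (r * D) + 1 / η * (r * D) := by ring
      have h2 : 1 * (r * D) ≤ 1 / η * (r * D) := by gcongr; linarith
      rw [hp₀]; linarith
    have hp₀0 : 0 < p₀ := by linarith
    have hyp : 2 * y ≤ p₀ := by
      refine le_of_sq_le_sq ?_ hp₀0.le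
      refine le_of_mul_le_mul_right ?_ hM
      have h1 : 4 * w ^ 2 ≤ M * p₀ := by
        have h2 : η ^ 2 * (M * v) ≤ 1 * (M * p₀) := by
          gcongr
          · exact pow_le_one₀ hη0.le (by linarith)
          · linarith
        have : 0 ≤ w ^ 2 := by positivity
        linarith
      calc (2 * y) ^ 2 * M = 4 * (y ^ 2 * M) := by ring
        _ ≤ 4 * (w ^ 2 * (p₀ * (1 - p₀))) := by gcongr
        _ ≤ 4 * (w ^ 2 * (p₀ * 1)) := by gcongr; linarith
        _ = 4 * w ^ 2 * p₀ := by ring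
        _ ≤ M * p₀ * p₀ := by gcongr
        _ = _ := by ring
    have hph0 : 0 < ph := by linarith [hyabs.1]
    have hphr : ph ≤ 50 / η * (r * D) := by
      have h1 : 50 / η * (r * D) = 2 * (25 / η * (r * D)) := by ring
      linarith [hyabs.2]
    have hphD : ph ≤ D / 2 := by
      refine hphr.trans ?_
      have : 50 / η * r ≤ 1 / 2 := by
        rw [div_mul_eq_mul_div, div_le_iff₀ hη0]; linarith
      calc 50 / η * (r * D) = 50 / η * r * D := by ring
        _ ≤ 1 / 2 * D := by gcongr
        _ = _ := by ring
    have hxpos : 0 < x := by linarith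
    have hph1 : ph < 1 := by linarith
    refine ⟨hph0, hph1, by linarith, ?_⟩
    refine le_trans ?_ (mul_log_sub_le_bernKL hph0 hph1 hx1)
    have hlog : L / 2 ≤ Real.log (x / ph) - 1 := by
      have h1 : Real.exp L * (η / 100) ≤ x / ph := by
        rw [le_div_iff₀ hph0]
        calc Real.exp L * (η / 100) * ph ≤ Real.exp L * (η / 100) * (50 / η * (r * D)) := by gcongr
          _ = Real.exp L * r * (D / 2) := by field_simp; norm_num
          _ ≤ Real.exp L * Real.exp (-L) * (D / 2) := by gcongr
          _ = D / 2 := by rw [← Real.exp_add]; simp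
          _ ≤ x := by linarith
      have h2 := Real.log_le_log (by positivity) h1
      rw [Real.log_mul (Real.exp_ne_zero _) (by positivity), Real.log_exp] at h2
      have h3 : Real.log (η / 100) = -Real.log (100 / η) := by
        rw [← Real.log_inv, inv_div]
      linarith
    have hL0 : 0 ≤ L := by
      have : 0 ≤ Real.log (100 / η) := Real.log_nonneg (by rw [le_div_iff₀ hη0]; linarith)
      linarith
    have hGD : 8 * n ≤ G * D := by
      have h1 : p * M ≤ 24 / η * (G * D) := by
        calc p * M ≤ 24 / η * (r * D) * M := by gcongr
          _ = 24 / η * (r * M * D) := by ring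
          _ = _ := by rw [hrM]
      have h2 : 24 / η * (8 * n) ≤ 24 / η * (G * D) := by
        refine le_trans (le_of_eq ?_) (hpM.trans h1)
        ring
      exact le_of_mul_le_mul_left h2 (by positivity)
    have hfin : h ≤ D / 2 * (L / 2) := by
      refine le_of_mul_le_mul_left (hh2.trans ?_) hG
      have := mul_le_mul_of_nonneg_right hGD hL0
      linarith
    refine hfin.trans ?_
    calc D / 2 * (L / 2) ≤ x * (Real.log (x / ph) - 1) :=
          mul_le_mul (by linarith) hlog (by linarith) hx0
      _ = _ := by ring

/-- The variance of the edge frequency inside the planted set. -/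
lemma integral_frequency_sub_sq {n : ℕ} (hmn : m ≤ n) {S : Finset (Fin N)} (hS : S.card = n)
    {p q : ℝ} (hp0 : 0 ≤ p) (hpq : p ≤ q) (hq1 : q ≤ 1) :
    ∫ A, ((edgesIn A S : ℝ) / n.choose m - q) ^ 2 ∂plantedLaw m N S p q =
      q * (1 - q) / n.choose m := by
  have hG : (0 : ℝ) < n.choose m := by exact_mod_cast Nat.choose_pos hmn
  have hq := plantedProb_mem (m := m) S hp0 (sub_nonneg.2 hpq) (by linarith)
  have h1 : ∀ A : HGraph m N, ((edgesIn A S : ℝ) / n.choose m - q) ^ 2 =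
      (∑ e, insideInd S e / n.choose m * (A.val e - plantedProb S p (q - p) e)) ^ 2 := by
    intro A
    congr 1
    have h2 : ∀ e : HEdge m N, insideInd S e / n.choose m *
        (A.val e - plantedProb S p (q - p) e) =
        insideInd S e * A.val e / n.choose m - q / n.choose m * insideInd S e := by
      intro e
      unfold plantedProb insideInd
      split_ifs
      · field_simp; ring
      · simp
    rw [Finset.sum_congr rfl fun e _ => h2 e, Finset.sum_sub_distrib, ← Finset.sum_div,
      ← edgesIn_eq, ← Finset.mul_sum, sum_insideInd hS, div_mul_cancel₀ _ hG.ne']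
  simp_rw [h1]
  rw [plantedLaw_eq, integral_linear_sq hq]
  have h3 : ∀ e : HEdge m N, (insideInd S e / n.choose m) ^ 2 *
      (plantedProb S p (q - p) e * (1 - plantedProb S p (q - p) e)) =
      q * (1 - q) / (n.choose m : ℝ) ^ 2 * insideInd S e := by
    intro e
    unfold plantedProb insideInd
    split_ifs
    · field_simp; ring
    · simp
  rw [Finset.sum_congr rfl fun e _ => h3 e, ← Finset.mul_sum, sum_insideInd hS]
  field_simp

set_option maxHeartbeats 1000000 in
/-- Type II error of the scan test. -/
lemma plantedLaw_scanTest_compl_le {n : ℕ} (hmN : m ≤ N) (hmn : m ≤ n)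
    {S : Finset (Fin N)} (hS : S.card = n) {p q w η : ℝ} (hn : 1 ≤ n) (hp0 : 0 < p) (hpq : p < q)
    (hq1 : q < 1) (hη0 : 0 < η) (hη1 : η < 1 / 2) (hw : 0 < w)
    (hr1 : (n.choose m : ℝ) / N.choose m ≤ η / 100)
    (hLr : (n.choose m : ℝ) / N.choose m ≤ n / N)
    (hL : 2 * (Real.log (100 / η) + 1) ≤ Real.log ((N : ℝ) / n))
    (hMH : 72 * w ^ 2 ≤ η ^ 2 * (N.choose m * bernKL p q))
    (hMv : 72 * w ^ 2 ≤ η ^ 2 * (N.choose m * (p * (1 - p))))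
    (hpM : 192 * n / η ≤ p * N.choose m)
    (hh : (n : ℝ) * (Real.log ((N : ℝ) / n) + 2) ≤
      (1 - 2 * η) * (n.choose m * bernKL p q)) :
    (plantedLaw m N S p q).real (scanTest m N n)ᶜ ≤
      16 / η ^ 2 * ((1 + Real.log (1 / p)) / (n.choose m * bernKL p q)) + 1 / w ^ 2 := by
  have hG : (0 : ℝ) < n.choose m := by exact_mod_cast Nat.choose_pos hmn
  have hM : (0 : ℝ) < N.choose m := by exact_mod_cast Nat.choose_pos hmN
  have hn0 : (0 : ℝ) < n := by exact_mod_cast hn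
  have hnN : n ≤ N := by rw [← hS]; simpa using Finset.card_le_univ S
  have hN0 : (0 : ℝ) < N := by exact_mod_cast (by omega : 0 < N)
  have hsum := sum_plantedProb (m := m) hmN hS p (q - p)
  have hqm := plantedProb_mem (m := m) S hp0.le (sub_nonneg.2 hpq.le) (by linarith)
  have hfreq := integral_frequency_sub_sq (m := m) (N := N) hmn hS hp0.le hpq.le hq1.le
  have hl : 0 ≤ Real.log (1 / p) := Real.log_nonneg (by rw [le_div_iff₀ hp0]; linarith)
  have hexpL : Real.exp (-Real.log ((N : ℝ) / n)) = n / N := by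
    rw [← Real.log_inv, inv_div, Real.exp_log (by positivity)]
  have hrM : (n.choose m : ℝ) / N.choose m * N.choose m = n.choose m := by field_simp
  have hL2 : 2 ≤ Real.log ((N : ℝ) / n) := by
    have : 0 ≤ Real.log (100 / η) := Real.log_nonneg (by rw [le_div_iff₀ hη0]; linarith)
    linarith
  have hvarL := bernLLR_variance_le hp0 hpq.le hq1
  have hvarF := planted_frequency_variance_le hp0 hpq hq1
  have hHpos : 0 < bernKL p q := by
    by_contra hcon
    have h1 : η ^ 2 * (N.choose m * bernKL p q) ≤ 0 :=
      mul_nonpos_of_nonneg_of_nonpos (by positivity)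
        (mul_nonpos_of_nonneg_of_nonpos hM.le (not_lt.1 hcon))
    have : 0 < 72 * w ^ 2 := by positivity
    linarith
  set L := Real.log ((N : ℝ) / n) with hLdef
  set G : ℝ := (n.choose m : ℝ) with hGdef
  set M : ℝ := (N.choose m : ℝ) with hMdef
  set r := G / M with hr
  set H := bernKL p q with hH
  set p₀ := p + r * (q - p) with hp₀
  set Λ := Real.log (q / p) - Real.log ((1 - q) / (1 - p)) with hΛ
  set l := Real.log (1 / p)
  have hr0 : 0 < r := by positivity
  have hp₀1 : p₀ < 1 := by
    have h1 : r * (q - p) ≤ 1 * (q - p) := by gcongr; linarith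
    linarith
  have hp₀0 : 0 < p₀ := by
    have : 0 < r * (q - p) := mul_pos hr0 (by linarith)
    linarith
  have hv₀ : 0 < p₀ * (1 - p₀) := mul_pos hp₀0 (by linarith)
  have hD0 : 0 < q - p := by linarith
  have hsub : (scanTest m N n)ᶜ ⊆
      ({A | (η * H) ^ 2 ≤ (Λ * ((edgesIn A S : ℝ) / G - q)) ^ 2} ∪
      {A | ((q - p) / 2) ^ 2 ≤ ((edgesIn A S : ℝ) / G - q) ^ 2}) ∪
      {A | w ^ 2 * (p₀ * (1 - p₀)) / M ≤ (phat A - p₀) ^ 2} := by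
    intro A hA
    by_contra hcon
    apply hA
    simp only [Set.mem_union, Set.mem_ofPred_eq, not_or, not_le] at hcon
    obtain ⟨⟨h1, h2⟩, h3⟩ := hcon
    set x : ℝ := (edgesIn A S : ℝ) / G with hx
    have hh2 : G * (n * (L + 2) / G) ≤ 2 * n * L := by
      have h4 : (n : ℝ) * (L + 2) ≤ n * (L + L) := by gcongr
      rw [mul_div_cancel₀ _ hG.ne']
      linarith
    have hx1 : x ≤ 1 := by rw [hx, div_le_one hG]; exact edgesIn_le A hS
    have h1' := abs_lt_of_sq_lt_sq h1 (by positivity)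
    have h2' := abs_lt_of_sq_lt_sq h2 (by positivity)
    have hLLR : (1 - η) * H ≤ bernLLR p q x := by
      have e : bernLLR p q x = H + Λ * (x - q) := by
        rw [hH, bernKL_eq_bernLLR, hΛ]; unfold bernLLR; ring
      rw [e]
      linarith [(abs_lt.1 h1').1]
    obtain ⟨hph0, hph1, hphx, hKL⟩ := le_bernKL_planted (x := x) (ph := phat A)
      (h := n * (L + 2) / G) hp0 hpq hq1 hη0
      hη1 hr0 hr1 hp₀ hM hG hrM hw (by rw [hexpL]; exact hLr) hL hMH hMv hpM
      (by rw [div_le_iff₀ hG]; linarith) hh2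
      hx1 hLLR h2'.le h3.le
    have hKL0 : bernKL (phat A) (phat A) = 0 := by
      have h5 : 1 - phat A ≠ 0 := by linarith
      simp [bernKL, div_self hph0.ne', div_self h5]
    obtain ⟨a, ⟨ha0, hax⟩, ha⟩ := intermediate_value_Icc hphx
      (continuous_bernKL hph0 hph1).continuousOn
      (show n * (L + 2) / G ∈ Set.Icc (bernKL (phat A) (phat A)) (bernKL (phat A) x) from
        ⟨by rw [hKL0]; positivity, hKL⟩)
    refine ⟨a, ⟨ha0, hax.trans hx1⟩, ha, ?_⟩
    have h6 : G * a ≤ edgesIn A S := by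
      rw [hx, le_div_iff₀ hG] at hax; linarith
    refine h6.trans ?_
    exact_mod_cast edgesIn_le_scanStat A hS
  have hb1 : (plantedLaw m N S p q).real
      {A | (η * H) ^ 2 ≤ (Λ * ((edgesIn A S : ℝ) / G - q)) ^ 2} ≤
      4 / η ^ 2 * ((1 + l) / (G * H)) := by
    refine (measureReal_le_integral_div _ (fun A => sq_nonneg _) (by positivity)).trans ?_
    simp_rw [mul_pow Λ]
    rw [integral_const_mul, hfreq, div_le_iff₀ (by positivity)]
    calc Λ ^ 2 * (q * (1 - q) / G) = Λ ^ 2 * (q * (1 - q)) / G := by ring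
      _ ≤ 4 * (1 + l) * H / G := by gcongr
      _ = _ := by field_simp
  have hb2 : (plantedLaw m N S p q).real
      {A | ((q - p) / 2) ^ 2 ≤ ((edgesIn A S : ℝ) / G - q) ^ 2} ≤
      12 / η ^ 2 * ((1 + l) / (G * H)) := by
    refine (measureReal_le_integral_div _ (fun A => sq_nonneg _) (by positivity)).trans ?_
    rw [hfreq]
    have h1 : q * (1 - q) / G / ((q - p) / 2) ^ 2 ≤ 12 * ((1 + l) / (G * H)) := by
      have h2 : q * (1 - q) ≤ 3 * (1 + l) * (q - p) ^ 2 / H := by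
        rw [le_div_iff₀ hHpos]; exact hvarF
      calc q * (1 - q) / G / ((q - p) / 2) ^ 2
          ≤ 3 * (1 + l) * (q - p) ^ 2 / H / G / ((q - p) / 2) ^ 2 := by gcongr
        _ = _ := by field_simp; norm_num
    refine h1.trans ?_
    have h3 : (12 : ℝ) ≤ 12 / η ^ 2 := by
      rw [le_div_iff₀ (by positivity)]
      have : η ^ 2 ≤ 1 := pow_le_one₀ hη0.le (by linarith)
      linarith
    gcongr
  have hb3 : (plantedLaw m N S p q).real
      {A | w ^ 2 * (p₀ * (1 - p₀)) / M ≤ (phat A - p₀) ^ 2} ≤ 1 / w ^ 2 := by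
    rw [plantedLaw_eq]
    refine (measureReal_phat_sub_sq_ge hmN hqm hsum (by positivity)).trans (le_of_eq ?_)
    change p₀ * (1 - p₀) / (M * (w ^ 2 * (p₀ * (1 - p₀)) / M)) = _
    generalize p₀ * (1 - p₀) = z at *
    field_simp
  refine (measureReal_mono hsub).trans ((measureReal_union_le _ _).trans (add_le_add
    ((measureReal_union_le _ _).trans (add_le_add hb1 hb2) |>.trans (le_of_eq ?_)) hb3))
  ring

end ScanPlanted

/-! ### Power of the scan test -/

section ScanPower

variable {m : ℕ} {n : ℕ → ℕ} {Θ : ℕ → Set (ℝ × ℝ)}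

lemma mul_prod_sub_eq {m n : ℕ} (hm : 1 ≤ m) (hmn : m ≤ n) :
    (n : ℝ) * ∏ j ∈ Finset.Icc 1 (m - 1), ((n : ℝ) - j) = m ! * n.choose m := by
  have h : ∀ k, k + 1 ≤ n →
      (n : ℝ) * ∏ j ∈ Finset.Icc 1 k, ((n : ℝ) - j) = n.descFactorial (k + 1) := by
    intro k
    induction k with
    | zero => intro _; simp
    | succ k ih =>
      intro hk
      rw [Finset.prod_Icc_succ_top (by omega), ← mul_assoc, ih (by omega),
        Nat.descFactorial_succ n (k + 1), Nat.cast_mul, Nat.cast_sub (by omega), mul_comm]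
  obtain ⟨j, rfl⟩ : ∃ j, m = j + 1 := ⟨m - 1, by omega⟩
  rw [Nat.add_sub_cancel, h j hmn, Nat.descFactorial_eq_factorial_mul_choose, Nat.cast_mul]

/-- The variance of an edge is not small compared with both the divergence and the density. -/
lemma min_bernKL_le_bernVar {p q : ℝ} (hp0 : 0 < p) (hpq : p ≤ q) (hq1 : q < 1) :
    min (bernKL p q) p ≤ 4 * (p * (1 - p)) := by
  rcases le_total p (1 / 2) with h | h
  · have : p * (1 / 2) ≤ p * (1 - p) := mul_le_mul_of_nonneg_left (by linarith) hp0.le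
    exact (min_le_right _ _).trans (by linarith)
  · have h1 := mul_bernKL_le_one_sub hp0 hpq hq1
    have h2 : 0 ≤ bernKL p q := bernKL_nonneg hp0 (by linarith) (by linarith) hq1.le
    have h3 : 1 / 2 * bernKL p q ≤ p * bernKL p q := by gcongr
    have h4 : 1 / 2 * (1 - p) ≤ p * (1 - p) := mul_le_mul_of_nonneg_right h (by linarith)
    exact (min_le_left _ _).trans (by linarith)

lemma bernVar_le_two_mul {p q r : ℝ} (hp0 : 0 ≤ p) (hpq : p ≤ q) (hq1 : q ≤ 1) (hr0 : 0 ≤ r)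
    (hr1 : r ≤ 1 / 2) :
    p * (1 - p) ≤ 2 * ((p + r * (q - p)) * (1 - (p + r * (q - p)))) := by
  have h1 : 0 ≤ r * (q - p) := mul_nonneg hr0 (by linarith)
  have h2 : r * (q - p) ≤ 1 / 2 * (1 - p) :=
    mul_le_mul hr1 (by linarith) (by linarith) (by norm_num)
  have h3 : p * ((1 - p) / 2) ≤ (p + r * (q - p)) * (1 - (p + r * (q - p))) :=
    mul_le_mul (by linarith) (by linarith) (by linarith) (by linarith)
  linarith

lemma eventually_le_log_ratio (hn : Tendsto n atTop atTop)
    (hnN : (fun N : ℕ => (n N : ℝ)) =o[atTop] fun N : ℕ => (N : ℝ)) (K : ℝ) :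
    ∀ᶠ N : ℕ in atTop, K ≤ Real.log ((N : ℝ) / n N) := by
  filter_upwards [eventually_mul_planted_size_le hnN (Real.exp K), hn.eventually_ge_atTop 1]
    with N h1 h2
  have hn0 : (0 : ℝ) < n N := by exact_mod_cast h2
  have h3 : Real.exp K ≤ (N : ℝ) / n N := by rwa [le_div_iff₀ hn0]
  simpa using Real.log_le_log (Real.exp_pos K) h3

lemma eventually_mul_log_sq_le (K : ℝ) :
    ∀ᶠ N : ℕ in atTop, K * (Real.log N + 2) ^ 2 ≤ N := by
  have h1 : (fun N : ℕ => Real.log (N : ℝ) ^ 2) =o[atTop] fun N : ℕ => (N : ℝ) :=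
    (Real.isLittleO_pow_log_id_atTop (n := 2)).comp_tendsto tendsto_natCast_atTop_atTop
  have h2 : Tendsto (fun N : ℕ => Real.log (N : ℝ)) atTop atTop :=
    Real.tendsto_log_atTop.comp tendsto_natCast_atTop_atTop
  have hK : 0 < 1 / (4 * (|K| + 1)) := by positivity
  filter_upwards [h1.bound hK, h2.eventually_ge_atTop 2] with N h3 h4
  rw [Real.norm_of_nonneg (by positivity), Real.norm_of_nonneg (by positivity), one_div,
    inv_mul_eq_div, le_div_iff₀ (by positivity)] at h3
  calc K * (Real.log N + 2) ^ 2 ≤ (|K| + 1) * (Real.log N + Real.log N) ^ 2 := by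
        gcongr; linarith [le_abs_self K]
    _ = Real.log N ^ 2 * (4 * (|K| + 1)) := by ring
    _ ≤ N := h3

/-- For `n² ≤ N` the logarithm of `N / n` is of the order of `log N` and `n` tends to infinity;
otherwise `n ≥ √N`. -/
lemma eventually_mul_log_le_mul_log_ratio (hn : Tendsto n atTop atTop)
    (hnN : (fun N : ℕ => (n N : ℝ)) =o[atTop] fun N : ℕ => (N : ℝ)) (K : ℝ) :
    ∀ᶠ N : ℕ in atTop, K * (1 + m * Real.log N) ≤ n N * Real.log ((N : ℝ) / n N) := by
  have hlog : Tendsto (fun N : ℕ => Real.log (N : ℝ)) atTop atTop :=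
    Real.tendsto_log_atTop.comp tendsto_natCast_atTop_atTop
  have hnR : Tendsto (fun N => (n N : ℝ)) atTop atTop := tendsto_natCast_atTop_atTop.comp hn
  filter_upwards [eventually_le_log_ratio hn hnN 1,
    eventually_mul_log_sq_le ((|K| * (m + 1)) ^ 2), hlog.eventually_ge_atTop 1,
    hnR.eventually_ge_atTop (2 * (|K| * (m + 1))), hnR.eventually_ge_atTop 1,
    eventually_ge_atTop 1] with N h1 h2 h3 h4 h5 h6
  have hN0 : (0 : ℝ) < N := by exact_mod_cast h6
  have hn0 : (0 : ℝ) < n N := by linarith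
  have h7 : K * (1 + m * Real.log N) ≤ |K| * (m + 1) * Real.log N := by
    calc K * (1 + m * Real.log N) ≤ |K| * (Real.log N + m * Real.log N) := by
          gcongr; exact le_abs_self K
      _ = _ := by ring
  refine h7.trans ?_
  rcases le_total ((n N : ℝ) ^ 2) N with hc | hc
  · have h8 : Real.log N ≤ 2 * Real.log ((N : ℝ) / n N) := by
      have h9 : (N : ℝ) ≤ ((N : ℝ) / n N) ^ 2 := by
        rw [div_pow, le_div_iff₀ (by positivity)]
        calc (N : ℝ) * (n N : ℝ) ^ 2 ≤ N * N := by gcongr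
          _ = _ := by ring
      have h10 := Real.log_le_log hN0 h9
      rwa [Real.log_pow, Nat.cast_ofNat] at h10
    calc |K| * (m + 1) * Real.log N
        ≤ |K| * (m + 1) * (2 * Real.log ((N : ℝ) / n N)) := by gcongr
      _ = 2 * (|K| * (m + 1)) * Real.log ((N : ℝ) / n N) := by ring
      _ ≤ _ := by gcongr
  · have h8 : |K| * (m + 1) * (Real.log N + 2) ≤ n N := by
      refine le_of_sq_le_sq ?_ hn0.le
      rw [mul_pow]
      exact h2.trans hc
    have h9 : 0 ≤ |K| * (m + 1) := by positivity
    calc |K| * (m + 1) * Real.log N ≤ |K| * (m + 1) * (Real.log N + 2) := by gcongr; linarith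
      _ ≤ n N * 1 := by linarith
      _ ≤ _ := by gcongr

lemma log_inv_le {m N n : ℕ} {p : ℝ} (hm : 1 ≤ m) (hn : 1 ≤ n) (hnN : n ≤ N) (hp : 0 < p)
    (h : (n : ℝ) ≤ N * ((n : ℝ) ^ (m - 1) * p)) : Real.log (1 / p) ≤ m * Real.log N := by
  have hn1 : (1 : ℝ) ≤ n := by exact_mod_cast hn
  have hnN' : (n : ℝ) ≤ N := by exact_mod_cast hnN
  rw [← Real.log_pow]
  refine Real.log_le_log (by positivity) ?_
  rw [div_le_iff₀ hp]
  calc (1 : ℝ) ≤ n := hn1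
    _ ≤ N * ((n : ℝ) ^ (m - 1) * p) := h
    _ ≤ N * ((N : ℝ) ^ (m - 1) * p) := by gcongr
    _ = (N : ℝ) ^ (m - 1 + 1) * p := by ring
    _ = _ := by rw [Nat.sub_add_cancel hm]

/-- The scan test is asymptotically powerful above the sharp information threshold. -/
theorem scanTest_powerful (hm : 2 ≤ m) (hn : Tendsto n atTop atTop)
    (hnN : (fun N : ℕ => (n N : ℝ)) =o[atTop] fun N : ℕ => (N : ℝ))
    (hΘ : ∀ᶠ N in atTop, ∀ p ∈ Θ N,
      0 < p.1 ∧ p.1 < p.2 ∧ p.2 < 1 ∧ 0 < matchedProb m N (n N) p.1 p.2)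
    (hr : ∀ᶠ N : ℕ in atTop, ∀ p ∈ Θ N,
      (n N : ℝ) ≤ N * ((n N : ℝ) ^ (m - 1) * matchedProb m N (n N) p.1 p.2))
    (hMp : ∀ᶠ N : ℕ in atTop, ∀ p ∈ Θ N,
      chooseConst m * N ≤ N.choose m * matchedProb m N (n N) p.1 p.2)
    {c : ℝ} (hc : 1 < c)
    (hI : ∀ᶠ N in atTop, ∀ p ∈ Θ N,
      c ≤ (∏ j ∈ Finset.Icc 1 (m - 1), ((n N : ℝ) - (j : ℝ))) *
            bernKL (matchedProb m N (n N) p.1 p.2) p.2 /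
          ((m ! : ℝ) * Real.log ((N : ℝ) / (n N : ℝ)))) :
    AsympPowerful m n Θ fun N => scanTest m N (n N) := by
  refine asympPowerful_of_errorsLE fun ε hε => ?_
  -- the margin is chosen such that `(1 - 2η) c = 1 + η`
  set η : ℝ := (c - 1) / (1 + 2 * c) with hηdef
  have hη0 : 0 < η := div_pos (by linarith) (by linarith)
  have hη1 : η < 1 / 2 := by rw [hηdef, div_lt_div_iff₀ (by linarith) (by norm_num)]; linarith
  have hηc : (1 - 2 * η) * c = 1 + η := by
    have : 1 + 2 * c ≠ 0 := by linarith
    rw [hηdef]; field_simp; ring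
  obtain ⟨w, hw, hw2⟩ : ∃ w : ℝ, 0 < w ∧ w ^ 2 = 2 / ε :=
    ⟨Real.sqrt (2 / ε), Real.sqrt_pos.2 (by positivity), Real.sq_sqrt (by positivity)⟩
  have hwε : 1 / w ^ 2 = ε / 2 := by rw [hw2, one_div_div]
  set κ : ℝ := min (chooseConst m) 1 with hκ
  have hκ0 : 0 < κ := lt_min (chooseConst_pos m) one_pos
  have hnR : Tendsto (fun N => (n N : ℝ)) atTop atTop := tendsto_natCast_atTop_atTop.comp hn
  have hexp : ∀ᶠ N in atTop, Real.exp (-((n N : ℝ) / 2)) ≤ ε / 2 := by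
    have h : Tendsto (fun N => Real.exp (-((n N : ℝ) / 2))) atTop (𝓝 0) :=
      Real.tendsto_exp_neg_atTop_nhds_zero.comp (hnR.atTop_div_const two_pos)
    exact h.eventually_le_const (by positivity)
  have hNR : Tendsto (fun N : ℕ => (N : ℝ)) atTop atTop := tendsto_natCast_atTop_atTop
  filter_upwards [hΘ, hr, hMp, hI, hn.eventually_ge_atTop m, eventually_planted_size_lt hn hnN,
    eventually_le_log_ratio hn hnN (max (2 * (Real.log (100 / η) + 1)) (2 / η)),
    eventually_mul_planted_size_le hnN (100 / η),
    hNR.eventually_ge_atTop (72 * w ^ 2 / (η ^ 2 * (κ / 4))),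
    eventually_mul_planted_size_le hnN (192 / η / chooseConst m),
    eventually_mul_log_sq_le (256 * w ^ 2 / (κ / 8)), eventually_mul_log_sq_le (64 * w ^ 2), hexp,
    eventually_mul_log_le_mul_log_ratio (m := m) hn hnN (16 / η ^ 2 * (2 / ε))]
    with N hΘ hr hMp hI hmn hnN hLK hrη hNw hNn hlog1 hlog2 hexp hnL p hp
  obtain ⟨-, h01, h11, hp0⟩ := hΘ p hp
  have hr := hr p hp
  have hMp := hMp p hp
  have hI := hI p hp
  have hmN : m ≤ N := by omega
  have hpq := matchedProb_lt (by omega) hmN hnN h01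
  have havg := eq_matchedProb_add (by omega) hmN hnN p.1 p.2
  have hG : (0 : ℝ) < (n N).choose m := by exact_mod_cast Nat.choose_pos hmn
  have hM : (0 : ℝ) < N.choose m := by exact_mod_cast Nat.choose_pos hmN
  have hn0 : (0 : ℝ) < n N := by exact_mod_cast (by omega : 0 < n N)
  have hN0 : (0 : ℝ) < N := by exact_mod_cast (by omega : 0 < N)
  have hNG : (N : ℝ) * (n N).choose m ≤ n N * N.choose m := mul_choose_le (by omega) hnN.le
  have hprod := mul_prod_sub_eq (by omega : 1 ≤ m) hmn
  have hloginv := log_inv_le (by omega) (by omega) hnN.le hp0 hr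
  have hmin := min_bernKL_le_bernVar hp0 hpq.le h11
  have hfac : (0 : ℝ) < m ! := by exact_mod_cast Nat.factorial_pos m
  have hL1 := (le_max_left _ _).trans hLK
  have hL2 := (le_max_right _ _).trans hLK
  have hLN : Real.log ((N : ℝ) / n N) ≤ Real.log N := by
    refine Real.log_le_log (by positivity) (div_le_self hN0.le ?_)
    exact_mod_cast (by omega : 1 ≤ n N)
  set P := matchedProb m N (n N) p.1 p.2 with hP
  set H := bernKL P p.2 with hH
  set L := Real.log ((N : ℝ) / n N) with hL
  set G : ℝ := ((n N).choose m : ℝ)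
  set M : ℝ := (N.choose m : ℝ)
  have hL4 : 4 ≤ L := by
    refine le_trans ?_ hL2
    rw [le_div_iff₀ hη0]; linarith
  have hGH : c * (n N * L) ≤ G * H := by
    rw [le_div_iff₀ (by positivity)] at hI
    refine le_of_mul_le_mul_left ?_ hfac
    calc (m ! : ℝ) * (c * (n N * L)) = n N * (c * (m ! * L)) := by ring
      _ ≤ n N * ((∏ j ∈ Finset.Icc 1 (m - 1), ((n N : ℝ) - (j : ℝ))) * H) := by gcongr
      _ = n N * (∏ j ∈ Finset.Icc 1 (m - 1), ((n N : ℝ) - (j : ℝ))) * H := by ring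
      _ = _ := by rw [hprod]; ring
  have hnL0 : 0 < n N * L := by positivity
  have hGH1 : n N * L ≤ G * H := le_trans (le_mul_of_one_le_left hnL0.le hc.le) hGH
  have hH0 : 0 < H := pos_of_mul_pos_right (hnL0.trans_le hGH1) hG.le
  have hrn : G / M ≤ n N / N := by
    rw [div_le_div_iff₀ hM hN0]; linarith
  have hrη' : G / M ≤ η / 100 := by
    refine hrn.trans ?_
    rw [div_mul_eq_mul_div, div_le_iff₀ hη0] at hrη
    rw [div_le_div_iff₀ hN0 (by norm_num)]
    linarith
  have hMH : (N : ℝ) ≤ M * H := by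
    refine le_of_mul_le_mul_left ?_ hG
    calc G * N = N * G := mul_comm _ _
      _ ≤ n N * M := hNG
      _ ≤ n N * M * L := le_mul_of_one_le_right (by positivity) (by linarith)
      _ = M * (n N * L) := by ring
      _ ≤ M * (G * H) := by gcongr
      _ = _ := by ring
  have hMH' : κ * N ≤ M * H := by
    have : κ * N ≤ 1 * N := by gcongr; exact min_le_right _ _
    linarith
  have hMP' : κ * N ≤ M * P := by
    have : κ * N ≤ chooseConst m * N := by gcongr; exact min_le_left _ _
    linarith
  have hMv : κ / 4 * N ≤ M * (P * (1 - P)) := by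
    have h1 : κ * N ≤ M * min H P := by
      rcases min_choice H P with h | h <;> rw [h] <;> assumption
    have h2 : M * min H P ≤ M * (4 * (P * (1 - P))) := by gcongr
    linarith
  have hNw' : 72 * w ^ 2 ≤ η ^ 2 * (κ / 4 * N) := by
    rw [div_le_iff₀ (by positivity)] at hNw
    linarith
  have hMv₀ : κ / 8 * N ≤ M * (p.1 * (1 - p.1)) := by
    have h1 := bernVar_le_two_mul hp0.le hpq.le h11.le (by positivity : 0 ≤ G / M)
      (by linarith)
    rw [← havg] at h1
    have h2 : M * (P * (1 - P)) ≤ M * (2 * (p.1 * (1 - p.1))) := by gcongr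
    linarith
  have hp10 : 0 < p.1 := by
    rw [havg]
    have : 0 < p.2 - P := by linarith
    positivity
  refine ⟨?_, fun S hS => ?_⟩
  · refine (nullLaw_scanTest_le hmN hmn (by omega) hnN.le hp10 (h01.trans h11) hw ?_ ?_).trans ?_
    · refine le_trans ?_ hMv₀
      rw [div_mul_eq_mul_div, div_le_iff₀ (by positivity)] at hlog1
      have : 256 * w ^ 2 * (L + 2) ^ 2 ≤ 256 * w ^ 2 * (Real.log N + 2) ^ 2 := by gcongr
      linarith
    · have h1 : 64 * w ^ 2 * (L + 2) ≤ N := by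
        refine le_trans ?_ hlog2
        gcongr
        calc L + 2 ≤ Real.log N + 2 := by linarith
          _ ≤ _ := le_self_pow₀ (by linarith) two_ne_zero
      exact (mul_le_mul_of_nonneg_right h1 hG.le).trans hNG
    · rw [hwε]; linarith
  · refine (plantedLaw_scanTest_compl_le hmN hmn hS (by omega) hp0 hpq h11 hη0 hη1 hw hrη' hrn hL1
      ?_ ?_ ?_ ?_).trans ?_
    · refine hNw'.trans (mul_le_mul_of_nonneg_left ?_ (by positivity))
      have : 0 ≤ κ * N := by positivity
      linarith
    · exact hNw'.trans (mul_le_mul_of_nonneg_left hMv (by positivity))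
    · rw [div_mul_eq_mul_div, div_le_iff₀ (chooseConst_pos m)] at hNn
      have : 192 * (n N : ℝ) / η = 192 / η * n N := by ring
      linarith
    · have h1 : 2 ≤ η * L := by
        rw [div_le_iff₀ hη0] at hL2; linarith
      calc (n N : ℝ) * (L + 2) ≤ n N * (L + η * L) := by gcongr
        _ = (1 + η) * (n N * L) := by ring
        _ = (1 - 2 * η) * (c * (n N * L)) := by rw [← hηc]; ring
        _ ≤ _ := mul_le_mul_of_nonneg_left hGH (by linarith)
    · rw [hwε]
      have h1 : 16 / η ^ 2 * ((1 + Real.log (1 / P)) / (G * H)) ≤ ε / 2 := by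
        rw [mul_div_assoc', div_le_iff₀ (by positivity)]
        have h2 : 16 / η ^ 2 * (1 + Real.log (1 / P)) ≤ 16 / η ^ 2 * (1 + m * Real.log N) := by
          gcongr
        refine h2.trans ?_
        calc 16 / η ^ 2 * (1 + m * Real.log N)
            = ε / 2 * (16 / η ^ 2 * (2 / ε) * (1 + m * Real.log N)) := by field_simp
          _ ≤ ε / 2 * (n N * L) := by gcongr
          _ ≤ _ := by gcongr
      linarith

end ScanPower

/-! ### The three tests -/

theorem theorem5 (m : ℕ) (hm : 2 ≤ m) (n : ℕ → ℕ) (Θ : ℕ → Set (ℝ × ℝ))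
    -- standing assumptions on the vertex numbers and the parameter sets
    (hnN : (fun N : ℕ => (n N : ℝ)) =o[atTop] fun N : ℕ => (N : ℝ))
    (hΘ : ∀ᶠ N in atTop, ∀ p ∈ Θ N,
      0 < p.1 ∧ p.1 < p.2 ∧ p.2 < 1 ∧ 0 < matchedProb m N (n N) p.1 p.2)
    -- the rate conditions
    (hlog : (fun N : ℕ => Real.log (N : ℝ)) =o[atTop] fun N : ℕ => (n N : ℝ) ^ (m - 1))
    (hrate : ∀ ε : ℝ, 0 < ε → ∀ᶠ N in atTop, ∀ p ∈ Θ N,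
      Real.log (max 1 (1 / ((n N : ℝ) ^ (m - 1) * matchedProb m N (n N) p.1 p.2))) ≤
        ε * Real.log ((N : ℝ) / (n N : ℝ))) :
    -- (I) the scan test with the estimated edge density
    ((∀ᶠ N in atTop, ∀ p ∈ Θ N, 2 * (n N : ℝ) < p.1 * (N : ℝ) ^ m) →
      (∃ c : ℝ, 1 < c ∧ ∀ᶠ N in atTop, ∀ p ∈ Θ N,
        c ≤ (∏ j ∈ Finset.Icc 1 (m - 1), ((n N : ℝ) - (j : ℝ))) *
              bernKL (matchedProb m N (n N) p.1 p.2) p.2 /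
            ((m ! : ℝ) * Real.log ((N : ℝ) / (n N : ℝ)))) →
      AsympPowerful m n Θ fun N => scanTest m N (n N)) ∧
    -- (II) the loose 2-path test
    ((∃ c : ℝ, 1 < c ∧ ∀ᶠ N in atTop, ∀ p ∈ Θ N, c ≤ (N : ℝ) ^ (m - 1) * p.1) →
      ((fun N : ℕ => Real.sqrt (N : ℝ)) =O[atTop] fun N : ℕ => (n N : ℝ)) →
      SignalDiverges m n Θ →
      ∃ τ : ℕ → ℝ, AsympPowerful m n Θ fun N => {A | τ N < looseStat A}) ∧
    -- (III) the tight 2-path test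
    (((fun N : ℕ => (n N : ℝ)) =o[atTop] fun N : ℕ => Real.sqrt (N : ℝ)) →
      SignalDiverges m n Θ →
      ∃ τ : ℕ → ℝ, AsympPowerful m n Θ fun N => {A | τ N < tightStat A}) := by
  have hn := tendsto_planted_size hlog
  have hr := eventually_le_matchedProb hn hΘ hrate
  have hMp : ∀ᶠ N : ℕ in atTop, ∀ p ∈ Θ N,
      chooseConst m * N ≤ N.choose m * matchedProb m N (n N) p.1 p.2 := by
    filter_upwards [hr, hn.eventually_ge_atTop 1, eventually_planted_size_lt hn hnN,
      eventually_ge_atTop (4 * m)] with N h1 h2 h3 h4 p hp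
    exact le_choose_mul_matchedProb hm h2 h3.le h4 (h1 p hp)
  exact ⟨fun _ ⟨_, hc, hI⟩ => scanTest_powerful hm hn hnN hΘ hr hMp hc hI,
    fun _ hO hS => looseStat_powerful hm hn hnN hΘ hr hMp hO hS,
    fun ho hS => tightStat_powerful hm hn hnN hΘ hr hMp ho hS⟩
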